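/- Let $J(p,q)=(-q,p)$ on $\mathbb{R}^{2n}=\mathbb{R}^n_p\times\mathbb{R}^n_q$. Let $K\subset\mathbb{R}^{2n}$ be a convex body (compact, convex, with non-empty interior), and let $N_K(x)=\{v:\langle v,x-y\rangle\ge 0\ \forall y\in K\}$. A closed characteristic on $\partial K$ is a non-constant curve $\gamma\in W^{1,2}([0,T],\partial K)$, $T>0$, with $\gamma(0)=\gamma(T)$ and $-J\dot\gamma(t)\in N_K(\gamma(t))$ for almost every $t$. Its action is $\mathcal A(\gamma)=\frac12\int_0^T\langle -J\dot\gamma,\gamma\rangle\,dt$. The capacity $c_{\mathrm{EHZ}}(K)$ is the minimal action of a closed characteristic on $\partial K$, and a systole of $K$ is a closed characteristic on $\partial K$ of minimal action. Let $u$ be a unit vector, let $H=\{x:\langle x,u\rangle=h\}$ be a hyperplane that meets the interior of $K$, and put $K_1=K\cap\{\langle x,u\rangle\ge h\}$ and $K_2=K\cap\{\langle x,u\rangle\le h\}$. Call the cut additive if $c_{\mathrm{EHZ}}(K)=c_{\mathrm{EHZ}}(K_1)+c_{\mathrm{EHZ}}(K_2)$. 1. The cut is additive if and only if there are a systole $\gamma:[0,T]\to\partial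 K$ of $K$ and times $0\le t_1<t_2\le T$ with $\gamma(t_1),\gamma(t_2)\in H$ and $\gamma(t_2)-\gamma(t_1)\in\mathbb{R}_{>0}\,Ju$. 2. For every such $\gamma,t_1,t_2$, the restriction of $\gamma$ to $[t_1,t_2]$ followed by the segment $[\gamma(t_2),\gamma(t_1)]$ is a systole of $K_1$, and the complementary arc of $\gamma$, from $\gamma(t_2)$ to $\gamma(t_1)$, followed by the segment $[\gamma(t_1),\gamma(t_2)]$ is a systole of $K_2$. 3. If the cut is additive, then every pair of systoles $\gamma_1:[0,T_1]\to\partial K_1$, $\gamma_2:[0,T_2]\to\partial K_2$ can be glued, up to translations, to a systole of $K$, in the following sense. (a) After a suitable choice of the starting points of the closed curves $\gamma_1,\gamma_2$, there are integrable functions $\alpha_i:[0,T_i]\to[0,\infty)$, vanishing where $\gamma_i\notin H$, with $-J\dot\gamma_1+\alpha_1u\in N_K(\gamma_1)$ and $-J\dot\gamma_2-\alpha_2u\in N_K(\gamma_2)$ almost everywhere, and vectors $x_1,x_2$, such that $\eta_1(t)=x_1+\gamma_1(t)+\int_0^t\alpha_1\,Ju$ on $[0,T_1]$ followed by $\eta_2(t)=x_2+\gamma_2(t)-\int_0^t\alpha_2\,Ju$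 on $[0,T_2]$ is a systole $\gamma$ of $K$ (that is, the motions of $\gamma_1,\gamma_2$ along $H$ in the directions $-Ju$, $Ju$ are deleted and what remains is translated and concatenated). Moreover $\gamma(0),\gamma(T_1)\in H$ and $\gamma(T_1)-\gamma(0)\in\mathbb{R}_{>0}\,Ju$. (b) Suppose that there are $a_i\in[0,T_i]$ such that almost everywhere $-J\dot\gamma_i\in N_K(\gamma_i)$ on $[0,a_i]$, while $\dot\gamma_1\in-\mathbb{R}_{\ge0}Ju$ on $[a_1,T_1]$ and $\dot\gamma_2\in\mathbb{R}_{\ge0}Ju$ on $[a_2,T_2]$; that is, each $\gamma_i$ is an arc followed by a single chord. Then there are vectors $x_1,x_2$ such that $\gamma_1|_{[0,a_1]}+x_1$ followed by $\gamma_2|_{[0,a_2]}+x_2$ is a systole $\gamma$ of $K$, with $\gamma(0),\gamma(a_1)\in H$ and $\gamma(a_1)-\gamma(0)\in\mathbb{R}_{>0}\,Ju$. -/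

import Mathlib

open MeasureTheory Set
open scoped RealInnerProductSpace

noncomputable section

/-- `ℝ²ⁿ` with its Euclidean structure. The coordinates indexed by `Sum.inl` are
`p₁, …, pₙ` and those indexed by `Sum.inr` are `q₁, …, qₙ`. -/
abbrev PhaseSpace (n : ℕ) : Type := EuclideanSpace ℝ (Fin n ⊕ Fin n)

/-- The standard complex structure `J (p, q) = (-q, p)`, so that `ω(v, w) = ⟪J v, w⟫` for
`ω = ∑ dpᵢ ∧ dqᵢ`. -/
def stdJ (n : ℕ) : PhaseSpace n →L[ℝ] PhaseSpace n :=
  Matrix.toEuclideanCLM (n := Fin n ⊕ Fin n) (𝕜 := ℝ) (Matrix.J (Fin n) ℝ)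

/-- The normal cone of `K` at `x`. -/
def normalCone {n : ℕ} (K : Set (PhaseSpace n)) (x : PhaseSpace n) : Set (PhaseSpace n) :=
  {v | ∀ y ∈ K, 0 ≤ ⟪v, x - y⟫}

/-- The Sobolev class `W^{1,2}([0,T], ℝ²ⁿ)`: absolutely continuous curves with square integrable
derivative. Only the values of `γ` on `[0,T]` matter, here and below. -/
def IsW12 {n : ℕ} (T : ℝ) (γ : ℝ → PhaseSpace n) : Prop :=
  AbsolutelyContinuousOnInterval γ 0 T ∧ MemLp (deriv γ) 2 (volume.restrict (Icc 0 T))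

/-- `γ : [0,T] → ∂K` is a (generalized, non-constant) closed characteristic on `∂K`. -/
structure IsClosedCharacteristic {n : ℕ} (K : Set (PhaseSpace n)) (T : ℝ)
    (γ : ℝ → PhaseSpace n) : Prop where
  period_pos : 0 < T
  isW12 : IsW12 T γ
  closed : γ 0 = γ T
  mem_frontier : ∀ t ∈ Icc 0 T, γ t ∈ frontier K
  velocity_mem : ∀ᵐ t ∂(volume.restrict (Icc 0 T)), -(stdJ n (deriv γ t)) ∈ normalCone K (γ t)
  nonconstant : ∃ t ∈ Icc 0 T, γ t ≠ γ 0

/-- The symplectic action `½ ∫₀ᵀ ⟪-J γ', γ⟫ dt = ½ ∫ ∑ (pᵢ dqᵢ - qᵢ dpᵢ)` of a closed curve. -/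
def action {n : ℕ} (T : ℝ) (γ : ℝ → PhaseSpace n) : ℝ :=
  (1 / 2) * ∫ t in (0 : ℝ)..T, ⟪-(stdJ n (deriv γ t)), γ t⟫

/-- The Ekeland–Hofer–Zehnder capacity: the minimal action of a closed characteristic. -/
def ehzCapacity {n : ℕ} (K : Set (PhaseSpace n)) : ℝ :=
  sInf {a | ∃ T γ, IsClosedCharacteristic K T γ ∧ action T γ = a}

/-- `γ : [0,T] → ∂K` is a systole: an action-minimizing closed characteristic. -/
def IsSystole {n : ℕ} (K : Set (PhaseSpace n)) (T : ℝ) (γ : ℝ → PhaseSpace n) : Prop :=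
  IsClosedCharacteristic K T γ ∧
    ∀ T' γ', IsClosedCharacteristic K T' γ' → action T γ ≤ action T' γ'

/-- The hyperplane with normal `u` at height `h`. -/
def hyperplane {n : ℕ} (u : PhaseSpace n) (h : ℝ) : Set (PhaseSpace n) := {x | ⟪u, x⟫ = h}

/-- The piece `K₁` of `K`, on the side of the hyperplane into which `u` points. -/
def upperPiece {n : ℕ} (K : Set (PhaseSpace n)) (u : PhaseSpace n) (h : ℝ) :
    Set (PhaseSpace n) := K ∩ {x | h ≤ ⟪u, x⟫}

/-- The piece `K₂` of `K`, on the other side. -/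
def lowerPiece {n : ℕ} (K : Set (PhaseSpace n)) (u : PhaseSpace n) (h : ℝ) :
    Set (PhaseSpace n) := K ∩ {x | ⟪u, x⟫ ≤ h}

/-- Additivity of the capacity for the cut of `K` by the hyperplane. -/
def IsAdditiveCut {n : ℕ} (K : Set (PhaseSpace n)) (u : PhaseSpace n) (h : ℝ) : Prop :=
  ehzCapacity K = ehzCapacity (upperPiece K u h) + ehzCapacity (lowerPiece K u h)

/-- The curve on `[0,T]` meets the hyperplane at the times `t₁ < t₂`, and
`γ(t₂) - γ(t₁)` is a positive multiple of `J u`. -/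
def SplitsAt {n : ℕ} (u : PhaseSpace n) (h T : ℝ) (γ : ℝ → PhaseSpace n) (t₁ t₂ : ℝ) : Prop :=
  0 ≤ t₁ ∧ t₁ < t₂ ∧ t₂ ≤ T ∧ γ t₁ ∈ hyperplane u h ∧ γ t₂ ∈ hyperplane u h ∧
    ∃ c : ℝ, 0 < c ∧ γ t₂ - γ t₁ = c • stdJ n u

/-- Run through `α` on `[0,a]`, then through `β`, started at time `a`. -/
def concatAt {n : ℕ} (a : ℝ) (α β : ℝ → PhaseSpace n) : ℝ → PhaseSpace n :=
  fun s => if s ≤ a then α s else β (s - a)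

/-- The straight segment from `x` to `y`, on `[0,1]`. -/
def segmentPath {n : ℕ} (x y : PhaseSpace n) : ℝ → PhaseSpace n := fun s => x + s • (y - x)

/-- The closed curve `γ` on `[0,T]`, started at time `s ∈ [0,T]` instead of `0`. -/
def rotate {n : ℕ} (T s : ℝ) (γ : ℝ → PhaseSpace n) : ℝ → PhaseSpace n :=
  concatAt (T - s) (fun r => γ (s + r)) γ

/-- The arc of `γ` from `t₁` to `t₂`, closed by the segment `[γ(t₂), γ(t₁)]`;
a curve on `[0, (t₂ - t₁) + 1]`. -/
def innerLoop {n : ℕ} (γ : ℝ → PhaseSpace n) (t₁ t₂ : ℝ) : ℝ → PhaseSpace n :=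
  concatAt (t₂ - t₁) (fun r => γ (t₁ + r)) (segmentPath (γ t₂) (γ t₁))

/-- The complementary arc of `γ`, from `t₂` through `T ∼ 0` to `t₁`, closed by the segment
`[γ(t₁), γ(t₂)]`; a curve on `[0, (T - t₂ + t₁) + 1]`. -/
def outerLoop {n : ℕ} (T : ℝ) (γ : ℝ → PhaseSpace n) (t₁ t₂ : ℝ) : ℝ → PhaseSpace n :=
  concatAt (T - t₂ + t₁) (rotate T t₂ γ) (segmentPath (γ t₁) (γ t₂))

/-- On `[0,a]` the curve `γ` moves by the characteristic directions of `K`, and on `[a,T]` it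
moves along a straight line in the direction `-J u`. -/
def IsArcThenChord {n : ℕ} (K : Set (PhaseSpace n)) (u : PhaseSpace n) (T a : ℝ)
    (γ : ℝ → PhaseSpace n) : Prop :=
  a ∈ Icc 0 T ∧
  (∀ᵐ t ∂(volume.restrict (Icc 0 a)), -(stdJ n (deriv γ t)) ∈ normalCone K (γ t)) ∧
  (∀ᵐ t ∂(volume.restrict (Icc a T)), ∃ c : ℝ, 0 ≤ c ∧ deriv γ t = -(c • stdJ n u))

/-- `η` arises from `γ` by a translation and by deleting the motion of `γ` along the hyperplane
`H` in the direction `-J u`: the velocity of `γ` is `J w(t) - α(t) J u` where `w(t)` is normal to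
`K` at `γ(t)` and `α ≥ 0` vanishes off `H`, and the velocity of `η` is `J w(t)`. -/
def StripsTo {n : ℕ} (K H : Set (PhaseSpace n)) (u : PhaseSpace n) (T : ℝ)
    (γ η : ℝ → PhaseSpace n) : Prop :=
  ∃ (x : PhaseSpace n) (α : ℝ → ℝ),
    (∀ t, 0 ≤ α t) ∧ IntervalIntegrable α volume 0 T ∧
    (∀ t ∈ Icc 0 T, γ t ∉ H → α t = 0) ∧
    (∀ᵐ t ∂(volume.restrict (Icc 0 T)),
      -(stdJ n (deriv γ t)) + α t • u ∈ normalCone K (γ t)) ∧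
    ∀ t ∈ Icc 0 T, η t = x + γ t + (∫ r in (0 : ℝ)..t, α r) • stdJ n u

end

/-!
For a closed curve `γ` let `L(γ) = ∫ h_K(-J γ')` be its length measured by the support function of
`K`. Maximizing the action among closed curves of bounded length gives the isoperimetric inequality
`4 c(K) 𝒜(γ) ≤ L(γ)²`, whose extremals are, up to translation and scaling, the systoles. So
`c(K) ≤ 𝒜(γ)` whenever `L(γ) ≤ 2 𝒜(γ)` and `0 < 𝒜(γ)`.

Gluing. Deleting from a closed characteristic of a piece of `K` its motion along the hyperplane
leaves an arc whose end points differ by a multiple of `J u`. Two such arcs, from characteristics of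
actions `A₁`, `A₂` of the two pieces, close up after scaling the second one by the ratio `c` of the
two multiples, to a curve of action `A₁ + c² A₂` and length `2 (A₁ + c A₂)`. The isoperimetric
inequality and `(A₁ + c A₂)² = (A₁ + A₂) (A₁ + c² A₂) - A₁ A₂ (1 - c)²` give `c(K) ≤ A₁ + A₂`, and
equality forces `c = 1`: the unscaled arcs already close up, to a systole.

Splitting. When a systole of `K` is cut into two loops by a chord in direction `J u`, the chord
contributes to length and action in such a way that `L ≤ 2 𝒜` for each loop, where `L` is measured
by the support function of the corresponding piece. The two actions add up to `c(K)`, which by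
gluing is at most the sum of the capacities of the pieces, so both loops have minimal action.
-/

noncomputable section

open Filter Topology

section ComplexStructure

variable {n : ℕ}

theorem stdJ_stdJ (x : PhaseSpace n) : stdJ n (stdJ n x) = -x := by
  have hsq : stdJ n * stdJ n = -1 := by
    rw [stdJ, ← map_mul, Matrix.J_squared, map_neg, map_one]
  simpa using DFunLike.congr_fun hsq x

theorem inner_stdJ_left (x y : PhaseSpace n) : ⟪stdJ n x, y⟫ = -⟪x, stdJ n y⟫ := by
  have hstar : star (stdJ n) = -stdJ n := by
    rw [stdJ, ← map_star, Matrix.star_eq_conjTranspose,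
      Matrix.conjTranspose_eq_transpose_of_trivial, Matrix.J_transpose, map_neg]
  rw [← ContinuousLinearMap.adjoint_inner_right, ← ContinuousLinearMap.star_eq_adjoint, hstar]
  simp

theorem inner_stdJ_right (x y : PhaseSpace n) : ⟪x, stdJ n y⟫ = -⟪stdJ n x, y⟫ := by
  rw [inner_stdJ_left, neg_neg]

theorem inner_stdJ_stdJ (x y : PhaseSpace n) : ⟪stdJ n x, stdJ n y⟫ = ⟪x, y⟫ := by
  rw [inner_stdJ_left, stdJ_stdJ, inner_neg_right, neg_neg]

theorem inner_self_stdJ (x : PhaseSpace n) : ⟪x, stdJ n x⟫ = 0 := by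
  linarith [inner_stdJ_right x x, real_inner_comm x (stdJ n x)]

theorem inner_stdJ_self (x : PhaseSpace n) : ⟪stdJ n x, x⟫ = 0 := by
  rw [real_inner_comm, inner_self_stdJ]

theorem norm_stdJ (x : PhaseSpace n) : ‖stdJ n x‖ = ‖x‖ := by
  rw [norm_eq_sqrt_real_inner, norm_eq_sqrt_real_inner, inner_stdJ_stdJ]

theorem neg_stdJ_smul_stdJ (c : ℝ) (x : PhaseSpace n) : -(stdJ n (c • stdJ n x)) = c • x := by
  rw [map_smul, stdJ_stdJ, smul_neg, neg_neg]

end ComplexStructure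

section AbsoluteContinuity

open AbsolutelyContinuousOnInterval in
theorem absolutelyContinuousOnInterval_of_dist_le {X Y Z : Type*} [PseudoMetricSpace X]
    [PseudoMetricSpace Y] [PseudoMetricSpace Z] {f : ℝ → X} {g : ℝ → Y} {k : ℝ → Z} {a b C : ℝ}
    (hg : AbsolutelyContinuousOnInterval g a b) (hk : AbsolutelyContinuousOnInterval k a b)
    (hle : ∀ s ∈ uIcc a b, ∀ t ∈ uIcc a b,
      dist (f s) (f t) ≤ C * (dist (g s) (g t) + dist (k s) (k t))) :
    AbsolutelyContinuousOnInterval f a b := by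
  have hlim := (Tendsto.add hg hk).const_mul C
  rw [add_zero, mul_zero] at hlim
  have hmem : ∀ᶠ E : ℕ × (ℕ → ℝ × ℝ) in totalLengthFilter ⊓ 𝓟 (disjWithin a b),
      E ∈ disjWithin a b := eventually_inf_principal.mpr (by simp)
  refine squeeze_zero' (Eventually.of_forall fun E => Finset.sum_nonneg fun _ _ => dist_nonneg)
    ?_ hlim
  filter_upwards [hmem] with E hE
  rw [← Finset.sum_add_distrib, Finset.mul_sum]
  exact Finset.sum_le_sum fun i hi => hle _ (hE.1 i hi).1 _ (hE.1 i hi).2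

variable {E : Type*} [NormedAddCommGroup E]

theorem absolutelyContinuousOnInterval_primitive [NormedSpace ℝ E] {f : ℝ → E} {a b c : ℝ}
    (hf : IntervalIntegrable f volume a b) (hc : c ∈ uIcc a b) :
    AbsolutelyContinuousOnInterval (fun x => ∫ t in c..x, f t) a b := by
  have hnorm := hf.norm.absolutelyContinuousOnInterval_intervalIntegral hc
  have hint : ∀ x ∈ uIcc a b, IntervalIntegrable f volume c x := fun x hx =>
    hf.mono_set (uIcc_subset_uIcc hc hx)
  refine absolutelyContinuousOnInterval_of_dist_le hnorm hnorm (C := 1) fun s hs t ht => ?_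
  rw [dist_eq_norm, dist_eq_norm,
    intervalIntegral.integral_interval_sub_left (hint s hs) (hint t ht),
    intervalIntegral.integral_interval_sub_left (hint s hs).norm (hint t ht).norm, Real.norm_eq_abs]
  linarith [abs_nonneg (∫ x in t..s, ‖f x‖), intervalIntegral.norm_integral_le_abs_integral_norm
    (f := f) (a := t) (b := s) (μ := volume)]

theorem absolutelyContinuousOnInterval_inner [InnerProductSpace ℝ E] {f g : ℝ → E} {a b : ℝ}
    (hf : AbsolutelyContinuousOnInterval f a b) (hg : AbsolutelyContinuousOnInterval g a b) :
    AbsolutelyContinuousOnInterval (fun t => ⟪f t, g t⟫) a b := by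
  obtain ⟨C, hC⟩ := hf.exists_bound
  obtain ⟨D, hD⟩ := hg.exists_bound
  refine absolutelyContinuousOnInterval_of_dist_le hf hg (C := max C D) fun s hs t ht => ?_
  rw [Real.dist_eq, dist_eq_norm, dist_eq_norm]
  calc |⟪f s, g s⟫ - ⟪f t, g t⟫| = |⟪f s - f t, g s⟫ + ⟪f t, g s - g t⟫| := by
        rw [inner_sub_left, inner_sub_right]; congr 1; ring
    _ ≤ ‖f s - f t‖ * ‖g s‖ + ‖f t‖ * ‖g s - g t‖ := (abs_add_le _ _).trans
        (add_le_add (abs_real_inner_le_norm _ _) (abs_real_inner_le_norm _ _))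
    _ ≤ ‖f s - f t‖ * max C D + max C D * ‖g s - g t‖ := by
        gcongr
        · exact (hD s hs).trans (le_max_right _ _)
        · exact (hC t ht).trans (le_max_left _ _)
    _ = max C D * (‖f s - f t‖ + ‖g s - g t‖) := by ring

end AbsoluteContinuity

section IntervalIntegrals

variable {E : Type*} [NormedAddCommGroup E]

theorem intervalIntegral_congr_ae_Icc [NormedSpace ℝ E] {a b : ℝ} (hab : a ≤ b) {f g : ℝ → E}
    (h : ∀ᵐ t ∂(volume.restrict (Icc a b)), f t = g t) :
    ∫ t in a..b, f t = ∫ t in a..b, g t := by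
  refine intervalIntegral.integral_congr_ae_restrict ?_
  rw [uIoc_of_le hab]
  exact ae_restrict_of_ae_restrict_of_subset Ioc_subset_Icc_self h

theorem intervalIntegrable_of_memLp_two {a b : ℝ} (hab : a ≤ b) {v : ℝ → E}
    (h : MemLp v 2 (volume.restrict (Icc a b))) : IntervalIntegrable v volume a b := by
  rw [intervalIntegrable_iff_integrableOn_Icc_of_le hab]
  exact h.integrable (by norm_num)

theorem memLp_two_of_continuousOn {a b : ℝ} {v : ℝ → E} (hv : ContinuousOn v (Icc a b)) :
    MemLp v 2 (volume.restrict (Icc a b)) := by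
  obtain ⟨C, hC⟩ := isCompact_Icc.exists_bound_of_continuousOn hv
  exact MemLp.of_bound (hv.aestronglyMeasurable measurableSet_Icc) C
    ((ae_restrict_mem measurableSet_Icc).mono fun t ht => hC t ht)

theorem integral_inner_const [InnerProductSpace ℝ E] [CompleteSpace E] {w : ℝ → E} {a b : ℝ}
    (hw : IntervalIntegrable w volume a b) (x : E) :
    ∫ t in a..b, ⟪w t, x⟫ = ⟪∫ t in a..b, w t, x⟫ := by
  simpa only [innerSL_apply_apply, real_inner_comm x] using
    (innerSL ℝ x).intervalIntegral_comp_comm hw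

theorem intervalIntegrable_inner [InnerProductSpace ℝ E] {w y : ℝ → E} {a b : ℝ}
    (hw : IntervalIntegrable w volume a b) (hy : ContinuousOn y (uIcc a b)) :
    IntervalIntegrable (fun t => ⟪w t, y t⟫) volume a b := by
  obtain ⟨C, hC⟩ := isCompact_uIcc.exists_bound_of_continuousOn hy
  rw [intervalIntegrable_iff] at hw ⊢
  refine (innerSL ℝ).integrable_of_bilin_of_bdd_right C hw
    ((hy.mono uIoc_subset_uIcc).aestronglyMeasurable measurableSet_uIoc) ?_
  exact (ae_restrict_mem measurableSet_uIoc).mono fun t ht => hC t (uIoc_subset_uIcc ht)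

end IntervalIntegrals

/-- `γ` is a curve on `[0,T]` of class `W^{1,2}` with velocity `v`. Carrying the velocity along as
data makes it possible to prescribe it; `deriv γ` agrees with it only almost everywhere. -/
structure HasVelocity {E : Type*} [NormedAddCommGroup E] [NormedSpace ℝ E] (T : ℝ)
    (γ v : ℝ → E) : Prop where
  nonneg : 0 ≤ T
  memLp : MemLp v 2 (volume.restrict (Icc 0 T))
  eq_add : ∀ t ∈ Icc 0 T, γ t = γ 0 + ∫ r in (0 : ℝ)..t, v r

namespace HasVelocity

section NormedSpace

variable {E F : Type*} [NormedAddCommGroup E] [NormedSpace ℝ E] [NormedAddCommGroup F]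
  [NormedSpace ℝ F] {T : ℝ} {γ v : ℝ → E}

theorem zero_mem (h : HasVelocity T γ v) : (0 : ℝ) ∈ Icc 0 T := ⟨le_rfl, h.nonneg⟩

theorem intervalIntegrable (h : HasVelocity T γ v) {a b : ℝ} (ha : a ∈ Icc 0 T)
    (hb : b ∈ Icc 0 T) : IntervalIntegrable v volume a b :=
  (intervalIntegrable_of_memLp_two h.nonneg h.memLp).mono_set
    (uIcc_subset_uIcc (by rwa [uIcc_of_le h.nonneg]) (by rwa [uIcc_of_le h.nonneg]))

theorem intervalIntegrable_right (h : HasVelocity T γ v) : IntervalIntegrable v volume 0 T :=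
  intervalIntegrable_of_memLp_two h.nonneg h.memLp

theorem sub_eq (h : HasVelocity T γ v) {a b : ℝ} (ha : a ∈ Icc 0 T) (hb : b ∈ Icc 0 T) :
    γ b - γ a = ∫ t in a..b, v t := by
  rw [h.eq_add a ha, h.eq_add b hb, ← intervalIntegral.integral_interval_sub_left
    (h.intervalIntegrable h.zero_mem hb) (h.intervalIntegrable h.zero_mem ha)]
  abel

theorem norm_sub_le (h : HasVelocity T γ v) {a b : ℝ} (ha : a ∈ Icc 0 T) (hb : b ∈ Icc 0 T)
    (hab : a ≤ b) : ‖γ b - γ a‖ ≤ ∫ t in a..b, ‖v t‖ := by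
  rw [h.sub_eq ha hb]
  exact intervalIntegral.norm_integral_le_integral_norm hab

theorem integral_norm_mono (h : HasVelocity T γ v) {a b a' b' : ℝ} (ha : 0 ≤ a) (haa : a ≤ a')
    (hab : a' ≤ b') (hbb : b' ≤ b) (hb : b ≤ T) :
    ∫ t in a'..b', ‖v t‖ ≤ ∫ t in a..b, ‖v t‖ :=
  intervalIntegral.integral_mono_interval haa hab hbb (Eventually.of_forall fun _ => norm_nonneg _)
    (h.intervalIntegrable ⟨ha, by linarith⟩ ⟨by linarith, hb⟩).norm

theorem absolutelyContinuous (h : HasVelocity T γ v) : AbsolutelyContinuousOnInterval γ 0 T := by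
  have hprim := absolutelyContinuousOnInterval_primitive h.intervalIntegrable_right left_mem_uIcc
  refine absolutelyContinuousOnInterval_of_dist_le hprim hprim (C := 1) fun s hs t ht => ?_
  rw [uIcc_of_le h.nonneg] at hs ht
  rw [h.eq_add s hs, h.eq_add t ht, dist_add_left]
  linarith [dist_nonneg (x := ∫ x in (0 : ℝ)..s, v x) (y := ∫ x in (0 : ℝ)..t, v x)]

theorem continuousOn (h : HasVelocity T γ v) : ContinuousOn γ (Icc 0 T) := by
  simpa [uIcc_of_le h.nonneg] using h.absolutelyContinuous.continuousOn

theorem ae_hasDerivAt [CompleteSpace E] (h : HasVelocity T γ v) :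
    ∀ᵐ t ∂(volume.restrict (Icc 0 T)), HasDerivAt γ (v t) t := by
  rw [ae_restrict_congr_set Ioo_ae_eq_Icc.symm, ae_restrict_iff' measurableSet_Ioo]
  filter_upwards [h.intervalIntegrable_right.ae_hasDerivAt_integral] with t ht htIoo
  have hderiv := (ht (by rw [uIcc_of_le h.nonneg]; exact Ioo_subset_Icc_self htIoo) 0
    left_mem_uIcc).const_add (γ 0)
  refine hderiv.congr_of_eventuallyEq ?_
  filter_upwards [Icc_mem_nhds htIoo.1 htIoo.2] with s hs
  exact h.eq_add s hs

theorem ae_deriv_eq [CompleteSpace E] (h : HasVelocity T γ v) :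
    ∀ᵐ t ∂(volume.restrict (Icc 0 T)), deriv γ t = v t :=
  h.ae_hasDerivAt.mono fun _ ht => ht.deriv

theorem primitive (hT : 0 ≤ T) (hv : MemLp v 2 (volume.restrict (Icc 0 T))) (x : E) :
    HasVelocity T (fun t => x + ∫ r in (0 : ℝ)..t, v r) v :=
  ⟨hT, hv, fun t _ => by simp⟩

theorem of_hasDerivAt [CompleteSpace E] (hT : 0 ≤ T) (h : ∀ t, HasDerivAt γ (v t) t)
    (hv : Continuous v) : HasVelocity T γ v := by
  refine ⟨hT, memLp_two_of_continuousOn hv.continuousOn, fun t _ => ?_⟩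
  rw [intervalIntegral.integral_eq_sub_of_hasDerivAt (fun s _ => h s) (hv.intervalIntegrable _ _)]
  abel

theorem add {y v' : ℝ → E} (h : HasVelocity T γ v) (h' : HasVelocity T y v') :
    HasVelocity T (fun t => γ t + y t) (fun t => v t + v' t) := by
  refine ⟨h.nonneg, h.memLp.add h'.memLp, fun t ht => ?_⟩
  rw [intervalIntegral.integral_add (h.intervalIntegrable h.zero_mem ht)
    (h'.intervalIntegrable h.zero_mem ht), h.eq_add t ht, h'.eq_add t ht]
  abel

theorem add_const (h : HasVelocity T γ v) (x : E) : HasVelocity T (fun t => γ t + x) v := by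
  refine ⟨h.nonneg, h.memLp, fun t ht => ?_⟩
  rw [h.eq_add t ht]
  abel

theorem const_smul (h : HasVelocity T γ v) (c : ℝ) :
    HasVelocity T (fun t => c • γ t) (fun t => c • v t) := by
  refine ⟨h.nonneg, h.memLp.const_smul c, fun t ht => ?_⟩
  rw [intervalIntegral.integral_smul, h.eq_add t ht, smul_add]

variable [CompleteSpace E] [CompleteSpace F]

theorem integral_map (h : HasVelocity T γ v) (L : E →L[ℝ] F) {a b : ℝ} (ha : a ∈ Icc 0 T)
    (hb : b ∈ Icc 0 T) : ∫ t in a..b, L (v t) = L (γ b - γ a) := by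
  rw [L.intervalIntegral_comp_comm (h.intervalIntegrable ha hb), h.sub_eq ha hb]

theorem map (h : HasVelocity T γ v) (L : E →L[ℝ] F) :
    HasVelocity T (fun t => L (γ t)) (fun t => L (v t)) := by
  refine ⟨h.nonneg, L.comp_memLp' h.memLp, fun t ht => ?_⟩
  rw [h.integral_map L h.zero_mem ht, map_sub]
  abel

end NormedSpace

theorem integral_inner_add_integral_inner {E : Type*} [NormedAddCommGroup E]
    [InnerProductSpace ℝ E] [CompleteSpace E] {T : ℝ} {γ v y w : ℝ → E} (hγ : HasVelocity T γ v)
    (hy : HasVelocity T y w) :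
    (∫ t in (0 : ℝ)..T, ⟪v t, y t⟫) + ∫ t in (0 : ℝ)..T, ⟪w t, γ t⟫ =
      ⟪γ T, y T⟫ - ⟪γ 0, y 0⟫ := by
  have hACγ := hγ.absolutelyContinuous
  have hACy := hy.absolutelyContinuous
  rw [← (absolutelyContinuousOnInterval_inner hACγ hACy).integral_deriv_eq_sub,
    ← intervalIntegral.integral_add
      (intervalIntegrable_inner hγ.intervalIntegrable_right hACy.continuousOn)
      (intervalIntegrable_inner hy.intervalIntegrable_right hACγ.continuousOn)]
  refine intervalIntegral_congr_ae_Icc hγ.nonneg ?_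
  filter_upwards [hγ.ae_hasDerivAt, hy.ae_hasDerivAt] with t htγ hty
  rw [(htγ.inner ℝ hty).deriv, real_inner_comm (γ t) (w t), add_comm]

variable {n : ℕ} {T : ℝ} {γ v : ℝ → PhaseSpace n}

theorem isW12 (h : HasVelocity T γ v) : IsW12 T γ :=
  ⟨h.absolutelyContinuous, h.memLp.ae_eq (h.ae_deriv_eq.mono fun _ ht => ht.symm)⟩

theorem action_eq (h : HasVelocity T γ v) :
    action T γ = (1 / 2) * ∫ t in (0 : ℝ)..T, ⟪-(stdJ n (v t)), γ t⟫ := by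
  rw [action, intervalIntegral_congr_ae_Icc h.nonneg (h.ae_deriv_eq.mono fun t ht => by rw [ht])]

theorem neg_stdJ (h : HasVelocity T γ v) :
    HasVelocity T (fun t => -(stdJ n (γ t))) (fun t => -(stdJ n (v t))) :=
  h.map (-stdJ n)

theorem intervalIntegrable_inner_neg_stdJ (h : HasVelocity T γ v) {y : ℝ → PhaseSpace n}
    (hy : ContinuousOn y (Icc 0 T)) :
    IntervalIntegrable (fun t => ⟪-(stdJ n (v t)), y t⟫) volume 0 T :=
  intervalIntegrable_inner h.neg_stdJ.intervalIntegrable_right (by rwa [uIcc_of_le h.nonneg])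

theorem integral_inner_neg_stdJ_const (h : HasVelocity T γ v) (x : PhaseSpace n) {a b : ℝ}
    (ha : a ∈ Icc 0 T) (hb : b ∈ Icc 0 T) :
    ∫ t in a..b, ⟪-(stdJ n (v t)), x⟫ = ⟪-(stdJ n (γ b - γ a)), x⟫ := by
  rw [integral_inner_const (h.neg_stdJ.intervalIntegrable ha hb), ← h.neg_stdJ.sub_eq ha hb,
    map_sub]
  congr 1
  abel

theorem integral_inner_neg_stdJ_const_of_closed (h : HasVelocity T γ v) (hc : γ 0 = γ T)
    (x : PhaseSpace n) : ∫ t in (0 : ℝ)..T, ⟪-(stdJ n (v t)), x⟫ = 0 := by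
  rw [h.integral_inner_neg_stdJ_const x h.zero_mem ⟨h.nonneg, le_rfl⟩, hc]
  simp

theorem integral_inner_neg_stdJ_comm {y w : ℝ → PhaseSpace n} (h : HasVelocity T γ v)
    (h' : HasVelocity T y w) (hc : γ 0 = γ T) (hc' : y 0 = y T) :
    ∫ t in (0 : ℝ)..T, ⟪-(stdJ n (v t)), y t⟫ = ∫ t in (0 : ℝ)..T, ⟪-(stdJ n (w t)), γ t⟫ := by
  have hparts := h.neg_stdJ.integral_inner_add_integral_inner h'
  rw [← hc, ← hc', sub_self] at hparts
  simp only [inner_neg_left, inner_neg_right, inner_stdJ_right,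
    intervalIntegral.integral_neg] at hparts ⊢
  linarith

theorem action_add_const (h : HasVelocity T γ v) (hc : γ 0 = γ T) (x : PhaseSpace n) :
    action T (fun t => γ t + x) = action T γ := by
  rw [(h.add_const x).action_eq, h.action_eq]
  simp only [inner_add_right]
  rw [intervalIntegral.integral_add (h.intervalIntegrable_inner_neg_stdJ h.continuousOn)
    (h.intervalIntegrable_inner_neg_stdJ continuousOn_const),
    h.integral_inner_neg_stdJ_const_of_closed hc, add_zero]

theorem action_const_smul (h : HasVelocity T γ v) (c : ℝ) :
    action T (fun t => c • γ t) = c ^ 2 * action T γ := by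
  rw [(h.const_smul c).action_eq, h.action_eq]
  have hint : ∀ t, ⟪-(stdJ n (c • v t)), c • γ t⟫ = c ^ 2 * ⟪-(stdJ n (v t)), γ t⟫ := fun t => by
    rw [map_smul, ← smul_neg, real_inner_smul_left, real_inner_smul_right]; ring
  simp only [hint, intervalIntegral.integral_const_mul]
  ring

end HasVelocity

section Sobolev

variable {n : ℕ} {T : ℝ} {γ : ℝ → PhaseSpace n}

theorem IsW12.hasVelocity (hT : 0 ≤ T) (h : IsW12 T γ) : HasVelocity T γ (deriv γ) := by
  have hint := intervalIntegrable_of_memLp_two hT h.2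
  have hAC : AbsolutelyContinuousOnInterval (fun t => γ t - ∫ r in (0 : ℝ)..t, deriv γ r) 0 T :=
    h.1.sub (absolutelyContinuousOnInterval_primitive hint left_mem_uIcc)
  obtain ⟨C, hC⟩ := hAC.const_of_ae_hasDerivAt_zero (by
    filter_upwards [h.1.boundedVariationOn.ae_differentiableAt_of_mem_uIcc,
      hint.ae_hasDerivAt_integral] with t hdiff hprim ht
    have hderiv := (hdiff ht).hasDerivAt.sub (hprim ht 0 left_mem_uIcc)
    rwa [sub_self] at hderiv)
  rw [uIcc_of_le hT] at hC
  have hC₀ := hC 0 ⟨le_rfl, hT⟩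
  simp only [intervalIntegral.integral_same, sub_zero] at hC₀
  refine ⟨hT, h.2, fun t ht => ?_⟩
  rw [hC₀, ← hC t ht, sub_add_cancel]

theorem hasVelocity_of_lipschitzWith {C : NNReal} (h : LipschitzWith C γ) (hT : 0 ≤ T) :
    HasVelocity T γ (deriv γ) :=
  IsW12.hasVelocity hT ⟨(h.lipschitzOnWith (s := uIcc 0 T)).absolutelyContinuousOnInterval,
    MemLp.of_bound (aestronglyMeasurable_deriv _ _) C
      (Eventually.of_forall fun _ => norm_deriv_le_of_lipschitz h)⟩

end Sobolev

section SupportFunction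

/-- The support function `w ↦ max {⟪w, y⟫ : y ∈ K}` of a compact set `K`. -/
def supportFn {E : Type*} [NormedAddCommGroup E] [InnerProductSpace ℝ E] (K : Set E) (w : E) : ℝ :=
  sSup ((fun y => ⟪w, y⟫) '' K)

theorem exists_closedBall_subset_of_mem_interior {X : Type*} [PseudoMetricSpace X] {K : Set X}
    {p : X} (hp : p ∈ interior K) : ∃ r, 0 < r ∧ Metric.closedBall p r ⊆ K :=
  Metric.nhds_basis_closedBall.mem_iff.1 (mem_interior_iff_mem_nhds.1 hp)

variable {E : Type*} [NormedAddCommGroup E] [InnerProductSpace ℝ E] {K K' : Set E}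

theorem inner_le_supportFn (hKc : IsCompact K) (w : E) {y : E} (hy : y ∈ K) :
    ⟪w, y⟫ ≤ supportFn K w :=
  le_csSup (hKc.image (by fun_prop)).bddAbove ⟨y, hy, rfl⟩

theorem supportFn_le (hne : K.Nonempty) {w : E} {c : ℝ} (h : ∀ y ∈ K, ⟪w, y⟫ ≤ c) :
    supportFn K w ≤ c :=
  csSup_le (hne.image _) (forall_mem_image.2 h)

theorem supportFn_smul {c : ℝ} (hc : 0 ≤ c) (w : E) :
    supportFn K (c • w) = c * supportFn K w := by
  rw [supportFn, supportFn, ← smul_eq_mul, ← Real.sSup_smul_of_nonneg hc, ← image_smul,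
    image_image]
  simp only [real_inner_smul_left, smul_eq_mul]

theorem supportFn_zero : supportFn K 0 = 0 := by
  simpa using supportFn_smul (K := K) le_rfl 0

theorem supportFn_add_le (hKc : IsCompact K) (hne : K.Nonempty) (v w : E) :
    supportFn K (v + w) ≤ supportFn K v + supportFn K w :=
  supportFn_le hne fun y hy => by
    rw [inner_add_left]
    exact add_le_add (inner_le_supportFn hKc v hy) (inner_le_supportFn hKc w hy)

theorem supportFn_mono (hKc : IsCompact K) (hne : K'.Nonempty) (h : K' ⊆ K) (w : E) :
    supportFn K' w ≤ supportFn K w :=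
  supportFn_le hne fun _ hy => inner_le_supportFn hKc w (h hy)

theorem exists_lipschitzWith_supportFn (hKc : IsCompact K) (hne : K.Nonempty) :
    ∃ C, LipschitzWith C (supportFn K) := by
  obtain ⟨R, hR⟩ := hKc.exists_bound_of_continuousOn continuousOn_id
  have hR₀ : 0 ≤ R := hne.elim fun y hy => (norm_nonneg _).trans (hR y hy)
  refine ⟨⟨R, hR₀⟩, LipschitzWith.of_le_add_mul _ fun v w => supportFn_le hne fun y hy => ?_⟩
  calc ⟪v, y⟫ = ⟪w, y⟫ + ⟪v - w, y⟫ := by rw [inner_sub_left]; ring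
    _ ≤ supportFn K w + ‖v - w‖ * R := add_le_add (inner_le_supportFn hKc w hy)
        ((real_inner_le_norm _ _).trans (mul_le_mul_of_nonneg_left (hR y hy) (norm_nonneg _)))
    _ = supportFn K w + R * dist v w := by rw [dist_eq_norm, mul_comm]

theorem mul_norm_le_of_forall_inner_le {p d : E} {r c : ℝ} (hr : 0 ≤ r)
    (hB : Metric.closedBall p r ⊆ K) (h : ∀ y ∈ K, ⟪d, y - p⟫ ≤ c) : r * ‖d‖ ≤ c := by
  rcases eq_or_ne d 0 with rfl | hd
  · simpa using h p (hB (Metric.mem_closedBall_self hr))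
  have hd' : ‖d‖ ≠ 0 := norm_ne_zero_iff.2 hd
  have hmem : p + (r / ‖d‖) • d ∈ K := hB (by
    rw [Metric.mem_closedBall, dist_eq_norm, add_sub_cancel_left, norm_smul, Real.norm_eq_abs,
      abs_of_nonneg (by positivity), div_mul_cancel₀ _ hd'])
  have hle := h _ hmem
  rw [add_sub_cancel_left, real_inner_smul_right, real_inner_self_eq_norm_sq] at hle
  calc r * ‖d‖ = r / ‖d‖ * ‖d‖ ^ 2 := by field_simp
    _ ≤ c := hle

theorem mul_norm_le_supportFn_sub {p : E} {r : ℝ} (hKc : IsCompact K) (hr : 0 ≤ r)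
    (hB : Metric.closedBall p r ⊆ K) (w : E) : r * ‖w‖ ≤ supportFn K w - ⟪w, p⟫ :=
  mul_norm_le_of_forall_inner_le hr hB fun y hy => by
    rw [inner_sub_right]
    linarith [inner_le_supportFn hKc w hy]

end SupportFunction

section NormalCone

variable {n : ℕ} {K : Set (PhaseSpace n)} {x w : PhaseSpace n}

theorem supportFn_eq_of_mem_normalCone (hKc : IsCompact K) (hx : x ∈ K)
    (hw : w ∈ normalCone K x) : supportFn K w = ⟪w, x⟫ := by
  refine le_antisymm (supportFn_le ⟨x, hx⟩ fun y hy => ?_) (inner_le_supportFn hKc w hx)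
  linarith [inner_sub_right (𝕜 := ℝ) w x y, hw y hy]

theorem mem_normalCone_of_supportFn_le (hKc : IsCompact K) (hw : supportFn K w ≤ ⟪w, x⟫) :
    w ∈ normalCone K x := fun y hy => by
  rw [inner_sub_right]
  linarith [inner_le_supportFn hKc w hy]

theorem eq_zero_of_mem_normalCone_of_mem_interior (hx : x ∈ interior K)
    (hw : w ∈ normalCone K x) : w = 0 := by
  obtain ⟨r, hr, hB⟩ := exists_closedBall_subset_of_mem_interior hx
  have hle : r * ‖w‖ ≤ 0 := mul_norm_le_of_forall_inner_le hr.le hB fun y hy => by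
    rw [← neg_sub, inner_neg_right]
    exact neg_nonpos.2 (hw y hy)
  exact norm_le_zero_iff.1 (nonpos_of_mul_nonpos_right hle hr)

end NormalCone

/-- The length of a curve with velocity `v`, measured by the support function of `K`. For a closed
characteristic on `∂K` it is twice the action. -/
def supportLength {n : ℕ} (K : Set (PhaseSpace n)) (T : ℝ) (v : ℝ → PhaseSpace n) : ℝ :=
  ∫ t in (0 : ℝ)..T, supportFn K (-(stdJ n (v t)))

namespace HasVelocity

variable {n : ℕ} {K : Set (PhaseSpace n)} {T : ℝ} {γ v : ℝ → PhaseSpace n}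

theorem intervalIntegrable_supportFn (h : HasVelocity T γ v) (hKc : IsCompact K)
    (hne : K.Nonempty) :
    IntervalIntegrable (fun t => supportFn K (-(stdJ n (v t)))) volume 0 T := by
  obtain ⟨C, hC⟩ := exists_lipschitzWith_supportFn hKc hne
  exact intervalIntegrable_of_memLp_two h.nonneg (hC.comp_memLp supportFn_zero h.neg_stdJ.memLp)

theorem supportLength_eq_of_closed (h : HasVelocity T γ v) (hc : γ 0 = γ T) (hKc : IsCompact K)
    (hne : K.Nonempty) (p : PhaseSpace n) :
    supportLength K T v =
      ∫ t in (0 : ℝ)..T, (supportFn K (-(stdJ n (v t))) - ⟪-(stdJ n (v t)), p⟫) := by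
  rw [intervalIntegral.integral_sub (h.intervalIntegrable_supportFn hKc hne)
    (h.intervalIntegrable_inner_neg_stdJ continuousOn_const),
    h.integral_inner_neg_stdJ_const_of_closed hc, sub_zero, supportLength]

theorem mul_integral_norm_le_supportLength (h : HasVelocity T γ v) (hc : γ 0 = γ T)
    (hKc : IsCompact K) {p : PhaseSpace n} {r : ℝ} (hr : 0 ≤ r) (hB : Metric.closedBall p r ⊆ K) :
    r * ∫ t in (0 : ℝ)..T, ‖v t‖ ≤ supportLength K T v := by
  have hne : K.Nonempty := ⟨p, hB (Metric.mem_closedBall_self hr)⟩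
  rw [h.supportLength_eq_of_closed hc hKc hne p, ← intervalIntegral.integral_const_mul]
  refine intervalIntegral.integral_mono_on h.nonneg (h.intervalIntegrable_right.norm.const_mul r)
    ((h.intervalIntegrable_supportFn hKc hne).sub
      (h.intervalIntegrable_inner_neg_stdJ continuousOn_const)) fun t _ => ?_
  simpa only [norm_neg, norm_stdJ] using mul_norm_le_supportFn_sub hKc hr hB (-(stdJ n (v t)))

theorem supportLength_nonneg (h : HasVelocity T γ v) (hc : γ 0 = γ T) (hKc : IsCompact K)
    (hne : K.Nonempty) : 0 ≤ supportLength K T v := by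
  obtain ⟨p, hp⟩ := hne
  have hle := h.mul_integral_norm_le_supportLength hc hKc (p := p) le_rfl (by simpa using hp)
  rwa [zero_mul] at hle

theorem supportLength_pos (h : HasVelocity T γ v) (hc : γ 0 = γ T) (hKc : IsCompact K)
    (hi : (interior K).Nonempty) (hnc : ∃ t ∈ Icc 0 T, γ t ≠ γ 0) : 0 < supportLength K T v := by
  obtain ⟨p, hp⟩ := hi
  obtain ⟨r, hr, hB⟩ := exists_closedBall_subset_of_mem_interior hp
  obtain ⟨t, ht, hne⟩ := hnc
  refine lt_of_lt_of_le (mul_pos hr ?_) (h.mul_integral_norm_le_supportLength hc hKc hr.le hB)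
  calc 0 < ‖γ t - γ 0‖ := norm_pos_iff.2 (sub_ne_zero.2 hne)
    _ ≤ ∫ s in (0 : ℝ)..t, ‖v s‖ := h.norm_sub_le h.zero_mem ht ht.1
    _ ≤ ∫ s in (0 : ℝ)..T, ‖v s‖ := h.integral_norm_mono le_rfl le_rfl ht.1 ht.2 le_rfl

end HasVelocity

theorem supportLength_const_smul {n : ℕ} {K : Set (PhaseSpace n)} {T c : ℝ} (hc : 0 ≤ c)
    (v : ℝ → PhaseSpace n) : supportLength K T (fun t => c • v t) = c * supportLength K T v := by
  simp only [supportLength, map_smul, ← smul_neg, supportFn_smul hc,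
    intervalIntegral.integral_const_mul]

theorem supportLength_eq_integral_inner {n : ℕ} {K : Set (PhaseSpace n)} {T : ℝ}
    {γ v : ℝ → PhaseSpace n} (hT : 0 ≤ T) (hKc : IsCompact K) (hmem : ∀ t ∈ Icc 0 T, γ t ∈ K)
    (hv : ∀ᵐ t ∂(volume.restrict (Icc 0 T)), -(stdJ n (v t)) ∈ normalCone K (γ t)) :
    supportLength K T v = ∫ t in (0 : ℝ)..T, ⟪-(stdJ n (v t)), γ t⟫ := by
  refine intervalIntegral_congr_ae_Icc hT ?_
  filter_upwards [hv, ae_restrict_mem measurableSet_Icc] with t ht htT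
  exact supportFn_eq_of_mem_normalCone hKc (hmem t htT) ht

namespace IsClosedCharacteristic

variable {n : ℕ} {K : Set (PhaseSpace n)} {T : ℝ} {γ : ℝ → PhaseSpace n}

theorem hasVelocity (h : IsClosedCharacteristic K T γ) : HasVelocity T γ (deriv γ) :=
  h.isW12.hasVelocity h.period_pos.le

theorem of_hasVelocity {v : ℝ → PhaseSpace n} (hT : 0 < T) (hγ : HasVelocity T γ v)
    (hc : γ 0 = γ T) (hfr : ∀ t ∈ Icc 0 T, γ t ∈ frontier K)
    (hv : ∀ᵐ t ∂(volume.restrict (Icc 0 T)), -(stdJ n (v t)) ∈ normalCone K (γ t))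
    (hnc : ∃ t ∈ Icc 0 T, γ t ≠ γ 0) : IsClosedCharacteristic K T γ :=
  ⟨hT, hγ.isW12, hc, hfr, by filter_upwards [hv, hγ.ae_deriv_eq] with t ht he; rwa [he], hnc⟩

theorem mem (h : IsClosedCharacteristic K T γ) (hKc : IsCompact K) {t : ℝ} (ht : t ∈ Icc 0 T) :
    γ t ∈ K := hKc.isClosed.frontier_subset (h.mem_frontier t ht)

theorem supportLength_eq (h : IsClosedCharacteristic K T γ) (hKc : IsCompact K) :
    supportLength K T (deriv γ) = 2 * action T γ := by
  rw [supportLength_eq_integral_inner h.period_pos.le hKc (fun _ => h.mem hKc) h.velocity_mem,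
    action]
  ring

theorem action_pos (h : IsClosedCharacteristic K T γ) (hKc : IsCompact K)
    (hi : (interior K).Nonempty) : 0 < action T γ := by
  have hpos := h.hasVelocity.supportLength_pos h.closed hKc hi h.nonconstant
  rw [h.supportLength_eq hKc] at hpos
  linarith

end IsClosedCharacteristic

section QuadraticIncrements

theorem eq_of_norm_sub_le_mul_sq {E F : Type*} [NormedAddCommGroup E] [NormedSpace ℝ E]
    [NormedAddCommGroup F] [NormedSpace ℝ F] {s : Set E} (hs : Convex ℝ s) {f : E → F} {C : ℝ}
    (h : ∀ x ∈ s, ∀ y ∈ s, ‖f y - f x‖ ≤ C * ‖y - x‖ ^ 2) {x y : E} (hx : x ∈ s) (hy : y ∈ s) :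
    f x = f y := by
  have hderiv : ∀ z ∈ s, HasFDerivWithinAt f (0 : E →L[ℝ] F) s z := fun z hz => by
    have hO : (fun w => f w - f z) =O[𝓝[s] z] fun w => ‖w - z‖ ^ 2 :=
      .of_bound C (eventually_mem_nhdsWithin.mono fun w hw => by simpa using h z hz w hw)
    simpa using (hO.hasFDerivWithinAt hz one_lt_two).add_const (f z)
  have hle := hs.norm_image_sub_le_of_norm_hasFDerivWithin_le hderiv (C := 0)
    (fun _ _ => norm_zero.le) hx hy
  rw [zero_mul, norm_le_zero_iff, sub_eq_zero] at hle
  exact hle.symm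

theorem eq_of_norm_sub_le_mul_sq_comp {F : Type*} [NormedAddCommGroup F] [NormedSpace ℝ F]
    {f : ℝ → F} {S : ℝ → ℝ} {a b C : ℝ} (hS : ContinuousOn S (uIcc a b))
    (h : ∀ s ∈ uIcc a b, ∀ t ∈ uIcc a b, ‖f t - f s‖ ≤ C * (S t - S s) ^ 2) : f a = f b := by
  have hsurj : ∀ σ ∈ uIcc (S a) (S b), ∃ t ∈ uIcc a b, S t = σ := intermediate_value_uIcc hS
  choose! τ hτ hSτ using hsurj
  have hf : ∀ t ∈ uIcc a b, S t ∈ uIcc (S a) (S b) → f (τ (S t)) = f t := fun t ht hSt => by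
    have hle := h t ht (τ (S t)) (hτ _ hSt)
    rwa [hSτ _ hSt, sub_self, zero_pow two_ne_zero, mul_zero, norm_le_zero_iff, sub_eq_zero] at hle
  rw [← hf a left_mem_uIcc left_mem_uIcc, ← hf b right_mem_uIcc right_mem_uIcc]
  refine eq_of_norm_sub_le_mul_sq (f := fun σ => f (τ σ)) (C := C) (convex_uIcc (S a) (S b))
    (fun σ hσ σ' hσ' => ?_) left_mem_uIcc right_mem_uIcc
  have hle := h (τ σ) (hτ σ hσ) (τ σ') (hτ σ' hσ')
  rwa [hSτ σ hσ, hSτ σ' hσ', ← sq_abs, ← Real.norm_eq_abs] at hle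

end QuadraticIncrements

/-! ### The isoperimetric inequality for closed curves -/

section Reparametrization

variable {n : ℕ} {T : ℝ} {γ v : ℝ → PhaseSpace n}

namespace HasVelocity

theorem abs_integral_inner_neg_stdJ_sub_le (h : HasVelocity T γ v) {a b : ℝ} (ha : 0 ≤ a)
    (hab : a ≤ b) (hb : b ≤ T) :
    |(∫ t in a..b, ⟪-(stdJ n (v t)), γ t⟫) - ⟪-(stdJ n (γ b - γ a)), γ a⟫| ≤
      (∫ t in a..b, ‖v t‖) ^ 2 := by
  have ha' : a ∈ Icc 0 T := ⟨ha, hab.trans hb⟩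
  have hb' : b ∈ Icc 0 T := ⟨ha.trans hab, hb⟩
  have hsub : uIcc a b ⊆ uIcc 0 T := by
    rw [uIcc_of_le hab, uIcc_of_le h.nonneg]
    exact Icc_subset_Icc ha hb
  have hbound : ∀ t ∈ Icc a b,
      ‖⟪-(stdJ n (v t)), γ t⟫ - ⟪-(stdJ n (v t)), γ a⟫‖ ≤ ‖v t‖ * ∫ t in a..b, ‖v t‖ :=
    fun t ht => calc
      _ = ‖⟪-(stdJ n (v t)), γ t - γ a⟫‖ := by rw [inner_sub_right]
      _ ≤ ‖v t‖ * ‖γ t - γ a‖ := by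
        simpa only [norm_neg, norm_stdJ] using norm_inner_le_norm (𝕜 := ℝ) (-(stdJ n (v t))) _
      _ ≤ ‖v t‖ * ∫ t in a..b, ‖v t‖ := mul_le_mul_of_nonneg_left
        ((h.norm_sub_le ha' ⟨ha.trans ht.1, ht.2.trans hb⟩ ht.1).trans
          (h.integral_norm_mono ha le_rfl ht.1 ht.2 hb)) (norm_nonneg _)
  rw [← h.integral_inner_neg_stdJ_const _ ha' hb', ← intervalIntegral.integral_sub
    ((h.intervalIntegrable_inner_neg_stdJ h.continuousOn).mono_set hsub)
    ((h.intervalIntegrable_inner_neg_stdJ continuousOn_const).mono_set hsub), ← Real.norm_eq_abs]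
  calc _ ≤ ∫ t in a..b, ‖v t‖ * ∫ t in a..b, ‖v t‖ :=
        intervalIntegral.norm_integral_le_of_norm_le hab
          (Eventually.of_forall fun t ht => hbound t (Ioc_subset_Icc_self ht))
          ((h.intervalIntegrable ha' hb').norm.mul_const _)
    _ = (∫ t in a..b, ‖v t‖) ^ 2 := by rw [intervalIntegral.integral_mul_const, sq]

theorem integral_inner_neg_stdJ_sub (h : HasVelocity T γ v) {a b : ℝ} (ha : a ∈ Icc 0 T)
    (hb : b ∈ Icc 0 T) :
    (∫ t in (0 : ℝ)..b, ⟪-(stdJ n (v t)), γ t⟫) - ∫ t in (0 : ℝ)..a, ⟪-(stdJ n (v t)), γ t⟫ =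
      ∫ t in a..b, ⟪-(stdJ n (v t)), γ t⟫ := by
  have hint := h.intervalIntegrable_inner_neg_stdJ h.continuousOn
  rw [← uIcc_of_le h.nonneg] at ha hb
  exact intervalIntegral.integral_interval_sub_left
    (hint.mono_set (uIcc_subset_uIcc left_mem_uIcc hb))
    (hint.mono_set (uIcc_subset_uIcc left_mem_uIcc ha))

/-- The difference `∫₀^t ⟪-J v, γ⟫ - ∫₀^(S t) ⟪-J w, ζ⟫` is constant, having increments of order
`(S t - S s)²`: over a short arc both integrals are close to `⟪-J (γ t - γ s), γ s⟫`. -/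
theorem action_eq_of_comp {T' R : ℝ} {ζ w : ℝ → PhaseSpace n} {S : ℝ → ℝ} (h : HasVelocity T γ v)
    (hζ : HasVelocity T' ζ w) (hScont : ContinuousOn S (Icc 0 T)) (hSmono : MonotoneOn S (Icc 0 T))
    (hS0 : S 0 = 0) (hST : S T = T') (hγζ : ∀ t ∈ Icc 0 T, γ t = ζ (S t))
    (hv : ∀ a ∈ Icc 0 T, ∀ b ∈ Icc 0 T, a ≤ b → ∫ t in a..b, ‖v t‖ ≤ R * (S b - S a))
    (hw : ∀ a ∈ Icc 0 T', ∀ b ∈ Icc 0 T', a ≤ b → ∫ t in a..b, ‖w t‖ ≤ R * (b - a)) :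
    action T γ = action T' ζ := by
  have hTT : T ∈ Icc 0 T := ⟨h.nonneg, le_rfl⟩
  have hSmem : ∀ t ∈ Icc 0 T, S t ∈ Icc 0 T' := fun t ht =>
    ⟨hS0.symm.trans_le (hSmono h.zero_mem ht ht.1), (hSmono ht hTT ht.2).trans_eq hST⟩
  set f : ℝ → ℝ := fun t => ∫ x in (0 : ℝ)..t, ⟪-(stdJ n (v x)), γ x⟫ with hf
  set g : ℝ → ℝ := fun σ => ∫ x in (0 : ℝ)..σ, ⟪-(stdJ n (w x)), ζ x⟫ with hg
  have increment_le : ∀ s ∈ Icc 0 T, ∀ t ∈ Icc 0 T, s ≤ t →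
      |(f t - g (S t)) - (f s - g (S s))| ≤ 2 * R ^ 2 * (S t - S s) ^ 2 := by
    intro s hs t ht hst
    have hSst := hSmono hs ht hst
    have hfst : f t - f s = ∫ x in s..t, ⟪-(stdJ n (v x)), γ x⟫ :=
      h.integral_inner_neg_stdJ_sub hs ht
    have hgst : g (S t) - g (S s) = ∫ x in (S s)..(S t), ⟪-(stdJ n (w x)), ζ x⟫ :=
      hζ.integral_inner_neg_stdJ_sub (hSmem s hs) (hSmem t ht)
    have hγle := h.abs_integral_inner_neg_stdJ_sub_le hs.1 hst ht.2
    have hζle := hζ.abs_integral_inner_neg_stdJ_sub_le (hSmem s hs).1 hSst (hSmem t ht).2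
    have hvle := pow_le_pow_left₀
      (intervalIntegral.integral_nonneg hst fun _ _ => norm_nonneg _) (hv s hs t ht hst) 2
    have hwle := pow_le_pow_left₀ (intervalIntegral.integral_nonneg hSst fun _ _ => norm_nonneg _)
      (hw _ (hSmem s hs) _ (hSmem t ht) hSst) 2
    rw [mul_pow] at hvle hwle
    rw [← hγζ s hs, ← hγζ t ht] at hζle
    rw [abs_le] at hγle hζle ⊢
    constructor <;> linarith [hγle.1, hγle.2, hζle.1, hζle.2]
  have hconst : f 0 - g (S 0) = f T - g (S T) := by
    refine eq_of_norm_sub_le_mul_sq_comp (f := fun t => f t - g (S t)) (S := S)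
      (C := 2 * R ^ 2) ?_ fun s hs t ht => ?_
    · rwa [uIcc_of_le h.nonneg]
    rw [uIcc_of_le h.nonneg] at hs ht
    rw [Real.norm_eq_abs]
    rcases le_total s t with hst | hst
    · exact increment_le s hs t ht hst
    · rw [abs_sub_comm, sub_sq_comm]
      exact increment_le t ht s hs hst
  rw [h.action_eq, hζ.action_eq]
  simp only [hf, hg, hS0, hST, intervalIntegral.integral_same] at hconst
  linarith

end HasVelocity

end Reparametrization

section UnitLoops

open scoped BoundedContinuousFunction unitInterval

variable {n : ℕ} {K : Set (PhaseSpace n)} {p : PhaseSpace n} {r : ℝ}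

/-- The closed curves on `[0,1]` based at `0` whose speed, measured by the support function of
`K - p`, is at most `1`. They form a compact set, on which the action is maximized. -/
def unitLoops (K : Set (PhaseSpace n)) (p : PhaseSpace n) : Set (I →ᵇ PhaseSpace n) :=
  {f | f 0 = 0 ∧ f 1 = 0 ∧
    ∀ s t : I, s ≤ t → ∀ y ∈ K, ⟪-(stdJ n (f t - f s)), y - p⟫ ≤ (t : ℝ) - s}

/-- The extension by constants of a curve on `[0,1]`, which makes `deriv` and `action` apply to
it. -/
def extendCurve (f : I →ᵇ PhaseSpace n) : ℝ → PhaseSpace n := IccExtend zero_le_one f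

theorem extendCurve_of_mem (f : I →ᵇ PhaseSpace n) {t : ℝ} (ht : t ∈ I) :
    extendCurve f t = f ⟨t, ht⟩ :=
  IccExtend_of_mem _ _ ht

theorem extendCurve_closed {f : I →ᵇ PhaseSpace n} (hf : f ∈ unitLoops K p) :
    extendCurve f 0 = extendCurve f 1 :=
  (IccExtend_left zero_le_one f).trans
    ((hf.1.trans hf.2.1.symm).trans (IccExtend_right zero_le_one f).symm)

theorem lipschitzWith_of_inner_sub_le (hr : 0 < r) (hB : Metric.closedBall p r ⊆ K)
    {f : I → PhaseSpace n}
    (hf : ∀ s t, s ≤ t → ∀ y ∈ K, ⟪-(stdJ n (f t - f s)), y - p⟫ ≤ (t : ℝ) - s) :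
    LipschitzWith (Real.toNNReal r⁻¹) f := by
  refine LipschitzWith.of_dist_le_mul fun s t => ?_
  wlog hst : t ≤ s generalizing s t
  · rw [dist_comm, dist_comm s]
    exact this t s (le_of_not_ge hst)
  rw [dist_eq_norm, Real.coe_toNNReal _ (inv_nonneg.2 hr.le), Subtype.dist_eq, Real.dist_eq,
    abs_of_nonneg (sub_nonneg.2 (Subtype.coe_le_coe.2 hst))]
  have hle := mul_norm_le_of_forall_inner_le hr.le hB (hf t s hst)
  rwa [norm_neg, norm_stdJ, ← le_inv_mul_iff₀ hr] at hle

theorem lipschitzWith_extendCurve (hr : 0 < r) (hB : Metric.closedBall p r ⊆ K)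
    {f : I →ᵇ PhaseSpace n} (hf : f ∈ unitLoops K p) :
    LipschitzWith (Real.toNNReal r⁻¹) (extendCurve f) := by
  have hlip := (lipschitzWith_of_inner_sub_le hr hB hf.2.2).comp (LipschitzWith.projIcc zero_le_one)
  rwa [mul_one] at hlip

theorem norm_deriv_extendCurve_le (hr : 0 < r) (hB : Metric.closedBall p r ⊆ K)
    {f : I →ᵇ PhaseSpace n} (hf : f ∈ unitLoops K p) (t : ℝ) :
    ‖deriv (extendCurve f) t‖ ≤ r⁻¹ :=
  (norm_deriv_le_of_lipschitz (lipschitzWith_extendCurve hr hB hf)).trans_eq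
    (Real.coe_toNNReal _ (inv_nonneg.2 hr.le))

theorem hasVelocity_extendCurve (hr : 0 < r) (hB : Metric.closedBall p r ⊆ K)
    {f : I →ᵇ PhaseSpace n} (hf : f ∈ unitLoops K p) :
    HasVelocity 1 (extendCurve f) (deriv (extendCurve f)) :=
  hasVelocity_of_lipschitzWith (lipschitzWith_extendCurve hr hB hf) zero_le_one

theorem isCompact_unitLoops (hr : 0 < r) (hB : Metric.closedBall p r ⊆ K) :
    IsCompact (unitLoops K p) := by
  refine BoundedContinuousFunction.arzela_ascoli₂ (Metric.closedBall 0 r⁻¹)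
    (isCompact_closedBall _ _) _ ?_ (fun f t hf => ?_) ?_
  · have heval : ∀ s : I, Continuous fun f : I →ᵇ PhaseSpace n => f s :=
      fun s => continuous_eval_const s
    have hspeed : IsClosed {f : I →ᵇ PhaseSpace n |
        ∀ s t : I, s ≤ t → ∀ y ∈ K, ⟪-(stdJ n (f t - f s)), y - p⟫ ≤ (t : ℝ) - s} := by
      simp only [ofPred_forall]
      refine isClosed_iInter fun s => isClosed_iInter fun t => isClosed_iInter fun _ =>
        isClosed_iInter fun y => isClosed_iInter fun _ => isClosed_le ?_ continuous_const
      exact ((stdJ n).continuous.comp ((heval t).sub (heval s))).neg.inner continuous_const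
    exact (isClosed_eq (heval 0) continuous_const).inter
      ((isClosed_eq (heval 1) continuous_const).inter hspeed)
  · have hle := (lipschitzWith_of_inner_sub_le hr hB hf.2.2).dist_le_mul t 0
    rw [hf.1, Real.coe_toNNReal _ (inv_nonneg.2 hr.le)] at hle
    refine Metric.mem_closedBall.2 (hle.trans (mul_le_of_le_one_right (inv_nonneg.2 hr.le) ?_))
    rw [Subtype.dist_eq, Real.dist_eq, Icc.coe_zero, sub_zero, abs_of_nonneg t.2.1]
    exact t.2.2
  · exact (LipschitzWith.uniformEquicontinuous _ _ fun f : unitLoops K p =>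
      lipschitzWith_of_inner_sub_le hr hB f.2.2.2).equicontinuous

theorem abs_action_sub_le (hr : 0 < r) (hB : Metric.closedBall p r ⊆ K)
    {f g : I →ᵇ PhaseSpace n} (hf : f ∈ unitLoops K p) (hg : g ∈ unitLoops K p) :
    |action 1 (extendCurve f) - action 1 (extendCurve g)| ≤ r⁻¹ * dist f g := by
  have hvf := hasVelocity_extendCurve hr hB hf
  have hvg := hasVelocity_extendCurve hr hB hg
  have integral_le : ∀ k ∈ unitLoops K p,
      |(∫ t in (0 : ℝ)..1, ⟪-(stdJ n (deriv (extendCurve k) t)), extendCurve f t⟫) -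
        ∫ t in (0 : ℝ)..1, ⟪-(stdJ n (deriv (extendCurve k) t)), extendCurve g t⟫|
        ≤ r⁻¹ * dist f g := fun k hk => by
    have hvk := hasVelocity_extendCurve hr hB hk
    rw [← intervalIntegral.integral_sub (hvk.intervalIntegrable_inner_neg_stdJ hvf.continuousOn)
      (hvk.intervalIntegrable_inner_neg_stdJ hvg.continuousOn), ← Real.norm_eq_abs]
    refine (intervalIntegral.norm_integral_le_of_norm_le_const (C := r⁻¹ * dist f g)
      fun t _ => ?_).trans_eq (by simp)
    rw [← inner_sub_right]
    refine (norm_inner_le_norm _ _).trans ?_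
    rw [norm_neg, norm_stdJ, ← dist_eq_norm]
    exact mul_le_mul (norm_deriv_extendCurve_le hr hB hk t)
      (BoundedContinuousFunction.dist_coe_le_dist _) dist_nonneg (inv_nonneg.2 hr.le)
  have hlef := integral_le f hf
  have hleg := integral_le g hg
  have hcomm := hvf.integral_inner_neg_stdJ_comm hvg (extendCurve_closed hf) (extendCurve_closed hg)
  rw [action, action, abs_le]
  rw [abs_le] at hlef hleg
  constructor <;> linarith [hlef.1, hlef.2, hleg.1, hleg.2]

theorem exists_isMaxOn_action_unitLoops (hr : 0 < r) (hB : Metric.closedBall p r ⊆ K) :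
    ∃ f ∈ unitLoops K p, IsMaxOn (fun g => action 1 (extendCurve g)) (unitLoops K p) f := by
  refine (isCompact_unitLoops hr hB).exists_isMaxOn
    ⟨0, rfl, rfl, fun s t hst y _ => by simpa using hst⟩
    (LipschitzOnWith.of_dist_le_mul (K := Real.toNNReal r⁻¹) fun f hf g hg => ?_).continuousOn
  rw [Real.coe_toNNReal _ (inv_nonneg.2 hr.le), Real.dist_eq]
  exact abs_action_sub_le hr hB hf hg

end UnitLoops

section UnitSpeed

variable {n : ℕ} {K : Set (PhaseSpace n)} {p : PhaseSpace n} {r T : ℝ} {γ v : ℝ → PhaseSpace n}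

/-- The length on `[0,t]` of a curve with velocity `v`, measured by the support function of `K - p`.
Moving the origin to an interior point `p` of `K` makes it nondecreasing in `t`; over a closed curve
it agrees with `supportLength`. -/
def lengthFrom (K : Set (PhaseSpace n)) (p : PhaseSpace n) (v : ℝ → PhaseSpace n) (t : ℝ) : ℝ :=
  ∫ x in (0 : ℝ)..t, (supportFn K (-(stdJ n (v x))) - ⟪-(stdJ n (v x)), p⟫)

namespace HasVelocity

theorem intervalIntegrable_supportFn_sub (h : HasVelocity T γ v) (hKc : IsCompact K)
    (hne : K.Nonempty) (p : PhaseSpace n) {a b : ℝ} (ha : a ∈ Icc 0 T) (hb : b ∈ Icc 0 T) :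
    IntervalIntegrable (fun x => supportFn K (-(stdJ n (v x))) - ⟪-(stdJ n (v x)), p⟫)
      volume a b := by
  rw [← uIcc_of_le h.nonneg] at ha hb
  exact ((h.intervalIntegrable_supportFn hKc hne).sub
    (h.intervalIntegrable_inner_neg_stdJ continuousOn_const)).mono_set (uIcc_subset_uIcc ha hb)

theorem lengthFrom_sub (h : HasVelocity T γ v) (hKc : IsCompact K) (hne : K.Nonempty)
    (p : PhaseSpace n) {a b : ℝ} (ha : a ∈ Icc 0 T) (hb : b ∈ Icc 0 T) :
    lengthFrom K p v b - lengthFrom K p v a =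
      ∫ x in a..b, (supportFn K (-(stdJ n (v x))) - ⟪-(stdJ n (v x)), p⟫) :=
  intervalIntegral.integral_interval_sub_left
    (h.intervalIntegrable_supportFn_sub hKc hne p h.zero_mem hb)
    (h.intervalIntegrable_supportFn_sub hKc hne p h.zero_mem ha)

theorem continuousOn_lengthFrom (h : HasVelocity T γ v) (hKc : IsCompact K) (hne : K.Nonempty)
    (p : PhaseSpace n) : ContinuousOn (lengthFrom K p v) (Icc 0 T) := by
  rw [← uIcc_of_le h.nonneg]
  exact intervalIntegral.continuousOn_primitive_interval'
    (h.intervalIntegrable_supportFn_sub hKc hne p h.zero_mem ⟨h.nonneg, le_rfl⟩) left_mem_uIcc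

theorem inner_sub_le_lengthFrom_sub (h : HasVelocity T γ v) (hKc : IsCompact K)
    (p : PhaseSpace n) {a b : ℝ} (ha : a ∈ Icc 0 T) (hb : b ∈ Icc 0 T) (hab : a ≤ b)
    {y : PhaseSpace n} (hy : y ∈ K) :
    ⟪-(stdJ n (γ b - γ a)), y - p⟫ ≤ lengthFrom K p v b - lengthFrom K p v a := by
  rw [h.lengthFrom_sub hKc ⟨y, hy⟩ p ha hb, ← h.integral_inner_neg_stdJ_const _ ha hb]
  refine intervalIntegral.integral_mono_on hab ?_
    (h.intervalIntegrable_supportFn_sub hKc ⟨y, hy⟩ p ha hb) fun t _ => ?_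
  · rw [← uIcc_of_le h.nonneg] at ha hb
    exact (h.intervalIntegrable_inner_neg_stdJ continuousOn_const).mono_set
      (uIcc_subset_uIcc ha hb)
  · rw [inner_sub_right]
    exact sub_le_sub_right (inner_le_supportFn hKc _ hy) _

theorem integral_norm_le_lengthFrom_sub (h : HasVelocity T γ v) (hKc : IsCompact K) (hr : 0 < r)
    (hB : Metric.closedBall p r ⊆ K) {a b : ℝ} (ha : a ∈ Icc 0 T) (hb : b ∈ Icc 0 T)
    (hab : a ≤ b) :
    ∫ t in a..b, ‖v t‖ ≤ r⁻¹ * (lengthFrom K p v b - lengthFrom K p v a) := by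
  have hne : K.Nonempty := ⟨p, hB (Metric.mem_closedBall_self hr.le)⟩
  rw [h.lengthFrom_sub hKc hne p ha hb, ← intervalIntegral.integral_const_mul]
  refine intervalIntegral.integral_mono_on hab (h.intervalIntegrable ha hb).norm
    ((h.intervalIntegrable_supportFn_sub hKc hne p ha hb).const_mul _) fun t _ => ?_
  have hle := mul_norm_le_supportFn_sub hKc hr.le hB (-(stdJ n (v t)))
  rwa [norm_neg, norm_stdJ, ← le_inv_mul_iff₀ hr] at hle

theorem monotoneOn_lengthFrom (h : HasVelocity T γ v) (hKc : IsCompact K) (hp : p ∈ K) :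
    MonotoneOn (lengthFrom K p v) (Icc 0 T) := fun a ha b hb hab => by
  simpa using h.inner_sub_le_lengthFrom_sub hKc p ha hb hab hp

theorem eq_of_lengthFrom_eq (h : HasVelocity T γ v) (hKc : IsCompact K) (hr : 0 < r)
    (hB : Metric.closedBall p r ⊆ K) {a b : ℝ} (ha : a ∈ Icc 0 T) (hb : b ∈ Icc 0 T)
    (hab : lengthFrom K p v a = lengthFrom K p v b) : γ a = γ b := by
  wlog hle : a ≤ b generalizing a b
  · exact (this hb ha hab.symm (le_of_not_ge hle)).symm
  have hnorm := (h.norm_sub_le ha hb hle).trans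
    (h.integral_norm_le_lengthFrom_sub hKc hr hB ha hb hle)
  rw [hab, sub_self, mul_zero, norm_le_zero_iff, sub_eq_zero] at hnorm
  exact hnorm.symm

theorem inner_sub_le_of_lengthFrom_le (h : HasVelocity T γ v) (hKc : IsCompact K) (hr : 0 < r)
    (hB : Metric.closedBall p r ⊆ K) {a b : ℝ} (ha : a ∈ Icc 0 T) (hb : b ∈ Icc 0 T)
    (hab : lengthFrom K p v a ≤ lengthFrom K p v b) {y : PhaseSpace n} (hy : y ∈ K) :
    ⟪-(stdJ n (γ b - γ a)), y - p⟫ ≤ lengthFrom K p v b - lengthFrom K p v a := by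
  rcases le_total a b with hle | hle
  · exact h.inner_sub_le_lengthFrom_sub hKc p ha hb hle hy
  · have heq := hab.antisymm
      (h.monotoneOn_lengthFrom hKc (hB (Metric.mem_closedBall_self hr.le)) hb ha hle)
    simp [heq, h.eq_of_lengthFrom_eq hKc hr hB ha hb heq]

open scoped unitInterval

theorem exists_unitLoop (h : HasVelocity T γ v) (hc : γ 0 = γ T) (hKc : IsCompact K) (hr : 0 < r)
    (hB : Metric.closedBall p r ⊆ K) (hL : 0 < supportLength K T v) :
    ∃ f ∈ unitLoops K p, ∀ t ∈ Icc 0 T, γ t = supportLength K T v •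
      extendCurve f (lengthFrom K p v t / supportLength K T v) + γ 0 := by
  have hp : p ∈ K := hB (Metric.mem_closedBall_self hr.le)
  set L := supportLength K T v
  set ℓ := lengthFrom K p v with hℓ
  have hℓ0 : ℓ 0 = 0 := intervalIntegral.integral_same
  have hℓT : ℓ T = L := (h.supportLength_eq_of_closed hc hKc ⟨p, hp⟩ p).symm
  have hT : T ∈ Icc 0 T := ⟨h.nonneg, le_rfl⟩
  have hmono := h.monotoneOn_lengthFrom hKc hp
  have hsurj : ∀ x : I, ∃ t ∈ Icc 0 T, ℓ t = L * x := fun x =>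
    intermediate_value_Icc h.nonneg (h.continuousOn_lengthFrom hKc ⟨p, hp⟩ p)
      ⟨(hℓ0.trans_le (mul_nonneg hL.le x.2.1)),
        (mul_le_of_le_one_right hL.le x.2.2).trans_eq hℓT.symm⟩
  choose τ hτ hℓτ using hsurj
  set ζ : I → PhaseSpace n := fun x => L⁻¹ • (γ (τ x) - γ 0)
  have hζ : ∀ (x : I), ∀ t ∈ Icc 0 T, ℓ t = L * x → ζ x = L⁻¹ • (γ t - γ 0) :=
    fun x t ht hx => by
      rw [h.eq_of_lengthFrom_eq hKc hr hB ht (hτ x) (hx.trans (hℓτ x).symm)]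
  have hspeed : ∀ s t : I, s ≤ t → ∀ y ∈ K, ⟪-(stdJ n (ζ t - ζ s)), y - p⟫ ≤ (t : ℝ) - s := by
    intro s t hst y hy
    have hle := h.inner_sub_le_of_lengthFrom_le hKc hr hB (hτ s) (hτ t)
      (by rw [← hℓ, hℓτ, hℓτ]; exact mul_le_mul_of_nonneg_left hst hL.le) hy
    rw [← hℓ, hℓτ, hℓτ, ← mul_sub] at hle
    rwa [← smul_sub, sub_sub_sub_cancel_right, map_smul, ← smul_neg, real_inner_smul_left,
      inv_mul_le_iff₀ hL]
  refine ⟨BoundedContinuousFunction.mkOfCompact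
    ⟨ζ, (lipschitzWith_of_inner_sub_le hr hB hspeed).continuous⟩, ⟨?_, ?_, hspeed⟩, fun t ht => ?_⟩
  · exact (hζ 0 0 h.zero_mem (by simpa using hℓ0)).trans (by simp)
  · exact (hζ 1 T hT (by simpa using hℓT)).trans (by simp [hc])
  · have hmem : ℓ t / L ∈ I := ⟨div_nonneg (hℓ0 ▸ hmono h.zero_mem ht ht.1) hL.le,
      div_le_one_of_le₀ (hℓT ▸ hmono ht hT ht.2) hL.le⟩
    rw [extendCurve_of_mem _ hmem]
    change γ t = L • ζ _ + γ 0
    rw [hζ _ t ht (mul_div_cancel₀ _ hL.ne').symm, smul_inv_smul₀ hL.ne', sub_add_cancel]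

theorem exists_unitLoop_action_eq (h : HasVelocity T γ v) (hc : γ 0 = γ T) (hKc : IsCompact K)
    (hr : 0 < r) (hB : Metric.closedBall p r ⊆ K) (hL : 0 < supportLength K T v) :
    ∃ f ∈ unitLoops K p, action T γ = supportLength K T v ^ 2 * action 1 (extendCurve f) := by
  obtain ⟨f, hf, hγ⟩ := h.exists_unitLoop hc hKc hr hB hL
  refine ⟨f, hf, ?_⟩
  have hp : p ∈ K := hB (Metric.mem_closedBall_self hr.le)
  set L := supportLength K T v
  have hvf := hasVelocity_extendCurve hr hB hf
  have hvζ := (hvf.const_smul L).add_const (γ 0)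
  have hcζ : L • extendCurve f 0 = L • extendCurve f 1 := congrArg _ (extendCurve_closed hf)
  rw [← hvf.action_const_smul, ← (hvf.const_smul L).action_add_const hcζ (γ 0)]
  refine h.action_eq_of_comp (S := fun t => lengthFrom K p v t / L) (R := r⁻¹ * L) hvζ
    ((h.continuousOn_lengthFrom hKc ⟨p, hp⟩ p).div_const _)
    (fun a ha b hb hab =>
      div_le_div_of_nonneg_right (h.monotoneOn_lengthFrom hKc hp ha hb hab) hL.le)
    ?_ ?_ hγ (fun a ha b hb hab => ?_) fun a _ b _ hab => ?_
  · simp [lengthFrom]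
  · rw [← div_self hL.ne']
    exact congrArg (· / L) (h.supportLength_eq_of_closed hc hKc ⟨p, hp⟩ p).symm
  · rw [mul_assoc, ← sub_div, mul_div_cancel₀ _ hL.ne']
    exact h.integral_norm_le_lengthFrom_sub hKc hr hB ha hb hab
  · have hle := intervalIntegral.norm_integral_le_of_norm_le_const (a := a) (b := b)
      (f := fun t => ‖L • deriv (extendCurve f) t‖) (C := r⁻¹ * L) fun t _ => by
        rw [norm_norm, norm_smul, Real.norm_of_nonneg hL.le, mul_comm]
        exact mul_le_mul_of_nonneg_right (norm_deriv_extendCurve_le hr hB hf t) hL.le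
    rw [abs_of_nonneg (sub_nonneg.2 hab)] at hle
    exact (le_abs_self _).trans hle

end HasVelocity

end UnitSpeed

section Isoperimetric

open scoped BoundedContinuousFunction unitInterval

variable {n : ℕ} {K : Set (PhaseSpace n)} {p : PhaseSpace n} {r : ℝ}

theorem inner_extendCurve_sub_le {f : I →ᵇ PhaseSpace n} (hf : f ∈ unitLoops K p) {s t : ℝ}
    (hst : s ≤ t) {y : PhaseSpace n} (hy : y ∈ K) :
    ⟪-(stdJ n (extendCurve f t - extendCurve f s)), y - p⟫ ≤ t - s :=
  calc _ ≤ (projIcc 0 1 zero_le_one t : ℝ) - projIcc 0 1 zero_le_one s :=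
        hf.2.2 _ _ (monotone_projIcc zero_le_one hst) y hy
    _ ≤ |t - s| := (le_abs_self _).trans (abs_projIcc_sub_projIcc zero_le_one)
    _ = t - s := abs_of_nonneg (sub_nonneg.2 hst)

theorem inner_deriv_extendCurve_le {f : I →ᵇ PhaseSpace n} (hf : f ∈ unitLoops K p) {t : ℝ}
    {w : PhaseSpace n} (ht : HasDerivAt (extendCurve f) w t) {y : PhaseSpace n} (hy : y ∈ K) :
    ⟪-(stdJ n w), y - p⟫ ≤ 1 := by
  set φ : ℝ → ℝ := fun s => ⟪-(stdJ n (extendCurve f s)), y - p⟫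
  have hφ : HasDerivAt φ ⟪-(stdJ n w), y - p⟫ t := by
    simpa [φ] using
      ((-stdJ n).hasFDerivAt.comp_hasDerivAt t ht).inner ℝ (hasDerivAt_const t (y - p))
  have hmono : Monotone fun s => s - φ s := fun a b hab => by
    have hle := inner_extendCurve_sub_le hf hab hy
    rw [map_sub, neg_sub', inner_sub_left] at hle
    simp only [φ]
    linarith
  have hderiv : HasDerivAt (fun s => s - φ s) (1 - ⟪-(stdJ n w), y - p⟫) t :=
    (hasDerivAt_id' t).sub hφ
  exact sub_nonneg.1 (hderiv.deriv ▸ hmono.deriv_nonneg)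

theorem supportLength_unitLoop_le (hKc : IsCompact K) (hr : 0 < r)
    (hB : Metric.closedBall p r ⊆ K) {f : I →ᵇ PhaseSpace n} (hf : f ∈ unitLoops K p) :
    supportLength K 1 (deriv (extendCurve f)) ≤ 1 := by
  have hp : p ∈ K := hB (Metric.mem_closedBall_self hr.le)
  have hv := hasVelocity_extendCurve hr hB hf
  rw [hv.supportLength_eq_of_closed (extendCurve_closed hf) hKc ⟨p, hp⟩ p]
  refine (intervalIntegral.integral_mono_ae_restrict (g := fun _ => (1 : ℝ)) zero_le_one
    (hv.intervalIntegrable_supportFn_sub hKc ⟨p, hp⟩ p hv.zero_mem ⟨zero_le_one, le_rfl⟩)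
    intervalIntegrable_const ?_).trans_eq (by simp)
  filter_upwards [hv.ae_hasDerivAt] with t ht
  refine sub_le_iff_le_add.2 (supportFn_le ⟨p, hp⟩ fun y hy => sub_le_iff_le_add.1 ?_)
  rw [← inner_sub_right]
  exact inner_deriv_extendCurve_le hf ht hy

theorem exists_loop_action_pos [Nontrivial (PhaseSpace n)] :
    ∃ γ v : ℝ → PhaseSpace n, HasVelocity (2 * Real.pi) γ v ∧ γ 0 = γ (2 * Real.pi) ∧
      0 < action (2 * Real.pi) γ := by
  obtain ⟨u, hu⟩ := exists_ne (0 : PhaseSpace n)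
  set γ : ℝ → PhaseSpace n := fun t => Real.cos t • u + Real.sin t • stdJ n u
  set v : ℝ → PhaseSpace n := fun t => -Real.sin t • u + Real.cos t • stdJ n u
  have hγ : HasVelocity (2 * Real.pi) γ v :=
    .of_hasDerivAt (by positivity) (fun t => ((Real.hasDerivAt_cos t).smul_const u).add
      ((Real.hasDerivAt_sin t).smul_const (stdJ n u))) (by fun_prop)
  have hJv : ∀ t, -(stdJ n (v t)) = γ t := fun t => by
    simp only [v, γ, map_add, map_smul, stdJ_stdJ]
    module
  have hnorm : ∀ t, ⟪γ t, γ t⟫ = ‖u‖ ^ 2 := fun t => by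
    simp only [γ, inner_add_left, inner_add_right, real_inner_smul_left, real_inner_smul_right,
      inner_stdJ_stdJ, inner_stdJ_self, inner_self_stdJ]
    rw [real_inner_self_eq_norm_sq]
    linear_combination ‖u‖ ^ 2 * Real.sin_sq_add_cos_sq t
  refine ⟨γ, v, hγ, by simp [γ], ?_⟩
  rw [hγ.action_eq]
  simp only [hJv, hnorm, intervalIntegral.integral_const, sub_zero, smul_eq_mul]
  have := norm_pos_iff.2 hu
  positivity

theorem HasVelocity.exists_ne_of_action_ne_zero {T : ℝ} {γ v : ℝ → PhaseSpace n}
    (h : HasVelocity T γ v) (hc : γ 0 = γ T) (hA : action T γ ≠ 0) :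
    ∃ t ∈ Icc 0 T, γ t ≠ γ 0 := by
  by_contra! hconst
  refine hA ?_
  rw [h.action_eq, intervalIntegral.integral_congr (g := fun t => ⟪-(stdJ n (v t)), γ 0⟫)
    fun t ht => by rw [uIcc_of_le h.nonneg] at ht; simp only [hconst t ht],
    h.integral_inner_neg_stdJ_const_of_closed hc, mul_zero]

theorem HasVelocity.action_eq_zero_of_supportLength_eq_zero {T : ℝ} {γ v : ℝ → PhaseSpace n}
    (h : HasVelocity T γ v) (hc : γ 0 = γ T) (hKc : IsCompact K) (hi : (interior K).Nonempty)
    (hL : supportLength K T v = 0) : action T γ = 0 :=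
  by_contra fun hA =>
    (h.supportLength_pos hc hKc hi (h.exists_ne_of_action_ne_zero hc hA)).ne' hL

theorem exists_isoperimetric_maximizer [Nontrivial (PhaseSpace n)] (hKc : IsCompact K)
    (hi : (interior K).Nonempty) :
    ∃ γ v : ℝ → PhaseSpace n, HasVelocity 1 γ v ∧ γ 0 = γ 1 ∧ supportLength K 1 v ≤ 1 ∧
      0 < action 1 γ ∧ ∀ T' γ' v', HasVelocity T' γ' v' → γ' 0 = γ' T' →
        action T' γ' ≤ supportLength K T' v' ^ 2 * action 1 γ := by
  obtain ⟨p, hp⟩ := hi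
  obtain ⟨r, hr, hB⟩ := exists_closedBall_subset_of_mem_interior hp
  obtain ⟨f, hf, hmax⟩ := exists_isMaxOn_action_unitLoops hr hB
  have action_le : ∀ T' γ' v', HasVelocity T' γ' v' → γ' 0 = γ' T' →
      action T' γ' ≤ supportLength K T' v' ^ 2 * action 1 (extendCurve f) := by
    intro T γ v h hc
    rcases (h.supportLength_nonneg hc hKc ⟨p, interior_subset hp⟩).eq_or_lt with hL | hL
    · rw [h.action_eq_zero_of_supportLength_eq_zero hc hKc ⟨p, hp⟩ hL.symm, ← hL]
      simp
    · obtain ⟨g, hg, hgeq⟩ := h.exists_unitLoop_action_eq hc hKc hr hB hL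
      rw [hgeq]
      exact mul_le_mul_of_nonneg_left (hmax hg) (sq_nonneg _)
  refine ⟨extendCurve f, _, hasVelocity_extendCurve hr hB hf, extendCurve_closed hf,
    supportLength_unitLoop_le hKc hr hB hf, ?_, action_le⟩
  obtain ⟨γ, v, h, hc, hpos⟩ := exists_loop_action_pos (n := n)
  exact pos_of_mul_pos_right (hpos.trans_le (action_le _ γ v h hc)) (sq_nonneg _)

/-- The isoperimetric inequality `4 m 𝒜(γ) ≤ (∫ h_K(-J γ'))²` for closed curves `γ`. -/
def IsoperimetricInequality (K : Set (PhaseSpace n)) (m : ℝ) : Prop :=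
  ∀ T (γ v : ℝ → PhaseSpace n), HasVelocity T γ v → γ 0 = γ T →
    4 * m * action T γ ≤ supportLength K T v ^ 2

/-- A closed curve with velocity `v` for which the isoperimetric inequality with constant `m` is
an equality, scaled to have action `m`. -/
structure IsIsoperimetricExtremal (K : Set (PhaseSpace n)) (m T : ℝ) (γ v : ℝ → PhaseSpace n) :
    Prop where
  hasVelocity : HasVelocity T γ v
  closed : γ 0 = γ T
  supportLength_le : supportLength K T v ≤ 2 * m
  action_eq : action T γ = m

theorem exists_isoperimetric_constant [Nontrivial (PhaseSpace n)] (hKc : IsCompact K)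
    (hi : (interior K).Nonempty) :
    ∃ m : ℝ, 0 < m ∧ IsoperimetricInequality K m ∧ ∃ γ v, IsIsoperimetricExtremal K m 1 γ v := by
  obtain ⟨γ, v, hv, hc, hlength, hpos, hmax⟩ := exists_isoperimetric_maximizer hKc hi
  set M := action 1 γ
  refine ⟨1 / (4 * M), by positivity, fun T' γ' v' h' hc' => ?_,
    fun t => (1 / (2 * M)) • γ t, _, ⟨hv.const_smul (1 / (2 * M)), congrArg _ hc, ?_, ?_⟩⟩
  · have hle := hmax T' γ' v' h' hc'
    rw [← div_le_iff₀ hpos] at hle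
    exact (le_of_eq (by field_simp)).trans hle
  · rw [supportLength_const_smul (by positivity)]
    calc _ ≤ 1 / (2 * M) * 1 := mul_le_mul_of_nonneg_left hlength (by positivity)
      _ = 2 * (1 / (4 * M)) := by field_simp; norm_num
  · rw [hv.action_const_smul]
    change (1 / (2 * M)) ^ 2 * M = _
    field_simp
    norm_num

end Isoperimetric

section MetricProjection

variable {E : Type*} [NormedAddCommGroup E] [InnerProductSpace ℝ E] {K : Set E} {P : E → E}

/-- `P` is the nearest point projection onto the convex set `K`, expressed by its variational
inequality. -/
structure IsMetricProjection (K : Set E) (P : E → E) : Prop where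
  mem : ∀ x, P x ∈ K
  inner_nonpos : ∀ x, ∀ y ∈ K, ⟪x - P x, y - P x⟫ ≤ 0

theorem exists_isMetricProjection (hK : Convex ℝ K) (hKc : IsComplete K) (hne : K.Nonempty) :
    ∃ P, IsMetricProjection K P := by
  choose P hP hmin using exists_norm_eq_iInf_of_complete_convex hne hKc hK
  exact ⟨P, hP, fun x => (norm_eq_iInf_iff_real_inner_le_zero hK (hP x)).1 (hmin x)⟩

namespace IsMetricProjection

theorem lipschitzWith (hP : IsMetricProjection K P) : LipschitzWith 1 P :=
  LipschitzWith.of_dist_le_mul fun x y => by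
    rw [NNReal.coe_one, one_mul, dist_eq_norm, dist_eq_norm]
    have hxy := hP.inner_nonpos x (P y) (hP.mem y)
    have hyx := hP.inner_nonpos y (P x) (hP.mem x)
    have hsq : ‖P x - P y‖ * ‖P x - P y‖ ≤ ‖x - y‖ * ‖P x - P y‖ :=
      calc _ = ⟪P x - P y, P x - P y⟫ := (real_inner_self_eq_norm_mul_norm _).symm
        _ ≤ ⟪x - y, P x - P y⟫ := by
          simp only [inner_sub_left, inner_sub_right] at hxy hyx ⊢
          linarith
        _ ≤ _ := real_inner_le_norm _ _
    rcases (norm_nonneg (P x - P y)).eq_or_lt with h₀ | h₀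
    · exact h₀ ▸ norm_nonneg _
    · exact le_of_mul_le_mul_right hsq h₀

theorem norm_sub_sq_le (hP : IsMetricProjection K P) (x : E) {y : E} (hy : y ∈ K) :
    ‖x - P x‖ ^ 2 ≤ ‖x - y‖ ^ 2 := by
  have hinner := hP.inner_nonpos x y hy
  rw [← sub_sub_sub_cancel_right x y (P x), norm_sub_sq_real (x - P x)]
  linarith [sq_nonneg ‖y - P x‖]

theorem supportFn_sub (hP : IsMetricProjection K P) (x : E) :
    supportFn K (x - P x) = ⟪x - P x, P x⟫ := by
  have hle : ∀ y ∈ K, ⟪x - P x, y⟫ ≤ ⟪x - P x, P x⟫ := fun y hy => by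
    rw [← sub_nonpos, ← inner_sub_right]
    exact hP.inner_nonpos x y hy
  exact le_antisymm (supportFn_le ⟨_, hP.mem x⟩ hle)
    (le_csSup ⟨_, forall_mem_image.2 hle⟩ ⟨_, hP.mem x, rfl⟩)

end IsMetricProjection

end MetricProjection

section Translate

variable {E : Type*} [NormedAddCommGroup E] [InnerProductSpace ℝ E] {K : Set E} {P : E → E} {T : ℝ}

theorem integral_norm_add_const_sq [CompleteSpace E] {q : ℝ → E} (hq : Continuous q) (a : E) :
    ∫ t in (0 : ℝ)..T, ‖q t + a‖ ^ 2 =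
      (∫ t in (0 : ℝ)..T, ‖q t‖ ^ 2) + 2 * ⟪∫ t in (0 : ℝ)..T, q t, a⟫ + T * ‖a‖ ^ 2 := by
  simp only [norm_add_sq_real]
  rw [intervalIntegral.integral_add, intervalIntegral.integral_add,
    intervalIntegral.integral_const_mul,
    integral_inner_const (hq.intervalIntegrable _ _), intervalIntegral.integral_const,
    smul_eq_mul, sub_zero]
  all_goals exact Continuous.intervalIntegrable (by fun_prop) _ _

theorem integral_eq_zero_of_forall_integral_norm_sq_le [CompleteSpace E] {q : ℝ → E} (hT : 0 < T)
    (hq : Continuous q)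
    (h : ∀ a, ∫ t in (0 : ℝ)..T, ‖q t‖ ^ 2 ≤ ∫ t in (0 : ℝ)..T, ‖q t + a‖ ^ 2) :
    ∫ t in (0 : ℝ)..T, q t = 0 := by
  set Q := ∫ t in (0 : ℝ)..T, q t with hQ
  have hle := h (-(1 / T) • Q)
  rw [integral_norm_add_const_sq hq, ← hQ, real_inner_smul_right, real_inner_self_eq_norm_sq,
    norm_smul, mul_pow, Real.norm_eq_abs, sq_abs] at hle
  have hquad : 2 * (-(1 / T) * ‖Q‖ ^ 2) + T * ((-(1 / T)) ^ 2 * ‖Q‖ ^ 2) = -(1 / T * ‖Q‖ ^ 2) := by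
    field_simp
    ring
  have hQ₀ : 1 / T * ‖Q‖ ^ 2 ≤ 0 := by linarith
  simpa using (nonpos_of_mul_nonpos_right hQ₀ (by positivity)).antisymm (sq_nonneg _)

theorem IsMetricProjection.exists_integral_sq_dist_minimal [ProperSpace E]
    (hP : IsMetricProjection K P) (hKb : Bornology.IsBounded K) (hT : 0 < T) {z : ℝ → E}
    (hz : Continuous z) :
    ∃ x, ∀ y, ∫ t in (0 : ℝ)..T, ‖x + z t - P (x + z t)‖ ^ 2 ≤
      ∫ t in (0 : ℝ)..T, ‖y + z t - P (y + z t)‖ ^ 2 := by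
  have hPc := hP.lipschitzWith.continuous
  obtain ⟨R, hR⟩ := hKb.exists_norm_le
  obtain ⟨C, hC⟩ := isCompact_Icc.exists_bound_of_continuousOn (s := Icc 0 T) hz.continuousOn
  refine Continuous.exists_forall_le
    (intervalIntegral.continuous_parametric_intervalIntegral_of_continuous' (by fun_prop) 0 T)
    (tendsto_atTop_mono' _ ?_ ((tendsto_atTop_add_const_right _ (-(C + R))
      tendsto_norm_cocompact_atTop).const_mul_atTop hT))
  filter_upwards [tendsto_norm_cocompact_atTop.eventually_ge_atTop (C + R + 1)] with x hx
  calc T * (‖x‖ + -(C + R)) = ∫ _ in (0 : ℝ)..T, (‖x‖ + -(C + R)) := by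
        rw [intervalIntegral.integral_const, smul_eq_mul, sub_zero]
    _ ≤ _ := intervalIntegral.integral_mono_on hT.le (by simp)
        (Continuous.intervalIntegrable (by fun_prop) _ _) fun t ht => ?_
  have hdist : ‖x‖ - (C + R) ≤ ‖x + z t - P (x + z t)‖ :=
    calc ‖x‖ - (C + R) ≤ ‖x‖ - ‖P (x + z t) - z t‖ := by
          linarith [norm_sub_le (P (x + z t)) (z t), hC t ht, hR _ (hP.mem (x + z t))]
      _ ≤ ‖x - (P (x + z t) - z t)‖ := norm_sub_norm_le _ _
      _ = _ := by congr 1; abel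
  nlinarith

/-- The translate of `z` with minimal mean squared distance to `K` lies in `K`: the outward normals
along it have mean zero, so testing the hypothesis with them shows that they vanish. -/
theorem exists_add_mem_of_forall_integral_inner_le [ProperSpace E] {z : ℝ → E}
    (hT : 0 < T) (hK : Convex ℝ K) (hKc : IsCompact K) (hne : K.Nonempty) (hz : Continuous z)
    (hvar : ∀ w : ℝ → E, Continuous w → ∫ t in (0 : ℝ)..T, w t = 0 →
      ∫ t in (0 : ℝ)..T, ⟪w t, z t⟫ ≤ ∫ t in (0 : ℝ)..T, supportFn K (w t)) :
    ∃ x, ∀ t ∈ Icc 0 T, z t + x ∈ K := by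
  obtain ⟨P, hP⟩ := exists_isMetricProjection hK hKc.isComplete hne
  have hPc := hP.lipschitzWith.continuous
  obtain ⟨x, hx⟩ := hP.exists_integral_sq_dist_minimal hKc.isBounded hT hz
  set q : ℝ → E := fun t => x + z t - P (x + z t) with hq
  have hqc : Continuous q := by fun_prop
  have hmean : ∫ t in (0 : ℝ)..T, q t = 0 := by
    refine integral_eq_zero_of_forall_integral_norm_sq_le hT hqc fun a => (hx (x + a)).trans ?_
    refine intervalIntegral.integral_mono_on hT.le
      (Continuous.intervalIntegrable (by fun_prop) _ _)
      (Continuous.intervalIntegrable (by fun_prop) _ _) fun t _ => ?_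
    convert hP.norm_sub_sq_le (x + a + z t) (hP.mem (x + z t)) using 3
    simp only [hq]
    abel
  have hsq : ∫ t in (0 : ℝ)..T, ‖q t‖ ^ 2 =
      (∫ t in (0 : ℝ)..T, ⟪q t, z t⟫) - ∫ t in (0 : ℝ)..T, supportFn K (q t) := by
    have hqx : ∫ t in (0 : ℝ)..T, ⟪q t, x⟫ = 0 := by
      rw [integral_inner_const (hqc.intervalIntegrable _ _), hmean, inner_zero_left]
    have hpt : ∀ t, ‖q t‖ ^ 2 = ⟪q t, x⟫ + ⟪q t, z t⟫ - supportFn K (q t) := fun t => by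
      rw [hP.supportFn_sub, ← inner_add_right, ← inner_sub_right, real_inner_self_eq_norm_sq]
    simp only [hpt]
    obtain ⟨C, hC⟩ := exists_lipschitzWith_supportFn hKc hne
    have hsc := hC.continuous
    rw [intervalIntegral.integral_sub, intervalIntegral.integral_add, hqx, zero_add]
    all_goals exact Continuous.intervalIntegrable (by fun_prop) _ _
  refine ⟨x, fun t ht => ?_⟩
  by_contra hnot
  have hqt : q t ≠ 0 := fun h₀ => hnot (by
    rw [add_comm, sub_eq_zero.1 h₀]
    exact hP.mem _)
  have hpos : 0 < ∫ t in (0 : ℝ)..T, ‖q t‖ ^ 2 :=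
    intervalIntegral.integral_pos hT (by fun_prop) (fun _ _ => by positivity)
      ⟨t, ht, by positivity⟩
  linarith [hvar q hqc hmean]

end Translate

theorem hasDerivAt_zero_of_norm_sub_le {E F : Type*} [NormedAddCommGroup E] [NormedSpace ℝ E]
    [NormedAddCommGroup F] [NormedSpace ℝ F] {f : ℝ → E} {g : ℝ → F} {t : ℝ}
    (hg : HasDerivAt g 0 t) (h : ∀ s, ‖f s - f t‖ ≤ ‖g s - g t‖) : HasDerivAt f 0 t := by
  rw [hasDerivAt_iff_isLittleO] at hg ⊢
  simp only [smul_zero, sub_zero] at hg ⊢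
  exact (Asymptotics.isBigO_of_le _ h).trans_isLittleO hg

namespace HasVelocity

variable {n : ℕ} {K : Set (PhaseSpace n)} {T : ℝ} {γ v γ' v' : ℝ → PhaseSpace n}

theorem supportLength_add_le (h : HasVelocity T γ v) (h' : HasVelocity T γ' v') (hKc : IsCompact K)
    (hne : K.Nonempty) :
    supportLength K T (fun t => v t + v' t) ≤ supportLength K T v + supportLength K T v' := by
  have hint := h.intervalIntegrable_supportFn hKc hne
  have hint' := h'.intervalIntegrable_supportFn hKc hne
  rw [supportLength, supportLength, supportLength, ← intervalIntegral.integral_add hint hint']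
  refine intervalIntegral.integral_mono_on h.nonneg
    ((h.add h').intervalIntegrable_supportFn hKc hne) (hint.add hint') fun t _ => ?_
  rw [map_add, neg_add]
  exact supportFn_add_le hKc hne _ _

theorem action_add (h : HasVelocity T γ v) (h' : HasVelocity T γ' v') (hc : γ 0 = γ T)
    (hc' : γ' 0 = γ' T) :
    action T (fun t => γ t + γ' t) =
      action T γ + (∫ t in (0 : ℝ)..T, ⟪-(stdJ n (v' t)), γ t⟫) + action T γ' := by
  have hvγ := h.intervalIntegrable_inner_neg_stdJ h.continuousOn
  have hvγ' := h.intervalIntegrable_inner_neg_stdJ h'.continuousOn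
  have hv'γ := h'.intervalIntegrable_inner_neg_stdJ h.continuousOn
  have hv'γ' := h'.intervalIntegrable_inner_neg_stdJ h'.continuousOn
  have hcomm := h.integral_inner_neg_stdJ_comm h' hc hc'
  rw [(h.add h').action_eq, h.action_eq, h'.action_eq]
  simp only [map_add, neg_add, inner_add_left, inner_add_right]
  rw [intervalIntegral.integral_add (hvγ.add hv'γ) (hvγ'.add hv'γ'),
    intervalIntegral.integral_add hvγ hv'γ, intervalIntegral.integral_add hvγ' hv'γ', hcomm]
  ring

theorem ae_mem_normalCone_of_supportLength_le (h : HasVelocity T γ v) (hKc : IsCompact K)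
    (hmem : ∀ t ∈ Icc 0 T, γ t ∈ K) (hL : supportLength K T v ≤ 2 * action T γ) :
    ∀ᵐ t ∂(volume.restrict (Icc 0 T)), -(stdJ n (v t)) ∈ normalCone K (γ t) := by
  set δ : ℝ → ℝ := fun t => supportFn K (-(stdJ n (v t))) - ⟪-(stdJ n (v t)), γ t⟫
  have hδ₀ : ∀ t ∈ Icc 0 T, 0 ≤ δ t := fun t ht =>
    sub_nonneg.2 (inner_le_supportFn hKc _ (hmem t ht))
  have hsupport := h.intervalIntegrable_supportFn hKc ⟨_, hmem 0 h.zero_mem⟩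
  have hinner := h.intervalIntegrable_inner_neg_stdJ h.continuousOn
  have hδ : ∫ t in Icc 0 T, δ t = 0 := by
    rw [integral_Icc_eq_integral_Ioc, ← intervalIntegral.integral_of_le h.nonneg]
    refine le_antisymm ?_ (intervalIntegral.integral_nonneg h.nonneg hδ₀)
    rw [intervalIntegral.integral_sub hsupport hinner, ← supportLength]
    linarith [h.action_eq]
  rw [integral_eq_zero_iff_of_nonneg_ae ((ae_restrict_mem measurableSet_Icc).mono hδ₀)
    ((intervalIntegrable_iff_integrableOn_Icc_of_le h.nonneg).1 (hsupport.sub hinner))] at hδ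
  exact hδ.mono fun t ht => mem_normalCone_of_supportFn_le hKc (sub_eq_zero.1 ht).le

/-- Near an interior point the normal cone is trivial, so the distance to `γ t₀`, truncated at the
radius of a ball around `γ t₀` in `K`, is absolutely continuous with derivative zero. -/
theorem eq_of_mem_interior (h : HasVelocity T γ v)
    (hv : ∀ᵐ t ∂(volume.restrict (Icc 0 T)), -(stdJ n (v t)) ∈ normalCone K (γ t)) {t₀ : ℝ}
    (ht₀ : t₀ ∈ Icc 0 T) (hint : γ t₀ ∈ interior K) : ∀ t ∈ Icc 0 T, γ t = γ t₀ := by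
  obtain ⟨r, hr, hB⟩ := Metric.isOpen_iff.1 isOpen_interior _ hint
  set d : ℝ → ℝ := fun t => min (dist (γ t) (γ t₀)) r
  have hdist : ∀ s t, |d s - d t| ≤ dist (γ s) (γ t) := fun s t =>
    (abs_min_sub_min_le_max _ _ _ _).trans (max_le (abs_dist_sub_le _ _ _) (by simp))
  have hAC : AbsolutelyContinuousOnInterval d 0 T :=
    absolutelyContinuousOnInterval_of_dist_le h.absolutelyContinuous h.absolutelyContinuous (C := 1)
      fun s _ t _ => by
        rw [Real.dist_eq]
        linarith [hdist s t, dist_nonneg (x := γ s) (y := γ t)]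
  obtain ⟨C, hC⟩ := hAC.const_of_ae_hasDerivAt_zero (by
    filter_upwards [hAC.boundedVariationOn.ae_differentiableAt_of_mem_uIcc,
      (ae_restrict_iff' measurableSet_Icc).1 hv,
      (ae_restrict_iff' measurableSet_Icc).1 h.ae_hasDerivAt] with t hdiff hnormal hderiv ht
    rcases lt_or_ge (dist (γ t) (γ t₀)) r with hlt | hge
    · rw [uIcc_of_le h.nonneg] at ht
      have hzero := eq_zero_of_mem_normalCone_of_mem_interior (hB hlt) (hnormal ht)
      rw [neg_eq_zero, ← norm_eq_zero, norm_stdJ, norm_eq_zero] at hzero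
      exact hasDerivAt_zero_of_norm_sub_le (hzero ▸ hderiv ht) fun s => hdist s t
    · have hmax : IsLocalMax d t := Eventually.of_forall fun s => by
        simp only [d, min_eq_right hge, min_le_right]
      exact hmax.deriv_eq_zero ▸ (hdiff ht).hasDerivAt)
  rw [uIcc_of_le h.nonneg] at hC
  intro t ht
  have hdt : d t = 0 :=
    calc d t = d t₀ := (hC t ht).trans (hC t₀ ht₀).symm
      _ = 0 := by simp only [d, dist_self, min_eq_left hr.le]
  exact dist_le_zero.1 ((min_le_iff.1 hdt.le).resolve_right hr.not_ge)

theorem isClosedCharacteristic_of_supportLength_le (h : HasVelocity T γ v) (hc : γ 0 = γ T)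
    (hKc : IsCompact K) (hmem : ∀ t ∈ Icc 0 T, γ t ∈ K) (hL : supportLength K T v ≤ 2 * action T γ)
    (hnc : ∃ t ∈ Icc 0 T, γ t ≠ γ 0) : IsClosedCharacteristic K T γ := by
  obtain ⟨t₁, ht₁, hne⟩ := hnc
  have hv := h.ae_mem_normalCone_of_supportLength_le hKc hmem hL
  have hT : 0 < T := h.nonneg.lt_of_ne' fun hT => by
    rw [hT, Icc_self] at ht₁
    exact hne (congrArg γ ht₁)
  refine .of_hasVelocity hT h hc
    (fun t ht => ⟨subset_closure (hmem t ht), fun hint => hne ?_⟩) hv ⟨t₁, ht₁, hne⟩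
  have hconst := h.eq_of_mem_interior hv ht hint
  exact (hconst t₁ ht₁).trans (hconst 0 h.zero_mem).symm

end HasVelocity

namespace IsIsoperimetricExtremal

variable {n : ℕ} {K : Set (PhaseSpace n)} {m T : ℝ} {γ v : ℝ → PhaseSpace n}

/-- First variation: compare `γ` with the closed curves `γ + ε γ'` and let `ε → 0`. -/
theorem integral_inner_le_supportLength (h : IsIsoperimetricExtremal K m T γ v) (hm : 0 < m)
    (hKc : IsCompact K) (hne : K.Nonempty) (hiso : IsoperimetricInequality K m)
    {γ' v' : ℝ → PhaseSpace n} (h' : HasVelocity T γ' v') (hc' : γ' 0 = γ' T) :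
    ∫ t in (0 : ℝ)..T, ⟪-(stdJ n (v' t)), γ t⟫ ≤ supportLength K T v' := by
  set B := ∫ t in (0 : ℝ)..T, ⟪-(stdJ n (v' t)), γ t⟫
  set L := supportLength K T v'
  have hvariation : ∀ ε > 0, 4 * m * (B - L) ≤ ε * (L ^ 2 - 4 * m * action T γ') := fun ε hε => by
    have hc : ε • γ' 0 = ε • γ' T := congrArg _ hc'
    have hε' := h'.const_smul ε
    have hsum := h.hasVelocity.add hε'
    have hclosed : γ 0 + ε • γ' 0 = γ T + ε • γ' T := congrArg₂ _ h.closed hc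
    have haction : action T (fun t => γ t + ε • γ' t) = m + ε * B + ε ^ 2 * action T γ' := by
      rw [h.hasVelocity.action_add hε' h.closed hc, h.action_eq, h'.action_const_smul]
      simp only [map_smul, ← smul_neg, real_inner_smul_left, intervalIntegral.integral_const_mul, B]
    have hlength : supportLength K T (fun t => v t + ε • v' t) ≤ 2 * m + ε * L :=
      calc _ ≤ supportLength K T v + supportLength K T (fun t => ε • v' t) :=
            h.hasVelocity.supportLength_add_le hε' hKc hne
        _ ≤ _ := by
            rw [supportLength_const_smul hε.le]
            exact add_le_add_left h.supportLength_le _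
    have hle := (hiso T _ _ hsum hclosed).trans
      (pow_le_pow_left₀ (hsum.supportLength_nonneg hclosed hKc hne) hlength 2)
    rw [haction] at hle
    refine le_of_mul_le_mul_left ?_ hε
    linear_combination hle
  have hcontinuous : Continuous fun ε : ℝ => ε * (L ^ 2 - 4 * m * action T γ') := by fun_prop
  have hlim : Tendsto (fun ε => ε * (L ^ 2 - 4 * m * action T γ')) (𝓝[>] 0) (𝓝 0) :=
    (hcontinuous.tendsto' 0 0 (zero_mul _)).mono_left nhdsWithin_le_nhds
  have hle := ge_of_tendsto hlim (eventually_mem_nhdsWithin.mono hvariation)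
  exact sub_nonpos.1 (nonpos_of_mul_nonpos_right hle (by positivity))

theorem period_pos (h : IsIsoperimetricExtremal K m T γ v) (hm : m ≠ 0) : 0 < T := by
  refine h.hasVelocity.nonneg.lt_of_ne ?_
  rintro rfl
  exact hm (by simpa [action] using h.action_eq.symm)

theorem exists_translate_mem (h : IsIsoperimetricExtremal K m T γ v) (hm : 0 < m)
    (hK : Convex ℝ K) (hKc : IsCompact K) (hne : K.Nonempty) (hiso : IsoperimetricInequality K m) :
    ∃ x, ∀ t ∈ Icc 0 T, γ t + x ∈ K := by
  have hT := h.period_pos hm.ne'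
  set z : ℝ → PhaseSpace n := IccExtend hT.le ((Icc 0 T).domRestrict γ)
  have hzγ : ∀ t ∈ Icc 0 T, z t = γ t := fun t ht => IccExtend_of_mem _ _ ht
  have hvar : ∀ w : ℝ → PhaseSpace n, Continuous w → ∫ t in (0 : ℝ)..T, w t = 0 →
      ∫ t in (0 : ℝ)..T, ⟪w t, z t⟫ ≤ ∫ t in (0 : ℝ)..T, supportFn K (w t) := fun w hw hw₀ => by
    have hloop := HasVelocity.primitive hT.le (v := fun t => stdJ n (w t))
      (memLp_two_of_continuousOn (by fun_prop)) 0
    have hle := h.integral_inner_le_supportLength hm hKc hne hiso hloop (by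
      rw [(stdJ n).intervalIntegral_comp_comm (hw.intervalIntegrable 0 T), hw₀]
      simp)
    simp only [supportLength, stdJ_stdJ, neg_neg] at hle
    refine le_of_eq_of_le (intervalIntegral.integral_congr fun t ht => ?_) hle
    rw [uIcc_of_le hT.le] at ht
    simp only [hzγ t ht]
  obtain ⟨x, hx⟩ := exists_add_mem_of_forall_integral_inner_le hT hK hKc hne
    h.hasVelocity.continuousOn.domRestrict.Icc_extend' hvar
  exact ⟨x, fun t ht => hzγ t ht ▸ hx t ht⟩

theorem exists_translate_isClosedCharacteristic (h : IsIsoperimetricExtremal K m T γ v)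
    (hm : 0 < m) (hK : Convex ℝ K) (hKc : IsCompact K) (hne : K.Nonempty)
    (hiso : IsoperimetricInequality K m) :
    ∃ x, IsClosedCharacteristic K T (fun t => γ t + x) := by
  obtain ⟨x, hx⟩ := h.exists_translate_mem hm hK hKc hne hiso
  have hγx := h.hasVelocity.add_const x
  have hA : action T (fun t => γ t + x) = m :=
    (h.hasVelocity.action_add_const h.closed x).trans h.action_eq
  have hcx : γ 0 + x = γ T + x := congrArg (· + x) h.closed
  exact ⟨x, hγx.isClosedCharacteristic_of_supportLength_le hcx hKc hx
    (hA.symm ▸ h.supportLength_le) (hγx.exists_ne_of_action_ne_zero hcx (hA ▸ hm.ne'))⟩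

end IsIsoperimetricExtremal

section Capacity

variable {n : ℕ} {K : Set (PhaseSpace n)} {T : ℝ} {γ v : ℝ → PhaseSpace n}

theorem IsoperimetricInequality.le_action {m : ℝ} (hiso : IsoperimetricInequality K m)
    (hKc : IsCompact K) (hi : (interior K).Nonempty) (h : IsClosedCharacteristic K T γ) :
    m ≤ action T γ := by
  have hle := hiso T γ _ h.hasVelocity h.closed
  have hpos := h.action_pos hKc hi
  rw [h.supportLength_eq hKc] at hle
  nlinarith

theorem IsSystole.action_eq (h : IsSystole K T γ) : action T γ = ehzCapacity K := by
  have hleast : IsLeast {a | ∃ T γ, IsClosedCharacteristic K T γ ∧ action T γ = a} (action T γ) :=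
    ⟨⟨T, γ, h.1, rfl⟩, by rintro _ ⟨T', γ', h', rfl⟩; exact h.2 T' γ' h'⟩
  exact hleast.csInf_eq.symm

theorem IsSystole.of_action_le (h : IsClosedCharacteristic K T γ) {T' : ℝ} {γ' : ℝ → PhaseSpace n}
    (h' : IsSystole K T' γ') (hA : action T γ ≤ ehzCapacity K) : IsSystole K T γ :=
  ⟨h, fun T₁ γ₁ h₁ => (hA.trans_eq h'.action_eq.symm).trans (h'.2 T₁ γ₁ h₁)⟩

variable [Nontrivial (PhaseSpace n)]

theorem isoperimetricInequality_ehzCapacity_and_exists_isSystole (hK : Convex ℝ K)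
    (hKc : IsCompact K) (hi : (interior K).Nonempty) :
    IsoperimetricInequality K (ehzCapacity K) ∧ ∃ T γ, IsSystole K T γ := by
  obtain ⟨m, hm, hiso, γ, v, h⟩ := exists_isoperimetric_constant hKc hi
  obtain ⟨x, hx⟩ := h.exists_translate_isClosedCharacteristic hm hK hKc
    (hi.mono interior_subset) hiso
  have hA : action 1 (fun t => γ t + x) = m :=
    (h.hasVelocity.action_add_const h.closed x).trans h.action_eq
  have hsystole : IsSystole K 1 (fun t => γ t + x) :=
    ⟨hx, fun T' γ' h' => hA.trans_le (hiso.le_action hKc hi h')⟩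
  exact ⟨hsystole.action_eq ▸ hA.symm ▸ hiso, 1, _, hsystole⟩

theorem isoperimetricInequality_ehzCapacity (hK : Convex ℝ K) (hKc : IsCompact K)
    (hi : (interior K).Nonempty) : IsoperimetricInequality K (ehzCapacity K) :=
  (isoperimetricInequality_ehzCapacity_and_exists_isSystole hK hKc hi).1

theorem exists_isSystole (hK : Convex ℝ K) (hKc : IsCompact K) (hi : (interior K).Nonempty) :
    ∃ T γ, IsSystole K T γ :=
  (isoperimetricInequality_ehzCapacity_and_exists_isSystole hK hKc hi).2

theorem ehzCapacity_pos (hK : Convex ℝ K) (hKc : IsCompact K) (hi : (interior K).Nonempty) :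
    0 < ehzCapacity K := by
  obtain ⟨T, γ, h⟩ := exists_isSystole hK hKc hi
  exact h.action_eq ▸ h.1.action_pos hKc hi

theorem IsClosedCharacteristic.isSystole (h : IsClosedCharacteristic K T γ) (hK : Convex ℝ K)
    (hKc : IsCompact K) (hi : (interior K).Nonempty) (hA : action T γ ≤ ehzCapacity K) :
    IsSystole K T γ := by
  obtain ⟨T', γ', h'⟩ := exists_isSystole hK hKc hi
  exact .of_action_le h h' hA

theorem HasVelocity.exists_translate_isSystole (h : HasVelocity T γ v) (hc : γ 0 = γ T)
    (hK : Convex ℝ K) (hKc : IsCompact K) (hi : (interior K).Nonempty)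
    (hL : supportLength K T v ≤ 2 * ehzCapacity K) (hA : ehzCapacity K ≤ action T γ) :
    ∃ x, IsSystole K T (fun t => γ t + x) := by
  have hne := hi.mono interior_subset
  have hpos := ehzCapacity_pos hK hKc hi
  have hiso := isoperimetricInequality_ehzCapacity hK hKc hi
  have hA' : action T γ ≤ ehzCapacity K := by
    have hle := (hiso T γ v h hc).trans
      (pow_le_pow_left₀ (h.supportLength_nonneg hc hKc hne) hL 2)
    nlinarith
  obtain ⟨x, hx⟩ := IsIsoperimetricExtremal.exists_translate_isClosedCharacteristic
    ⟨h, hc, hL, hA'.antisymm hA⟩ hpos hK hKc hne hiso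
  exact ⟨x, hx.isSystole hK hKc hi ((h.action_add_const hc x).trans_le hA')⟩

end Capacity

/-! ### Concatenation and rotation of curves -/

section Concatenation

variable {E : Type*} [NormedAddCommGroup E]

theorem measurePreserving_const_add_restrict_Ioc (c a b : ℝ) :
    MeasurePreserving (fun t => c + t) (volume.restrict (Ioc a b))
      (volume.restrict (Ioc (c + a) (c + b))) := by
  have hpres := (measurePreserving_add_left volume c).restrict_preimage
    (measurableSet_Ioc (a := c + a) (b := c + b))
  rwa [preimage_const_add_Ioc, add_sub_cancel_left, add_sub_cancel_left] at hpres

theorem ae_restrict_Ioc_const_add_iff {c a b : ℝ} {P : ℝ → Prop} :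
    (∀ᵐ t ∂(volume.restrict (Ioc a b)), P (c + t)) ↔
      ∀ᵐ t ∂(volume.restrict (Ioc (c + a) (c + b))), P t := by
  rw [← (measurePreserving_const_add_restrict_Ioc c a b).map_eq,
    (measurableEmbedding_addLeft c).ae_map_iff]

theorem ae_restrict_Icc_zero_const_add {T a b : ℝ} {P : ℝ → Prop} (ha : 0 ≤ a) (hb : b ≤ T)
    (h : ∀ᵐ t ∂(volume.restrict (Icc 0 T)), P t) :
    ∀ᵐ t ∂(volume.restrict (Icc 0 (b - a))), P (a + t) := by
  rw [← restrict_Ioc_eq_restrict_Icc, ae_restrict_Ioc_const_add_iff, add_zero, add_sub_cancel]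
  exact ae_restrict_of_ae_restrict_of_subset
    (Ioc_subset_Icc_self.trans (Icc_subset_Icc ha hb)) h

theorem ae_restrict_Icc_zero_add_iff {a b : ℝ} (ha : 0 ≤ a) (hb : 0 ≤ b) {P : ℝ → Prop} :
    (∀ᵐ t ∂(volume.restrict (Icc 0 (a + b))), P t) ↔
      (∀ᵐ t ∂(volume.restrict (Ioc 0 a)), P t) ∧
        ∀ᵐ t ∂(volume.restrict (Ioc 0 b)), P (a + t) := by
  rw [← restrict_Ioc_eq_restrict_Icc, ae_restrict_Ioc_const_add_iff, add_zero,
    ← ae_restrict_union_iff, Ioc_union_Ioc_eq_Ioc ha (le_add_of_nonneg_right hb)]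

theorem intervalIntegrable_ite_le_sub {f g : ℝ → E} {a b : ℝ} (ha : 0 ≤ a) (hb : 0 ≤ b)
    (hf : IntervalIntegrable f volume 0 a) (hg : IntervalIntegrable g volume 0 b) :
    IntervalIntegrable (fun t => if t ≤ a then f t else g (t - a)) volume 0 a ∧
      IntervalIntegrable (fun t => if t ≤ a then f t else g (t - a)) volume a (a + b) := by
  have hg' : IntervalIntegrable (fun t => g (t - a)) volume a (a + b) := by
    simpa only [zero_add, add_comm b a] using hg.comp_sub_right a
  refine ⟨hf.congr fun t ht => ?_, hg'.congr fun t ht => ?_⟩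
  · rw [uIoc_of_le ha] at ht
    exact (if_pos ht.2).symm
  · rw [uIoc_of_le (le_add_of_nonneg_right hb)] at ht
    exact (if_neg (not_le.2 ht.1)).symm

theorem integral_ite_le_sub [NormedSpace ℝ E] {f g : ℝ → E} {a b : ℝ} (ha : 0 ≤ a) (hb : 0 ≤ b)
    (hf : IntervalIntegrable f volume 0 a) (hg : IntervalIntegrable g volume 0 b) :
    ∫ t in (0 : ℝ)..(a + b), (if t ≤ a then f t else g (t - a)) =
      (∫ t in (0 : ℝ)..a, f t) + ∫ t in (0 : ℝ)..b, g t := by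
  obtain ⟨hleft, hright⟩ := intervalIntegrable_ite_le_sub ha hb hf hg
  rw [← intervalIntegral.integral_add_adjacent_intervals hleft hright]
  congr 1
  · refine intervalIntegral.integral_congr fun t ht => ?_
    rw [uIcc_of_le ha] at ht
    exact if_pos ht.2
  · calc ∫ t in a..(a + b), (if t ≤ a then f t else g (t - a))
        = ∫ t in a..(a + b), g (t - a) := by
          refine intervalIntegral.integral_congr_ae (.of_forall fun t ht => ?_)
          rw [uIoc_of_le (le_add_of_nonneg_right hb)] at ht
          exact if_neg (not_le.2 ht.1)
      _ = ∫ t in (0 : ℝ)..b, g t := by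
          rw [intervalIntegral.integral_comp_sub_right, sub_self, add_sub_cancel_left]

theorem memLp_ite_le_sub {f g : ℝ → E} {p : ENNReal} {a b : ℝ}
    (hf : MemLp f p (volume.restrict (Icc 0 a))) (hg : MemLp g p (volume.restrict (Icc 0 b))) :
    MemLp (fun t => if t ≤ a then f t else g (t - a)) p (volume.restrict (Icc 0 (a + b))) := by
  have hg' : MemLp (fun t => g (t - a)) p (volume.restrict (Ioc a (a + b))) := by
    have hcomp : MemLp g p (volume.restrict (Ioc (-a + a) (-a + (a + b)))) := by
      rwa [neg_add_cancel, neg_add_cancel_left, restrict_Ioc_eq_restrict_Icc]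
    simpa only [Function.comp_def, neg_add_eq_sub] using
      hcomp.comp_measurePreserving (measurePreserving_const_add_restrict_Ioc (-a) a (a + b))
  have hsub : Iic a ∩ Icc 0 (a + b) ⊆ Icc 0 a := fun t ht => ⟨ht.2.1, ht.1⟩
  have hsub' : (Iic a)ᶜ ∩ Icc 0 (a + b) ⊆ Ioc a (a + b) := fun t ht => ⟨not_le.1 ht.1, ht.2.2⟩
  refine MemLp.piecewise (s := Iic a) measurableSet_Iic ?_ ?_
  · rw [Measure.restrict_restrict measurableSet_Iic]
    exact hf.mono_measure (Measure.restrict_mono hsub le_rfl)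
  · rw [Measure.restrict_restrict measurableSet_Iic.compl]
    exact hg'.mono_measure (Measure.restrict_mono hsub' le_rfl)

theorem HasVelocity.shift [NormedSpace ℝ E] {T : ℝ} {γ v : ℝ → E} (h : HasVelocity T γ v) {a b : ℝ}
    (ha : 0 ≤ a) (hab : a ≤ b) (hb : b ≤ T) :
    HasVelocity (b - a) (fun t => γ (a + t)) (fun t => v (a + t)) := by
  refine ⟨sub_nonneg.2 hab, ?_, fun t ht => ?_⟩
  · have hpres := measurePreserving_const_add_restrict_Ioc a 0 (b - a)
    rw [add_zero, add_sub_cancel, restrict_Ioc_eq_restrict_Icc, restrict_Ioc_eq_restrict_Icc]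
      at hpres
    exact (h.memLp.mono_measure (Measure.restrict_mono (Icc_subset_Icc ha hb) le_rfl)
      ).comp_measurePreserving hpres
  · rw [intervalIntegral.integral_comp_add_left (f := v), add_zero,
      ← h.sub_eq ⟨ha, hab.trans hb⟩ ⟨add_nonneg ha ht.1, by linarith [ht.2]⟩, add_sub_cancel]

theorem HasVelocity.mono [NormedSpace ℝ E] {T S : ℝ} {γ v : ℝ → E} (h : HasVelocity T γ v)
    (hS : 0 ≤ S) (hST : S ≤ T) : HasVelocity S γ v :=
  ⟨hS, h.memLp.mono_measure (Measure.restrict_mono (Icc_subset_Icc_right hST) le_rfl),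
    fun t ht => h.eq_add t ⟨ht.1, ht.2.trans hST⟩⟩

variable {n : ℕ} {a s S S' T : ℝ} {α β v w γ : ℝ → PhaseSpace n}

theorem concatAt_of_le (h : s ≤ a) : concatAt a α β s = α s := if_pos h

theorem concatAt_of_lt (h : a < s) : concatAt a α β s = β (s - a) := if_neg (not_le.2 h)

theorem concatAt_add (hαβ : α a = β 0) (hs : 0 ≤ s) : concatAt a α β (a + s) = β s := by
  rcases hs.eq_or_lt with rfl | hs
  · rw [add_zero, concatAt_of_le le_rfl, hαβ]
  · rw [concatAt_of_lt (by linarith), add_sub_cancel_left]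

theorem concatAt_mem {X : Set (PhaseSpace n)} (hα : ∀ t ∈ Icc 0 S, α t ∈ X)
    (hβ : ∀ t ∈ Icc 0 S', β t ∈ X) : ∀ t ∈ Icc 0 (S + S'), concatAt S α β t ∈ X := by
  intro t ht
  rcases le_or_gt t S with hle | hlt
  · exact concatAt_of_le (β := β) hle ▸ hα t ⟨ht.1, hle⟩
  · exact concatAt_of_lt (α := α) hlt ▸ hβ _ ⟨by linarith, by linarith [ht.2]⟩

theorem ae_concatAt_iff (hS : 0 ≤ S) (hS' : 0 ≤ S') {P : PhaseSpace n → PhaseSpace n → Prop} :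
    (∀ᵐ t ∂(volume.restrict (Icc 0 (S + S'))), P (concatAt S v w t) (concatAt S α β t)) ↔
      (∀ᵐ t ∂(volume.restrict (Icc 0 S)), P (v t) (α t)) ∧
        ∀ᵐ t ∂(volume.restrict (Icc 0 S')), P (w t) (β t) := by
  rw [ae_restrict_Icc_zero_add_iff hS hS', ← restrict_Ioc_eq_restrict_Icc,
    ← restrict_Ioc_eq_restrict_Icc, ae_restrict_iff' measurableSet_Ioc,
    ae_restrict_iff' measurableSet_Ioc, ae_restrict_iff' measurableSet_Ioc,
    ae_restrict_iff' measurableSet_Ioc]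
  refine and_congr (eventually_congr (.of_forall fun t => forall_congr' fun ht => ?_))
    (eventually_congr (.of_forall fun t => forall_congr' fun ht => ?_))
  · rw [concatAt_of_le ht.2, concatAt_of_le ht.2]
  · have hlt : S < S + t := lt_add_of_pos_right S ht.1
    rw [concatAt_of_lt hlt, concatAt_of_lt hlt, add_sub_cancel_left]

namespace HasVelocity

theorem concat (h₁ : HasVelocity S α v) (h₂ : HasVelocity S' β w) (hαβ : α S = β 0) :
    HasVelocity (S + S') (concatAt S α β) (concatAt S v w) := by
  refine ⟨add_nonneg h₁.nonneg h₂.nonneg, memLp_ite_le_sub h₁.memLp h₂.memLp, fun t ht => ?_⟩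
  rw [concatAt_of_le (s := 0) h₁.nonneg]
  rcases le_or_gt t S with hle | hlt
  · rw [concatAt_of_le hle, h₁.eq_add t ⟨ht.1, hle⟩]
    congr 1
    refine intervalIntegral.integral_congr fun r hr => ?_
    rw [uIcc_of_le ht.1] at hr
    exact (concatAt_of_le (hr.2.trans hle)).symm
  · have hmem : t - S ∈ Icc 0 S' := ⟨by linarith, by linarith [ht.2]⟩
    have hintegral := integral_ite_le_sub h₁.nonneg hmem.1 h₁.intervalIntegrable_right
      (h₂.intervalIntegrable h₂.zero_mem hmem)
    rw [add_sub_cancel] at hintegral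
    rw [concatAt_of_lt hlt, h₂.eq_add _ hmem, ← hαβ, h₁.eq_add S ⟨h₁.nonneg, le_rfl⟩, add_assoc,
      ← hintegral]
    rfl

theorem integral_inner_concat (h₁ : HasVelocity S α v) (h₂ : HasVelocity S' β w) :
    ∫ t in (0 : ℝ)..(S + S'), ⟪-(stdJ n (concatAt S v w t)), concatAt S α β t⟫ =
      (∫ t in (0 : ℝ)..S, ⟪-(stdJ n (v t)), α t⟫) +
        ∫ t in (0 : ℝ)..S', ⟪-(stdJ n (w t)), β t⟫ := by
  rw [← integral_ite_le_sub h₁.nonneg h₂.nonneg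
    (h₁.intervalIntegrable_inner_neg_stdJ h₁.continuousOn)
    (h₂.intervalIntegrable_inner_neg_stdJ h₂.continuousOn)]
  congr 1 with t
  simp only [concatAt]
  split_ifs <;> rfl

theorem supportLength_concat (h₁ : HasVelocity S α v) (h₂ : HasVelocity S' β w)
    {K : Set (PhaseSpace n)} (hKc : IsCompact K) (hne : K.Nonempty) :
    supportLength K (S + S') (concatAt S v w) = supportLength K S v + supportLength K S' w := by
  rw [supportLength, supportLength, supportLength, ← integral_ite_le_sub h₁.nonneg h₂.nonneg
    (h₁.intervalIntegrable_supportFn hKc hne) (h₂.intervalIntegrable_supportFn hKc hne)]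
  congr 1 with t
  simp only [concatAt]
  split_ifs <;> rfl

protected theorem rotate (h : HasVelocity T γ v) (hc : γ 0 = γ T) {s r : ℝ} (hs : s ∈ Icc 0 T)
    (hr : r ∈ Icc 0 T) :
    HasVelocity (T - s + r) (rotate T s γ) (concatAt (T - s) (fun t => v (s + t)) v) :=
  (h.shift hs.1 hs.2 le_rfl).concat (h.mono hr.1 hr.2) (by rw [add_sub_cancel, hc])

theorem integral_inner_rotate (h : HasVelocity T γ v) {s r : ℝ} (hs : s ∈ Icc 0 T)
    (hr : r ∈ Icc 0 T) :
    ∫ t in (0 : ℝ)..(T - s + r), ⟪-(stdJ n (concatAt (T - s) (fun t => v (s + t)) v t)),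
        rotate T s γ t⟫ =
      (∫ t in s..T, ⟪-(stdJ n (v t)), γ t⟫) + ∫ t in (0 : ℝ)..r, ⟪-(stdJ n (v t)), γ t⟫ := by
  simp only [rotate]
  rw [(h.shift hs.1 hs.2 le_rfl).integral_inner_concat (h.mono hr.1 hr.2),
    intervalIntegral.integral_comp_add_left (f := fun t => ⟪-(stdJ n (v t)), γ t⟫), add_zero,
    add_sub_cancel]

end HasVelocity

theorem hasVelocity_segmentPath (x y : PhaseSpace n) :
    HasVelocity 1 (segmentPath x y) (fun _ => y - x) := by
  refine .of_hasDerivAt zero_le_one (fun t => ?_) continuous_const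
  have h := ((hasDerivAt_id t).smul_const (y - x)).const_add x
  rw [one_smul] at h
  exact h

theorem rotate_zero (hs : s ≤ T) : rotate T s γ 0 = γ s := by
  rw [rotate, concatAt_of_le (sub_nonneg.2 hs), add_zero]

theorem rotate_sub_add (hc : γ 0 = γ T) (hs : 0 ≤ s) (t : ℝ) : rotate T t γ (T - t + s) = γ s :=
  concatAt_add (by rw [add_sub_cancel, hc]) hs

theorem rotate_self (hc : γ 0 = γ T) (hs : 0 ≤ s) : rotate T s γ T = γ s := by
  simpa only [sub_add_cancel] using rotate_sub_add hc hs s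

theorem forall_rotate_mem_iff {X : Set (PhaseSpace n)} (hc : γ 0 = γ T) (hs : s ∈ Icc 0 T) :
    (∀ t ∈ Icc 0 T, rotate T s γ t ∈ X) ↔ ∀ t ∈ Icc 0 T, γ t ∈ X := by
  refine ⟨fun h t ht => ?_, fun h t ht => ?_⟩
  · rcases le_or_gt s t with hle | hlt
    · have hmem := h (t - s) ⟨sub_nonneg.2 hle, by linarith [ht.2, hs.1]⟩
      rwa [rotate, concatAt_of_le (by linarith [ht.2]), add_sub_cancel] at hmem
    · exact rotate_sub_add hc ht.1 s ▸ h _ ⟨by linarith [ht.1, hs.2], by linarith⟩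
  · rw [← sub_add_cancel T s] at ht
    refine concatAt_mem (fun r hr => h _ ⟨add_nonneg hs.1 hr.1, by linarith [hr.2]⟩)
      (fun r hr => h _ ⟨hr.1, hr.2.trans hs.2⟩) t ht

variable {K : Set (PhaseSpace n)}

theorem IsClosedCharacteristic.ae_mem_normalCone (h : IsClosedCharacteristic K T γ)
    (hγ : HasVelocity T γ v) :
    ∀ᵐ t ∂(volume.restrict (Icc 0 T)), -(stdJ n (v t)) ∈ normalCone K (γ t) := by
  filter_upwards [h.velocity_mem, hγ.ae_deriv_eq] with t hmem hderiv
  rwa [← hderiv]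

theorem IsClosedCharacteristic.hasVelocity_rotate (h : IsClosedCharacteristic K T γ)
    (hs : s ∈ Icc 0 T) :
    HasVelocity T (rotate T s γ) (concatAt (T - s) (fun t => deriv γ (s + t)) (deriv γ)) := by
  simpa only [sub_add_cancel] using h.hasVelocity.rotate h.closed hs hs

theorem isClosedCharacteristic_rotate (h : IsClosedCharacteristic K T γ) (hs : s ∈ Icc 0 T) :
    IsClosedCharacteristic K T (rotate T s γ) := by
  refine .of_hasVelocity h.period_pos (h.hasVelocity_rotate hs)
    ((rotate_zero hs.2).trans (rotate_self h.closed hs.1).symm)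
    ((forall_rotate_mem_iff h.closed hs).2 h.mem_frontier) ?_ ?_
  · have hconcat := (ae_concatAt_iff (P := fun v x => -(stdJ n v) ∈ normalCone K x)
      (sub_nonneg.2 hs.2) hs.1).2 ⟨ae_restrict_Icc_zero_const_add hs.1 le_rfl h.velocity_mem,
        ae_restrict_of_ae_restrict_of_subset (Icc_subset_Icc_right hs.2) h.velocity_mem⟩
    rwa [sub_add_cancel] at hconcat
  · by_contra! hconst
    obtain ⟨t, ht, hne⟩ := h.nonconstant
    have hγ := (forall_rotate_mem_iff (X := {rotate T s γ 0}) h.closed hs).1 hconst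
    exact hne ((hγ t ht).trans (hγ 0 h.hasVelocity.zero_mem).symm)

theorem IsClosedCharacteristic.action_rotate (h : IsClosedCharacteristic K T γ)
    (hs : s ∈ Icc 0 T) : action T (rotate T s γ) = action T γ := by
  have hrotate := h.hasVelocity.integral_inner_rotate hs hs
  rw [sub_add_cancel] at hrotate
  have hint := h.hasVelocity.intervalIntegrable_inner_neg_stdJ h.hasVelocity.continuousOn
  have hs' : s ∈ uIcc 0 T := Icc_subset_uIcc hs
  rw [(h.hasVelocity_rotate hs).action_eq, hrotate, add_comm,
    intervalIntegral.integral_add_adjacent_intervals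
      (hint.mono_set (uIcc_subset_uIcc left_mem_uIcc hs'))
      (hint.mono_set (uIcc_subset_uIcc hs' right_mem_uIcc)), action]

end Concatenation

section Pieces

variable {n : ℕ} {K : Set (PhaseSpace n)} {u x w : PhaseSpace n} {h : ℝ}

theorem lowerPiece_eq_upperPiece (K : Set (PhaseSpace n)) (u : PhaseSpace n) (h : ℝ) :
    lowerPiece K u h = upperPiece K (-u) (-h) := by
  ext x
  simp [lowerPiece, upperPiece, inner_neg_left]

theorem hyperplane_neg (u : PhaseSpace n) (h : ℝ) : hyperplane (-u) (-h) = hyperplane u h := by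
  ext x
  simp [hyperplane, inner_neg_left]

theorem isClosed_hyperplane (u : PhaseSpace n) (h : ℝ) : IsClosed (hyperplane u h) :=
  isClosed_eq (f := fun x : PhaseSpace n => ⟪u, x⟫) (by fun_prop) continuous_const

theorem upperPiece_subset : upperPiece K u h ⊆ K := inter_subset_left

theorem convex_upperPiece (hK : Convex ℝ K) : Convex ℝ (upperPiece K u h) :=
  hK.inter (convex_halfSpace_ge (innerSL ℝ u).toLinearMap.isLinear h)

theorem isCompact_upperPiece (hKc : IsCompact K) : IsCompact (upperPiece K u h) :=
  hKc.inter_right (isClosed_le continuous_const (by fun_prop))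

theorem exists_mem_interior_lt_inner (hu : u ≠ 0)
    (hcut : (interior K ∩ hyperplane u h).Nonempty) : ∃ q ∈ interior K, h < ⟪u, q⟫ := by
  obtain ⟨p, hp, hpH : ⟪u, p⟫ = h⟩ := hcut
  have hlim : Tendsto (fun c : ℝ => p + c • u) (𝓝[>] 0) (𝓝 p) := by
    have hcont : Continuous fun c : ℝ => p + c • u := by fun_prop
    simpa only [zero_smul, add_zero] using (hcont.tendsto 0).mono_left nhdsWithin_le_nhds
  obtain ⟨c, hmem, hc⟩ :=
    ((hlim.eventually (isOpen_interior.mem_nhds hp)).and self_mem_nhdsWithin).exists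
  refine ⟨p + c • u, hmem, ?_⟩
  rw [inner_add_right, real_inner_smul_right, hpH]
  exact lt_add_of_pos_right h (mul_pos hc (real_inner_self_pos.2 hu))

theorem interior_upperPiece_nonempty (hu : u ≠ 0)
    (hcut : (interior K ∩ hyperplane u h).Nonempty) : (interior (upperPiece K u h)).Nonempty := by
  obtain ⟨q, hq, hqh⟩ := exists_mem_interior_lt_inner hu hcut
  have hopen : IsOpen {y : PhaseSpace n | h < ⟪u, y⟫} := isOpen_lt continuous_const (by fun_prop)
  have hsub : interior K ∩ {y | h < ⟪u, y⟫} ⊆ upperPiece K u h := fun y hy =>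
    ⟨interior_subset hy.1, le_of_lt (show h < ⟪u, y⟫ from hy.2)⟩
  exact ⟨q, interior_maximal hsub (isOpen_interior.inter hopen) ⟨hq, hqh⟩⟩

theorem inner_div_le_inner_div_of_mem_normalCone_upperPiece (hK : Convex ℝ K)
    (hw : w ∈ normalCone (upperPiece K u h) x) {y y' : PhaseSpace n} (hy : y ∈ K)
    (hyh : ⟪u, y⟫ < h) (hy' : y' ∈ K) (hyh' : h < ⟪u, y'⟫) :
    ⟪w, y - x⟫ / (h - ⟪u, y⟫) ≤ ⟪w, x - y'⟫ / (⟪u, y'⟫ - h) := by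
  obtain ⟨δ, hδ⟩ : ∃ δ, δ = h - ⟪u, y⟫ := ⟨_, rfl⟩
  obtain ⟨δ', hδ'⟩ : ∃ δ', δ' = ⟪u, y'⟫ - h := ⟨_, rfl⟩
  have hpos : 0 < δ := hδ ▸ sub_pos.2 hyh
  have hpos' : 0 < δ' := hδ' ▸ sub_pos.2 hyh'
  have hcross : (δ' + δ)⁻¹ • (δ' • y + δ • y') ∈ upperPiece K u h := by
    refine ⟨?_, ?_⟩
    · rw [smul_add, smul_smul, smul_smul]
      exact hK hy hy' (by positivity) (by positivity) (by field_simp)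
    · change h ≤ _
      rw [real_inner_smul_right, inner_add_right, real_inner_smul_right, real_inner_smul_right,
        inv_mul_eq_div, le_div_iff₀ (by positivity), show ⟪u, y⟫ = h - δ by linarith,
        show ⟪u, y'⟫ = h + δ' by linarith]
      linarith
  have hinner : (δ' + δ) * ⟪w, x - (δ' + δ)⁻¹ • (δ' • y + δ • y')⟫ =
      δ * ⟪w, x - y'⟫ - δ' * ⟪w, y - x⟫ := by
    simp only [inner_sub_right, inner_add_right, real_inner_smul_right]
    field_simp
    ring
  rw [← hδ, ← hδ', div_le_div_iff₀ hpos hpos', mul_comm, mul_comm _ δ, ← sub_nonneg, ← hinner]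
  exact mul_nonneg (by positivity) (hw _ hcross)

theorem mem_normalCone_of_mem_normalCone_upperPiece (hK : Convex ℝ K) (hx : x ∈ K)
    (hxh : h < ⟪u, x⟫) (hw : w ∈ normalCone (upperPiece K u h) x) : w ∈ normalCone K x := by
  intro y hy
  rcases le_or_gt h ⟪u, y⟫ with hle | hlt
  · exact hw y ⟨hy, hle⟩
  · have hslope := inner_div_le_inner_div_of_mem_normalCone_upperPiece hK hw hy hlt hx hxh
    rw [sub_self, inner_zero_right, zero_div, div_le_iff₀ (sub_pos.2 hlt), zero_mul] at hslope
    rwa [← neg_sub, inner_neg_right, neg_nonneg]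

/-- The least `a ≥ 0` for which `w + a • u` satisfies the inequalities defining the normal cone at
`x` for all points of `S`, when `x` lies on the hyperplane at height `h` and `S` below it. Letting
`S` be a countable dense set keeps the supremum measurable in `w` and `x`. -/
def cutSlope (S : Set (PhaseSpace n)) (u : PhaseSpace n) (h : ℝ) (w x : PhaseSpace n) : ℝ :=
  ⨆ y : S, max 0 (⟪w, y - x⟫ / (h - ⟪u, y⟫))

variable {S : Set (PhaseSpace n)}

theorem cutSlope_nonneg (S : Set (PhaseSpace n)) (u : PhaseSpace n) (h : ℝ)
    (w x : PhaseSpace n) : 0 ≤ cutSlope S u h w x :=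
  Real.iSup_nonneg fun _ => le_max_left _ _

theorem aemeasurable_cutSlope (hS : S.Countable) {μ : Measure ℝ} {w γ : ℝ → PhaseSpace n}
    (hw : AEMeasurable w μ) (hγ : AEMeasurable γ μ) :
    AEMeasurable (fun t => cutSlope S u h (w t) (γ t)) μ := by
  have := hS.to_subtype
  exact AEMeasurable.iSup fun y => (aemeasurable_const (b := (0 : ℝ))).max
    ((hw.inner (aemeasurable_const.sub hγ)).div_const _)

theorem max_inner_div_le_of_mem_normalCone_upperPiece (hK : Convex ℝ K)
    (hw : w ∈ normalCone (upperPiece K u h) x) {y y' : PhaseSpace n} (hy : y ∈ K)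
    (hyh : ⟪u, y⟫ < h) (hy' : y' ∈ K) (hyh' : h < ⟪u, y'⟫) :
    max 0 (⟪w, y - x⟫ / (h - ⟪u, y⟫)) ≤ ⟪w, x - y'⟫ / (⟪u, y'⟫ - h) :=
  max_le (div_nonneg (hw y' ⟨hy', hyh'.le⟩) (sub_pos.2 hyh').le)
    (inner_div_le_inner_div_of_mem_normalCone_upperPiece hK hw hy hyh hy' hyh')

theorem cutSlope_le (hK : Convex ℝ K) (hS : S ⊆ K ∩ {y | ⟪u, y⟫ < h})
    (hw : w ∈ normalCone (upperPiece K u h) x) {y' : PhaseSpace n} (hy' : y' ∈ K)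
    (hyh' : h < ⟪u, y'⟫) : cutSlope S u h w x ≤ ⟪w, x - y'⟫ / (⟪u, y'⟫ - h) :=
  Real.iSup_le (fun y => max_inner_div_le_of_mem_normalCone_upperPiece hK hw (hS y.2).1
    (hS y.2).2 hy' hyh') (div_nonneg (hw y' ⟨hy', hyh'.le⟩) (sub_pos.2 hyh').le)

theorem inner_div_le_cutSlope (hK : Convex ℝ K) (hS : S ⊆ K ∩ {y | ⟪u, y⟫ < h})
    (hw : w ∈ normalCone (upperPiece K u h) x) (hupper : ∃ q ∈ K, h < ⟪u, q⟫)
    {y : PhaseSpace n} (hy : y ∈ S) : ⟪w, y - x⟫ / (h - ⟪u, y⟫) ≤ cutSlope S u h w x := by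
  obtain ⟨q, hq, hqh⟩ := hupper
  have hbdd : BddAbove (range fun y : S => max 0 (⟪w, y - x⟫ / (h - ⟪u, y⟫))) := by
    refine ⟨⟪w, x - q⟫ / (⟪u, q⟫ - h), ?_⟩
    rintro _ ⟨y, rfl⟩
    exact max_inner_div_le_of_mem_normalCone_upperPiece hK hw (hS y.2).1 (hS y.2).2 hq hqh
  exact (le_max_right _ _).trans (le_ciSup hbdd ⟨y, hy⟩)

theorem add_cutSlope_smul_mem_normalCone (hK : Convex ℝ K) (hS : S ⊆ K ∩ {y | ⟪u, y⟫ < h})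
    (hdense : K ∩ {y | ⟪u, y⟫ < h} ⊆ closure S) (hupper : ∃ q ∈ K, h < ⟪u, q⟫)
    (hx : x ∈ hyperplane u h) (hw : w ∈ normalCone (upperPiece K u h) x) :
    w + cutSlope S u h w x • u ∈ normalCone K x := by
  have hexpand : ∀ y, ⟪w + cutSlope S u h w x • u, x - y⟫ =
      ⟪w, x - y⟫ + cutSlope S u h w x * (h - ⟪u, y⟫) := fun y => by
    rw [inner_add_left, real_inner_smul_left, inner_sub_right u, show ⟪u, x⟫ = h from hx]
  intro y hy
  rcases lt_or_ge ⟪u, y⟫ h with hlt | hle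
  · have hclosed : IsClosed {y : PhaseSpace n | 0 ≤ ⟪w + cutSlope S u h w x • u, x - y⟫} :=
      isClosed_le continuous_const (by fun_prop)
    refine closure_minimal (fun z hz => ?_) hclosed (hdense ⟨hy, hlt⟩)
    have hslope := inner_div_le_cutSlope hK hS hw hupper hz
    rw [div_le_iff₀ (sub_pos.2 (hS hz).2), ← neg_sub, inner_neg_right] at hslope
    rw [mem_ofPred_eq, hexpand]
    linarith
  · rw [hexpand]
    rcases hle.eq_or_lt with heq | hgt
    · rw [← heq, sub_self, mul_zero, add_zero]
      exact hw y ⟨hy, hle⟩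
    · have hslope := cutSlope_le hK hS hw hy hgt
      rw [le_div_iff₀ (sub_pos.2 hgt)] at hslope
      linarith

theorem memLp_two_indicator_cutSlope (hK : Convex ℝ K) (hKc : IsCompact K) (hS : S.Countable)
    (hSK : S ⊆ K ∩ {y | ⟪u, y⟫ < h}) (hupper : ∃ q ∈ K, h < ⟪u, q⟫) {T : ℝ}
    {γ v : ℝ → PhaseSpace n} (hγ : HasVelocity T γ v) (hmem : ∀ t ∈ Icc 0 T, γ t ∈ K)
    (hv : ∀ᵐ t ∂(volume.restrict (Icc 0 T)),
      -(stdJ n (v t)) ∈ normalCone (upperPiece K u h) (γ t)) :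
    MemLp ((Icc 0 T ∩ γ ⁻¹' hyperplane u h).indicator
      fun t => cutSlope S u h (-(stdJ n (v t))) (γ t)) 2 (volume.restrict (Icc 0 T)) := by
  obtain ⟨q, hq, hqh⟩ := hupper
  have hmeas : MeasurableSet (Icc 0 T ∩ γ ⁻¹' hyperplane u h) :=
    (hγ.continuousOn.preimage_isClosed_of_isClosed isClosed_Icc
      (isClosed_hyperplane u h)).measurableSet
  have hslope : AEMeasurable (fun t => cutSlope S u h (-(stdJ n (v t))) (γ t))
      (volume.restrict (Icc 0 T)) :=
    aemeasurable_cutSlope hS hγ.neg_stdJ.memLp.aestronglyMeasurable.aemeasurable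
      (hγ.continuousOn.aemeasurable measurableSet_Icc)
  refine MemLp.of_le_mul (c := Metric.diam K / (⟪u, q⟫ - h)) hγ.neg_stdJ.memLp
    (hslope.indicator hmeas).aestronglyMeasurable ?_
  filter_upwards [hv, ae_restrict_mem measurableSet_Icc] with t ht htT
  refine (norm_indicator_le_norm_self _ _).trans ?_
  calc ‖cutSlope S u h (-(stdJ n (v t))) (γ t)‖
      ≤ ⟪-(stdJ n (v t)), γ t - q⟫ / (⟪u, q⟫ - h) :=
        (Real.norm_of_nonneg (cutSlope_nonneg _ _ _ _ _)).trans_le (cutSlope_le hK hSK ht hq hqh)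
    _ ≤ ‖-(stdJ n (v t))‖ * Metric.diam K / (⟪u, q⟫ - h) := by
        refine div_le_div_of_nonneg_right ((real_inner_le_norm _ _).trans ?_) (sub_pos.2 hqh).le
        rw [← dist_eq_norm]
        gcongr
        exact Metric.dist_le_diam_of_mem hKc.isBounded (hmem t htT) hq
    _ = Metric.diam K / (⟪u, q⟫ - h) * ‖-(stdJ n (v t))‖ := by ring

theorem exists_memLp_two_add_smul_mem_normalCone (hK : Convex ℝ K) (hKc : IsCompact K)
    (hupper : ∃ q ∈ K, h < ⟪u, q⟫) {T : ℝ} {γ v : ℝ → PhaseSpace n} (hγ : HasVelocity T γ v)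
    (hmem : ∀ t ∈ Icc 0 T, γ t ∈ upperPiece K u h)
    (hv : ∀ᵐ t ∂(volume.restrict (Icc 0 T)),
      -(stdJ n (v t)) ∈ normalCone (upperPiece K u h) (γ t)) :
    ∃ α : ℝ → ℝ, (∀ t, 0 ≤ α t) ∧ MemLp α 2 (volume.restrict (Icc 0 T)) ∧
      (∀ t ∈ Icc 0 T, γ t ∉ hyperplane u h → α t = 0) ∧
      ∀ᵐ t ∂(volume.restrict (Icc 0 T)), -(stdJ n (v t)) + α t • u ∈ normalCone K (γ t) := by
  obtain ⟨S, hSK, hScount, hSdense⟩ := (TopologicalSpace.IsSeparable.of_separableSpace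
    (K ∩ {y | ⟪u, y⟫ < h})).exists_countable_dense_subset
  refine ⟨_, indicator_nonneg fun t _ => cutSlope_nonneg S u h (-(stdJ n (v t))) (γ t),
    memLp_two_indicator_cutSlope hK hKc hScount hSK hupper hγ (fun t ht => (hmem t ht).1) hv,
    fun t _ htH => indicator_of_notMem (fun htS => htH htS.2) _, ?_⟩
  filter_upwards [hv, ae_restrict_mem measurableSet_Icc] with t ht htT
  by_cases htH : γ t ∈ hyperplane u h
  · rw [indicator_of_mem (show t ∈ Icc 0 T ∩ γ ⁻¹' hyperplane u h from ⟨htT, htH⟩)]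
    exact add_cutSlope_smul_mem_normalCone hK hSK hSdense hupper htH ht
  · rw [indicator_of_notMem fun htS => htH htS.2, zero_smul, add_zero]
    exact mem_normalCone_of_mem_normalCone_upperPiece hK (hmem t htT).1
      ((hmem t htT).2.lt_of_ne fun heq => htH heq.symm) ht

end Pieces

/-! ### Gluing two arcs along the hyperplane -/

section Glue

variable {n : ℕ} {K : Set (PhaseSpace n)} {u : PhaseSpace n} {h : ℝ}

theorem HasVelocity.ehzCapacity_le [Nontrivial (PhaseSpace n)] {T A : ℝ}
    {γ v : ℝ → PhaseSpace n} (hγ : HasVelocity T γ v) (hc : γ 0 = γ T) (hK : Convex ℝ K)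
    (hKc : IsCompact K) (hi : (interior K).Nonempty) (hA : 0 < A)
    (hL : supportLength K T v ≤ 2 * A) (hact : action T γ = A) : ehzCapacity K ≤ A := by
  have hiso := (isoperimetricInequality_ehzCapacity hK hKc hi T γ v hγ hc).trans
    (pow_le_pow_left₀ (hγ.supportLength_nonneg hc hKc (hi.mono interior_subset)) hL 2)
  rw [hact] at hiso
  nlinarith

/-- An arc on `[0,S]` whose end points differ by `a • J u`, such that its support length equals
twice its action and closing it by the chord between its end points in the hyperplane gives a closed
curve of action `A`. These are the arcs left of a closed characteristic of `upperPiece K u h` of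
action `A` when its motion along the hyperplane is deleted. -/
structure IsBalancedArc (K : Set (PhaseSpace n)) (u : PhaseSpace n) (h S a A : ℝ)
    (ζ v : ℝ → PhaseSpace n) : Prop where
  hasVelocity : HasVelocity S ζ v
  nonneg : 0 ≤ a
  sub_eq : ζ S - ζ 0 = a • stdJ n u
  inner_eq : a ≠ 0 → ⟪u, ζ 0⟫ = h
  supportLength_eq : supportLength K S v = 2 * A + a * h
  integral_eq : ∫ t in (0 : ℝ)..S, ⟪-(stdJ n (v t)), ζ t⟫ = 2 * A + a * h

/-- The arc `ζ₁` on `[0,S]`, followed by the copy of `ζ₂` scaled by `c` that starts at the end point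
of `ζ₁`. -/
def scaledConcat (S c : ℝ) (ζ₁ ζ₂ : ℝ → PhaseSpace n) : ℝ → PhaseSpace n :=
  concatAt S ζ₁ fun t => c • ζ₂ t + (ζ₁ S - c • ζ₂ 0)

theorem scaledConcat_one_add_const (S : ℝ) (ζ₁ ζ₂ : ℝ → PhaseSpace n) (x : PhaseSpace n) :
    (fun t => scaledConcat S 1 ζ₁ ζ₂ t + x) =
      concatAt S (fun t => ζ₁ t + x) (fun t => ζ₂ t + (ζ₁ S - ζ₂ 0 + x)) := by
  ext1 t
  simp only [scaledConcat, concatAt, one_smul]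
  split_ifs
  · rfl
  · rw [add_assoc]

section ScaledConcat

variable {S₁ S₂ : ℝ} {ζ₁ v₁ ζ₂ v₂ : ℝ → PhaseSpace n}

theorem HasVelocity.scaledConcat (h₁ : HasVelocity S₁ ζ₁ v₁) (h₂ : HasVelocity S₂ ζ₂ v₂) (c : ℝ) :
    HasVelocity (S₁ + S₂) (scaledConcat S₁ c ζ₁ ζ₂) (concatAt S₁ v₁ fun t => c • v₂ t) :=
  h₁.concat ((h₂.const_smul c).add_const _) (add_sub_cancel _ _).symm

theorem HasVelocity.integral_inner_const_smul_add (h : HasVelocity S₁ ζ₁ v₁) (c : ℝ)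
    (x : PhaseSpace n) :
    ∫ t in (0 : ℝ)..S₁, ⟪-(stdJ n (c • v₁ t)), c • ζ₁ t + x⟫ =
      c ^ 2 * (∫ t in (0 : ℝ)..S₁, ⟪-(stdJ n (v₁ t)), ζ₁ t⟫) +
        c * ⟪-(stdJ n (ζ₁ S₁ - ζ₁ 0)), x⟫ := by
  have hexpand : ∀ t, ⟪-(stdJ n (c • v₁ t)), c • ζ₁ t + x⟫ =
      c ^ 2 * ⟪-(stdJ n (v₁ t)), ζ₁ t⟫ + c * ⟪-(stdJ n (v₁ t)), x⟫ := fun t => by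
    rw [map_smul, ← smul_neg, real_inner_smul_left, inner_add_right, real_inner_smul_right]
    ring
  simp only [hexpand]
  rw [intervalIntegral.integral_add
      ((h.intervalIntegrable_inner_neg_stdJ h.continuousOn).const_mul _)
      ((h.intervalIntegrable_inner_neg_stdJ continuousOn_const).const_mul _),
    intervalIntegral.integral_const_mul, intervalIntegral.integral_const_mul,
    h.integral_inner_neg_stdJ_const x h.zero_mem ⟨h.nonneg, le_rfl⟩]

end ScaledConcat

namespace IsBalancedArc

variable {S S₁ S₂ a a₁ a₂ A A₁ A₂ : ℝ} {ζ v ζ₁ v₁ ζ₂ v₂ : ℝ → PhaseSpace n}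

theorem eq_add (hζ : IsBalancedArc K u h S a A ζ v) : ζ S = ζ 0 + a • stdJ n u :=
  eq_add_of_sub_eq' hζ.sub_eq

theorem ehzCapacity_le_of_closed [Nontrivial (PhaseSpace n)]
    (hζ : IsBalancedArc K u h S 0 A ζ v) (hK : Convex ℝ K) (hKc : IsCompact K)
    (hi : (interior K).Nonempty) (hA : 0 < A) : ehzCapacity K ≤ A := by
  have hc := hζ.eq_add
  have hL := hζ.supportLength_eq
  have hint := hζ.integral_eq
  rw [zero_smul, add_zero] at hc
  rw [zero_mul, add_zero] at hL hint
  refine hζ.hasVelocity.ehzCapacity_le hc.symm hK hKc hi hA hL.le ?_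
  rw [hζ.hasVelocity.action_eq, hint]
  ring

theorem scaledConcat_closed (h₁ : IsBalancedArc K u h S₁ a₁ A₁ ζ₁ v₁)
    (h₂ : IsBalancedArc K (-u) (-h) S₂ a₂ A₂ ζ₂ v₂) {c : ℝ} (hc : c * a₂ = a₁) :
    scaledConcat S₁ c ζ₁ ζ₂ 0 = scaledConcat S₁ c ζ₁ ζ₂ (S₁ + S₂) := by
  rw [scaledConcat, concatAt_of_le h₁.hasVelocity.nonneg,
    concatAt_add (add_sub_cancel _ _).symm h₂.hasVelocity.nonneg, h₁.eq_add, h₂.eq_add, ← hc,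
    map_neg, smul_add, smul_neg, smul_neg, smul_smul]
  abel

theorem supportLength_scaledConcat (h₁ : IsBalancedArc K u h S₁ a₁ A₁ ζ₁ v₁)
    (h₂ : IsBalancedArc K (-u) (-h) S₂ a₂ A₂ ζ₂ v₂) {c : ℝ} (hc : 0 ≤ c) (hca : c * a₂ = a₁)
    (hKc : IsCompact K) (hne : K.Nonempty) :
    supportLength K (S₁ + S₂) (concatAt S₁ v₁ fun t => c • v₂ t) = 2 * (A₁ + c * A₂) := by
  rw [h₁.hasVelocity.supportLength_concat (h₂.hasVelocity.const_smul c) hKc hne,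
    supportLength_const_smul hc, h₁.supportLength_eq, h₂.supportLength_eq, ← hca]
  ring

theorem action_scaledConcat (h₁ : IsBalancedArc K u h S₁ a₁ A₁ ζ₁ v₁)
    (h₂ : IsBalancedArc K (-u) (-h) S₂ a₂ A₂ ζ₂ v₂) (ha₁ : a₁ ≠ 0) {c : ℝ} (hca : c * a₂ = a₁) :
    action (S₁ + S₂) (scaledConcat S₁ c ζ₁ ζ₂) = A₁ + c ^ 2 * A₂ := by
  have hH₁ := h₁.inner_eq ha₁
  have hH₂ := h₂.inner_eq (right_ne_zero_of_mul (hca.trans_ne ha₁))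
  rw [inner_neg_left, neg_inj] at hH₂
  have hjump : ⟪-(stdJ n (ζ₂ S₂ - ζ₂ 0)), ζ₁ S₁ - c • ζ₂ 0⟫ = a₂ * (c - 1) * h := by
    rw [h₂.sub_eq, neg_stdJ_smul_stdJ, h₁.eq_add, real_inner_smul_left, inner_neg_left,
      inner_sub_right, inner_add_right, real_inner_smul_right, real_inner_smul_right,
      inner_self_stdJ, hH₁, hH₂]
    ring
  rw [(h₁.hasVelocity.scaledConcat h₂.hasVelocity c).action_eq, scaledConcat,
    h₁.hasVelocity.integral_inner_concat ((h₂.hasVelocity.const_smul c).add_const _),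
    h₂.hasVelocity.integral_inner_const_smul_add, h₁.integral_eq, h₂.integral_eq, hjump, ← hca]
  ring

theorem ehzCapacity_mul_le_sq [Nontrivial (PhaseSpace n)]
    (h₁ : IsBalancedArc K u h S₁ a₁ A₁ ζ₁ v₁) (h₂ : IsBalancedArc K (-u) (-h) S₂ a₂ A₂ ζ₂ v₂)
    (hK : Convex ℝ K) (hKc : IsCompact K) (hi : (interior K).Nonempty) (ha₁ : a₁ ≠ 0) {c : ℝ}
    (hc : 0 ≤ c) (hca : c * a₂ = a₁) :
    ehzCapacity K * (A₁ + c ^ 2 * A₂) ≤ (A₁ + c * A₂) ^ 2 := by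
  have hiso := isoperimetricInequality_ehzCapacity hK hKc hi _ _ _
    (h₁.hasVelocity.scaledConcat h₂.hasVelocity c) (h₁.scaledConcat_closed h₂ hca)
  rw [h₁.supportLength_scaledConcat h₂ hc hca hKc (hi.mono interior_subset),
    h₁.action_scaledConcat h₂ ha₁ hca] at hiso
  linarith

end IsBalancedArc

theorem add_mul_sq_eq (A₁ A₂ c : ℝ) : (A₁ + c * A₂) ^ 2 =
    (A₁ + A₂) * (A₁ + c ^ 2 * A₂) - A₁ * A₂ * (1 - c) ^ 2 := by ring

theorem le_add_of_mul_le_sq {m A₁ A₂ c : ℝ} (hA₁ : 0 < A₁) (hA₂ : 0 < A₂)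
    (hm : m * (A₁ + c ^ 2 * A₂) ≤ (A₁ + c * A₂) ^ 2) : m ≤ A₁ + A₂ := by
  have hdefect : 0 ≤ A₁ * A₂ * (1 - c) ^ 2 := by positivity
  rw [add_mul_sq_eq] at hm
  exact le_of_mul_le_mul_right (by linarith) (by positivity : 0 < A₁ + c ^ 2 * A₂)

theorem eq_one_of_add_mul_le_sq {A₁ A₂ c : ℝ} (hA₁ : 0 < A₁) (hA₂ : 0 < A₂)
    (hm : (A₁ + A₂) * (A₁ + c ^ 2 * A₂) ≤ (A₁ + c * A₂) ^ 2) : c = 1 := by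
  rw [add_mul_sq_eq] at hm
  have hsq : (1 - c) ^ 2 ≤ 0 := nonpos_of_mul_nonpos_right (by linarith) (mul_pos hA₁ hA₂)
  exact (sub_eq_zero.1 (pow_eq_zero_iff two_ne_zero |>.1 (hsq.antisymm (sq_nonneg _)))).symm

namespace IsBalancedArc

variable {S S₁ S₂ a a₁ a₂ A A₁ A₂ : ℝ} {ζ v ζ₁ v₁ ζ₂ v₂ : ℝ → PhaseSpace n}

theorem ehzCapacity_le_add [Nontrivial (PhaseSpace n)]
    (h₁ : IsBalancedArc K u h S₁ a₁ A₁ ζ₁ v₁) (h₂ : IsBalancedArc K (-u) (-h) S₂ a₂ A₂ ζ₂ v₂)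
    (hK : Convex ℝ K) (hKc : IsCompact K) (hi : (interior K).Nonempty) (hA₁ : 0 < A₁)
    (hA₂ : 0 < A₂) : ehzCapacity K ≤ A₁ + A₂ := by
  rcases eq_or_ne a₁ 0 with rfl | ha₁
  · linarith [h₁.ehzCapacity_le_of_closed hK hKc hi hA₁]
  rcases eq_or_ne a₂ 0 with rfl | ha₂
  · linarith [h₂.ehzCapacity_le_of_closed hK hKc hi hA₂]
  exact le_add_of_mul_le_sq hA₁ hA₂ (h₁.ehzCapacity_mul_le_sq h₂ hK hKc hi ha₁
    (div_nonneg h₁.nonneg h₂.nonneg) (div_mul_cancel₀ a₁ ha₂))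

theorem eq_of_add_le_ehzCapacity [Nontrivial (PhaseSpace n)]
    (h₁ : IsBalancedArc K u h S₁ a₁ A₁ ζ₁ v₁) (h₂ : IsBalancedArc K (-u) (-h) S₂ a₂ A₂ ζ₂ v₂)
    (hK : Convex ℝ K) (hKc : IsCompact K) (hi : (interior K).Nonempty) (hA₁ : 0 < A₁)
    (hA₂ : 0 < A₂) (hle : A₁ + A₂ ≤ ehzCapacity K) : a₁ ≠ 0 ∧ a₂ = a₁ := by
  have ha₁ : a₁ ≠ 0 := by
    rintro rfl
    linarith [h₁.ehzCapacity_le_of_closed hK hKc hi hA₁]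
  have ha₂ : a₂ ≠ 0 := by
    rintro rfl
    linarith [h₂.ehzCapacity_le_of_closed hK hKc hi hA₂]
  have hiso := h₁.ehzCapacity_mul_le_sq h₂ hK hKc hi ha₁
    (div_nonneg h₁.nonneg h₂.nonneg) (div_mul_cancel₀ a₁ ha₂)
  have hratio := eq_one_of_add_mul_le_sq hA₁ hA₂
    ((mul_le_mul_of_nonneg_right hle (by positivity)).trans hiso)
  exact ⟨ha₁, ((div_eq_one_iff_eq ha₂).1 hratio).symm⟩

theorem inner_eq_zero_of_ae_mem_normalCone (hζ : IsBalancedArc K u h S a A ζ v) (ha : a ≠ 0)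
    (hKc : IsCompact K) {x : PhaseSpace n} (hmem : ∀ t ∈ Icc 0 S, ζ t + x ∈ K)
    (hv : ∀ᵐ t ∂(volume.restrict (Icc 0 S)), -(stdJ n (v t)) ∈ normalCone K (ζ t + x)) :
    ⟪u, x⟫ = 0 := by
  have hγ := hζ.hasVelocity
  have hlength := supportLength_eq_integral_inner hγ.nonneg hKc hmem hv
  simp only [inner_add_right] at hlength
  rw [intervalIntegral.integral_add (hγ.intervalIntegrable_inner_neg_stdJ hγ.continuousOn)
    (hγ.intervalIntegrable_inner_neg_stdJ continuousOn_const), hζ.integral_eq,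
    hζ.supportLength_eq, hγ.integral_inner_neg_stdJ_const x hγ.zero_mem ⟨hγ.nonneg, le_rfl⟩,
    hζ.sub_eq, neg_stdJ_smul_stdJ, real_inner_smul_left, left_eq_add] at hlength
  exact (mul_eq_zero.1 hlength).resolve_left ha

theorem splitsAt_concatAt_add (hζ : IsBalancedArc K u h S a A ζ v) (ha : a ≠ 0) (hu : u ≠ 0)
    {x : PhaseSpace n} (hx : ⟪u, x⟫ = 0) {S' : ℝ} (hS' : 0 ≤ S') (β : ℝ → PhaseSpace n) :
    SplitsAt u h (S + S') (concatAt S (fun t => ζ t + x) β) 0 S := by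
  have hS := hζ.hasVelocity.nonneg
  have hH : ⟪u, ζ 0⟫ = h := hζ.inner_eq ha
  have hJu : stdJ n u ≠ 0 := norm_ne_zero_iff.1 ((norm_stdJ u).trans_ne (norm_ne_zero_iff.2 hu))
  have hSpos : 0 < S := hS.lt_of_ne' fun hS₀ => by
    have hchord := hζ.sub_eq
    rw [hS₀, sub_self] at hchord
    exact smul_ne_zero ha hJu hchord.symm
  refine ⟨le_rfl, hSpos, le_add_of_nonneg_right hS', ?_, ?_, a, hζ.nonneg.lt_of_ne' ha, ?_⟩
  · change ⟪u, _⟫ = h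
    rw [concatAt_of_le hS, inner_add_right, hH, hx, add_zero]
  · change ⟪u, _⟫ = h
    rw [concatAt_of_le le_rfl, hζ.eq_add, inner_add_right, inner_add_right, hH, hx,
      real_inner_smul_right, inner_self_stdJ, mul_zero, add_zero, add_zero]
  · rw [concatAt_of_le hS, concatAt_of_le le_rfl, add_sub_add_right_eq_sub, hζ.sub_eq]

theorem exists_isSystole_concatAt (h₁ : IsBalancedArc K u h S₁ a₁ A₁ ζ₁ v₁)
    (h₂ : IsBalancedArc K (-u) (-h) S₂ a₂ A₂ ζ₂ v₂) (hu : u ≠ 0) (hK : Convex ℝ K)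
    (hKc : IsCompact K) (hi : (interior K).Nonempty) (hA₁ : 0 < A₁) (hA₂ : 0 < A₂)
    (hA : ehzCapacity K = A₁ + A₂) : ∃ x₁ x₂ : PhaseSpace n,
      IsSystole K (S₁ + S₂) (concatAt S₁ (fun t => ζ₁ t + x₁) (fun t => ζ₂ t + x₂)) ∧
      SplitsAt u h (S₁ + S₂) (concatAt S₁ (fun t => ζ₁ t + x₁) (fun t => ζ₂ t + x₂)) 0 S₁ := by
  have : Nontrivial (PhaseSpace n) := nontrivial_of_ne u 0 hu
  obtain ⟨ha₁, ha⟩ := h₁.eq_of_add_le_ehzCapacity h₂ hK hKc hi hA₁ hA₂ hA.ge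
  have ha' : 1 * a₂ = a₁ := by rw [one_mul, ha]
  have hγ := h₁.hasVelocity.scaledConcat h₂.hasVelocity 1
  obtain ⟨x, hx⟩ := hγ.exists_translate_isSystole (h₁.scaledConcat_closed h₂ ha') hK hKc hi
    (by rw [h₁.supportLength_scaledConcat h₂ zero_le_one ha' hKc (hi.mono interior_subset), hA,
      one_mul])
    (by rw [h₁.action_scaledConcat h₂ ha₁ ha', hA, one_pow, one_mul])
  have hS : Icc 0 S₁ ⊆ Icc 0 (S₁ + S₂) :=
    Icc_subset_Icc_right (le_add_of_nonneg_right h₂.hasVelocity.nonneg)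
  have hmem : ∀ t ∈ Icc 0 S₁, ζ₁ t + x ∈ K := fun t ht => by
    simpa only [scaledConcat, concatAt_of_le ht.2] using hx.1.mem hKc (hS ht)
  have hux : ⟪u, x⟫ = 0 := by
    refine h₁.inner_eq_zero_of_ae_mem_normalCone ha₁ hKc hmem ?_
    filter_upwards [ae_restrict_of_ae_restrict_of_subset hS
      (hx.1.ae_mem_normalCone (hγ.add_const x)), ae_restrict_mem measurableSet_Icc] with t ht htS
    simpa only [scaledConcat, concatAt_of_le htS.2] using ht
  rw [scaledConcat_one_add_const] at hx
  exact ⟨x, _, hx, h₁.splitsAt_concatAt_add ha₁ hu hux h₂.hasVelocity.nonneg _⟩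

end IsBalancedArc

end Glue

section Strip

theorem hasVelocity_integral_smul {E : Type*} [NormedAddCommGroup E] [NormedSpace ℝ E]
    [CompleteSpace E] {T : ℝ} {α : ℝ → ℝ} (hT : 0 ≤ T)
    (hα : MemLp α 2 (volume.restrict (Icc 0 T))) (x : E) :
    HasVelocity T (fun t => (∫ r in (0 : ℝ)..t, α r) • x) (fun t => α t • x) := by
  refine ⟨hT, (ContinuousLinearMap.smulRight (1 : ℝ →L[ℝ] ℝ) x).comp_memLp' hα, fun t _ => ?_⟩
  rw [intervalIntegral.integral_smul_const, intervalIntegral.integral_same, zero_smul, zero_add]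

variable {n : ℕ} {K : Set (PhaseSpace n)} {u : PhaseSpace n} {h T : ℝ} {γ v : ℝ → PhaseSpace n}
  {α : ℝ → ℝ}

theorem neg_stdJ_add_smul_stdJ (c : ℝ) (x y : PhaseSpace n) :
    -(stdJ n (x + c • stdJ n y)) = -(stdJ n x) + c • y := by
  rw [map_add, neg_add, neg_stdJ_smul_stdJ]

theorem integral_inner_smul_of_eq_zero_of_notMem (hT : 0 ≤ T)
    (hαH : ∀ t ∈ Icc 0 T, γ t ∉ hyperplane u h → α t = 0) :
    ∫ t in (0 : ℝ)..T, ⟪α t • u, γ t⟫ = (∫ t in (0 : ℝ)..T, α t) * h := by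
  rw [← intervalIntegral.integral_mul_const]
  refine intervalIntegral.integral_congr fun t ht => ?_
  rw [uIcc_of_le hT] at ht
  simp only [real_inner_smul_left]
  by_cases hH : γ t ∈ hyperplane u h
  · rw [show ⟪u, γ t⟫ = h from hH]
  · rw [hαH t ht hH, zero_mul, zero_mul]

theorem HasVelocity.integral_inner_add_smul (hγ : HasVelocity T γ v)
    (hα : MemLp α 2 (volume.restrict (Icc 0 T)))
    (hαH : ∀ t ∈ Icc 0 T, γ t ∉ hyperplane u h → α t = 0) :
    ∫ t in (0 : ℝ)..T, ⟪-(stdJ n (v t + α t • stdJ n u)), γ t⟫ =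
      (∫ t in (0 : ℝ)..T, ⟪-(stdJ n (v t)), γ t⟫) + (∫ t in (0 : ℝ)..T, α t) * h := by
  simp only [neg_stdJ_add_smul_stdJ, inner_add_left]
  rw [intervalIntegral.integral_add (hγ.intervalIntegrable_inner_neg_stdJ hγ.continuousOn)
    (intervalIntegrable_inner (hasVelocity_integral_smul hγ.nonneg hα u).intervalIntegrable_right
      hγ.absolutelyContinuous.continuousOn),
    integral_inner_smul_of_eq_zero_of_notMem hγ.nonneg hαH]

theorem HasVelocity.integral_inner_integral_smul_eq_zero (hγ : HasVelocity T γ v)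
    (hT : γ T ∈ hyperplane u h) (hα : MemLp α 2 (volume.restrict (Icc 0 T)))
    (hαH : ∀ t ∈ Icc 0 T, γ t ∉ hyperplane u h → α t = 0) :
    ∫ t in (0 : ℝ)..T, ⟪-(stdJ n (v t + α t • stdJ n u)),
      (∫ r in (0 : ℝ)..t, α r) • stdJ n u⟫ = 0 := by
  have hpointwise : ∀ t, ⟪-(stdJ n (v t + α t • stdJ n u)), (∫ r in (0 : ℝ)..t, α r) • stdJ n u⟫ =
      -⟪v t, (∫ r in (0 : ℝ)..t, α r) • u⟫ := fun t => by
    rw [neg_stdJ_add_smul_stdJ, inner_add_left, inner_neg_left, real_inner_smul_right,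
      inner_stdJ_stdJ, real_inner_smul_left, real_inner_smul_right, inner_self_stdJ,
      real_inner_smul_right]
    ring
  have hparts := hγ.integral_inner_add_integral_inner (hasVelocity_integral_smul hγ.nonneg hα u)
  rw [integral_inner_smul_of_eq_zero_of_notMem hγ.nonneg hαH, intervalIntegral.integral_same,
    zero_smul, inner_zero_right, sub_zero, real_inner_smul_right, real_inner_comm,
    show ⟪u, γ T⟫ = h from hT, add_eq_right] at hparts
  simp only [hpointwise, intervalIntegral.integral_neg, hparts, neg_zero]

namespace IsClosedCharacteristic

theorem forall_mem (hγ : IsClosedCharacteristic (upperPiece K u h) T γ) (hKc : IsCompact K) :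
    ∀ t ∈ Icc 0 T, γ t ∈ K := fun _ ht => upperPiece_subset (hγ.mem (isCompact_upperPiece hKc) ht)

theorem isBalancedArc_strip (hγ : IsClosedCharacteristic (upperPiece K u h) T γ)
    (hKc : IsCompact K) (h₀ : γ 0 ∈ hyperplane u h) (hα : ∀ t, 0 ≤ α t)
    (hα₂ : MemLp α 2 (volume.restrict (Icc 0 T)))
    (hαH : ∀ t ∈ Icc 0 T, γ t ∉ hyperplane u h → α t = 0)
    (hαK : ∀ᵐ t ∂(volume.restrict (Icc 0 T)),
      -(stdJ n (deriv γ t)) + α t • u ∈ normalCone K (γ t)) :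
    IsBalancedArc K u h T (∫ t in (0 : ℝ)..T, α t) (action T γ)
      (fun t => γ t + (∫ r in (0 : ℝ)..t, α r) • stdJ n u)
      (fun t => deriv γ t + α t • stdJ n u) := by
  have hv := hγ.hasVelocity
  have hdrift := hasVelocity_integral_smul hv.nonneg hα₂ (stdJ n u)
  have hint : ∫ t in (0 : ℝ)..T, ⟪-(stdJ n (deriv γ t + α t • stdJ n u)), γ t⟫ =
      2 * action T γ + (∫ t in (0 : ℝ)..T, α t) * h := by
    rw [hv.integral_inner_add_smul hα₂ hαH, action]
    ring
  refine ⟨hv.add hdrift, intervalIntegral.integral_nonneg hv.nonneg fun t _ => hα t, ?_,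
    fun _ => ?_, ?_, ?_⟩
  · rw [← hγ.closed, intervalIntegral.integral_same, zero_smul, add_zero, add_sub_cancel_left]
  · rwa [intervalIntegral.integral_same, zero_smul, add_zero]
  · rw [supportLength_eq_integral_inner hv.nonneg hKc (hγ.forall_mem hKc)
      (by simpa only [neg_stdJ_add_smul_stdJ] using hαK), hint]
  · simp only [inner_add_right]
    rw [intervalIntegral.integral_add
      ((hv.add hdrift).intervalIntegrable_inner_neg_stdJ hv.continuousOn)
      ((hv.add hdrift).intervalIntegrable_inner_neg_stdJ hdrift.continuousOn), hint,
      hv.integral_inner_integral_smul_eq_zero (hγ.closed ▸ h₀) hα₂ hαH, add_zero]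

theorem ehzCapacity_le_of_forall_notMem (hγ : IsClosedCharacteristic (upperPiece K u h) T γ)
    (hK : Convex ℝ K) (hKc : IsCompact K) (hu : u ≠ 0)
    (hcut : (interior K ∩ hyperplane u h).Nonempty)
    (hH : ∀ t ∈ Icc 0 T, γ t ∉ hyperplane u h) : ehzCapacity K ≤ action T γ := by
  have : Nontrivial (PhaseSpace n) := nontrivial_of_ne u 0 hu
  have hK₁c : IsCompact (upperPiece K u h) := isCompact_upperPiece hKc
  refine hγ.hasVelocity.ehzCapacity_le hγ.closed hK hKc (hcut.mono inter_subset_left)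
    (hγ.action_pos hK₁c (interior_upperPiece_nonempty hu hcut)) (le_of_eq ?_) rfl
  rw [supportLength_eq_integral_inner hγ.period_pos.le hKc (hγ.forall_mem hKc), action]
  · ring
  · filter_upwards [hγ.velocity_mem, ae_restrict_mem measurableSet_Icc] with t ht htT
    exact mem_normalCone_of_mem_normalCone_upperPiece hK (hγ.forall_mem hKc t htT)
      ((hγ.mem hK₁c htT).2.lt_of_ne' (hH t htT)) ht

theorem exists_stripsTo (hγ : IsClosedCharacteristic (upperPiece K u h) T γ) (hK : Convex ℝ K)
    (hKc : IsCompact K) (hu : u ≠ 0) (hcut : (interior K ∩ hyperplane u h).Nonempty)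
    (hA : action T γ < ehzCapacity K) :
    ∃ s ∈ Icc 0 T, ∃ (a : ℝ) (ζ v : ℝ → PhaseSpace n),
      IsBalancedArc K u h T a (action T γ) ζ v ∧
        ∀ x, StripsTo K (hyperplane u h) u T (rotate T s γ) (fun t => ζ t + x) := by
  obtain ⟨s, hs, hsH⟩ : ∃ s ∈ Icc 0 T, γ s ∈ hyperplane u h := by
    by_contra! hcon
    exact hA.not_ge (hγ.ehzCapacity_le_of_forall_notMem hK hKc hu hcut hcon)
  have hrot := isClosedCharacteristic_rotate hγ hs
  obtain ⟨q, hq, hqh⟩ := exists_mem_interior_lt_inner hu hcut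
  obtain ⟨α, hα, hα₂, hαH, hαK⟩ := exists_memLp_two_add_smul_mem_normalCone hK hKc
    ⟨q, interior_subset hq, hqh⟩ hrot.hasVelocity
    (fun t ht => hrot.mem (isCompact_upperPiece hKc) ht) hrot.velocity_mem
  have harc := hrot.isBalancedArc_strip hKc (by rwa [rotate_zero hs.2]) hα hα₂ hαH hαK
  rw [hγ.action_rotate hs] at harc
  refine ⟨s, hs, _, _, _, harc, fun x => ⟨x, α, hα,
    intervalIntegrable_of_memLp_two hγ.period_pos.le hα₂, hαH, hαK, fun t _ => ?_⟩⟩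
  beta_reduce
  abel

end IsClosedCharacteristic

end Strip

section Chord

theorem HasVelocity.sub_eq_neg_integral_smul {E : Type*} [NormedAddCommGroup E] [NormedSpace ℝ E]
    [CompleteSpace E] {T a t : ℝ} {γ v : ℝ → E} {c : ℝ → ℝ} {y : E} (hγ : HasVelocity T γ v)
    (ha : 0 ≤ a) (hv : ∀ᵐ t ∂(volume.restrict (Icc a T)), v t = -(c t • y)) (ht : t ∈ Icc a T) :
    γ T - γ t = -((∫ r in t..T, c r) • y) := by
  rw [hγ.sub_eq ⟨ha.trans ht.1, ht.2⟩ ⟨hγ.nonneg, le_rfl⟩, ← intervalIntegral.integral_smul_const,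
    ← intervalIntegral.integral_neg]
  exact intervalIntegral_congr_ae_Icc ht.2
    (ae_restrict_of_ae_restrict_of_subset (Icc_subset_Icc_left ht.1) hv)

variable {n : ℕ} {K : Set (PhaseSpace n)} {u : PhaseSpace n} {h T a : ℝ} {γ v : ℝ → PhaseSpace n}
  {c : ℝ → ℝ}

theorem HasVelocity.inner_eq_of_chord (hγ : HasVelocity T γ v) (ha : 0 ≤ a)
    (hv : ∀ᵐ t ∂(volume.restrict (Icc a T)), v t = -(c t • stdJ n u)) {t : ℝ}
    (ht : t ∈ Icc a T) : ⟪u, γ t⟫ = ⟪u, γ T⟫ := by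
  rw [eq_comm, ← sub_eq_zero, ← inner_sub_right, hγ.sub_eq_neg_integral_smul ha hv ht,
    inner_neg_right, real_inner_smul_right, inner_self_stdJ, mul_zero, neg_zero]

theorem HasVelocity.integral_inner_chord (hγ : HasVelocity T γ v) (ha : a ∈ Icc 0 T)
    (hv : ∀ᵐ t ∂(volume.restrict (Icc a T)), v t = -(c t • stdJ n u)) :
    ∫ t in a..T, ⟪-(stdJ n (v t)), γ t⟫ = -((∫ t in a..T, c t) * ⟪u, γ T⟫) := by
  rw [← intervalIntegral.integral_mul_const, ← intervalIntegral.integral_neg]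
  refine intervalIntegral_congr_ae_Icc ha.2 ?_
  filter_upwards [hv, ae_restrict_mem measurableSet_Icc] with t ht htT
  rw [ht, map_neg, neg_stdJ_smul_stdJ, inner_neg_left, real_inner_smul_left,
    hγ.inner_eq_of_chord ha.1 hv htT]

theorem mem_hyperplane_of_neg_smul_mem_normalCone (hK : (K ∩ hyperplane u h).Nonempty)
    {x : PhaseSpace n} (hx : x ∈ upperPiece K u h) {b : ℝ} (hb : 0 < b)
    (hbu : -(b • u) ∈ normalCone (upperPiece K u h) x) : x ∈ hyperplane u h := by
  obtain ⟨p, hp, hpH : ⟪u, p⟫ = h⟩ := hK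
  have hle := hbu p ⟨hp, hpH.ge⟩
  rw [inner_neg_left, real_inner_smul_left, inner_sub_right, hpH, neg_nonneg] at hle
  exact (sub_nonpos.1 (nonpos_of_mul_nonpos_right hle hb)).antisymm hx.2

theorem IsClosedCharacteristic.mem_hyperplane_of_chord
    (hγ : IsClosedCharacteristic (upperPiece K u h) T γ) (hKc : IsCompact K)
    (hK : (K ∩ hyperplane u h).Nonempty) (ha : a ∈ Icc 0 T)
    (hv : ∀ᵐ t ∂(volume.restrict (Icc a T)), 0 ≤ c t ∧ deriv γ t = -(c t • stdJ n u))
    (hc : ∫ t in a..T, c t ≠ 0) : γ T ∈ hyperplane u h := by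
  by_contra hT
  refine hc ?_
  rw [intervalIntegral_congr_ae_Icc (g := 0) ha.2, Pi.zero_def, intervalIntegral.integral_zero]
  filter_upwards [hv, ae_restrict_of_ae_restrict_of_subset (Icc_subset_Icc_left ha.1)
    hγ.velocity_mem, ae_restrict_mem measurableSet_Icc] with t ⟨hct, hvt⟩ hcone ht
  by_contra hne
  rw [hvt, map_neg, neg_stdJ_smul_stdJ] at hcone
  have hγt : ⟪u, γ t⟫ = h := mem_hyperplane_of_neg_smul_mem_normalCone hK
    (hγ.mem (isCompact_upperPiece hKc) ⟨ha.1.trans ht.1, ht.2⟩) (hct.lt_of_ne' hne) hcone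
  exact hT ((hγ.hasVelocity.inner_eq_of_chord ha.1 (hv.mono fun _ => And.right) ht).symm.trans hγt)

theorem IsArcThenChord.exists_isBalancedArc (hγa : IsArcThenChord K u T a γ)
    (hγ : IsClosedCharacteristic (upperPiece K u h) T γ) (hKc : IsCompact K)
    (hK : (K ∩ hyperplane u h).Nonempty) :
    ∃ b, IsBalancedArc K u h a b (action T γ) γ (deriv γ) := by
  obtain ⟨ha, harc, hchord⟩ := hγa
  have hv := hγ.hasVelocity
  obtain ⟨c, hc⟩ := skolem.1 hchord
  have hcv := hc.mono fun _ => And.right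
  have hH : ∫ t in a..T, c t ≠ 0 → ⟪u, γ T⟫ = h := hγ.mem_hyperplane_of_chord hKc hK ha hc
  have hint : ∫ t in (0 : ℝ)..a, ⟪-(stdJ n (deriv γ t)), γ t⟫ =
      2 * action T γ + (∫ t in a..T, c t) * h := by
    have hi := hv.intervalIntegrable_inner_neg_stdJ hv.continuousOn
    have hsplit := intervalIntegral.integral_add_adjacent_intervals
      (hi.mono_set (uIcc_subset_uIcc left_mem_uIcc (Icc_subset_uIcc ha)))
      (hi.mono_set (uIcc_subset_uIcc (Icc_subset_uIcc ha) right_mem_uIcc))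
    have hlevel : (∫ t in a..T, c t) * ⟪u, γ T⟫ = (∫ t in a..T, c t) * h :=
      mul_eq_mul_left_iff.2 (or_iff_not_imp_right.2 hH)
    rw [hv.integral_inner_chord ha hcv, hlevel] at hsplit
    rw [action]
    linarith
  refine ⟨∫ t in a..T, c t, hv.mono ha.1 ha.2, intervalIntegral.integral_nonneg_of_ae_restrict ha.2
    (hc.mono fun _ => And.left), ?_, fun hne => hγ.closed ▸ hH hne, ?_, hint⟩
  · rw [hγ.closed, ← neg_sub, hv.sub_eq_neg_integral_smul ha.1 hcv ⟨le_rfl, ha.2⟩, neg_neg]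
  · rw [supportLength_eq_integral_inner ha.1 hKc
      (fun t ht => hγ.forall_mem hKc t ⟨ht.1, ht.2.trans ha.2⟩) harc, hint]

end Chord

section Split

variable {n : ℕ} {K : Set (PhaseSpace n)} {u : PhaseSpace n} {h T t₁ t₂ c : ℝ}
  {γ v : ℝ → PhaseSpace n}

theorem segmentPath_mem_hyperplane {x y : PhaseSpace n} (hx : x ∈ hyperplane u h)
    (hy : y ∈ hyperplane u h) (t : ℝ) : segmentPath x y t ∈ hyperplane u h := by
  change ⟪u, x⟫ = h at hx
  change ⟪u, y⟫ = h at hy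
  change ⟪u, _⟫ = h
  rw [segmentPath, inner_add_right, real_inner_smul_right, inner_sub_right, hx, hy, sub_self,
    mul_zero, add_zero]

theorem segmentPath_zero (x y : PhaseSpace n) : segmentPath x y 0 = x := by
  rw [segmentPath, zero_smul, add_zero]

theorem segmentPath_one (x y : PhaseSpace n) : segmentPath x y 1 = y := by
  rw [segmentPath, one_smul, add_sub_cancel]

theorem innerLoop_zero (h₁₂ : t₁ ≤ t₂) : innerLoop γ t₁ t₂ 0 = γ t₁ := by
  rw [innerLoop, concatAt_of_le (sub_nonneg.2 h₁₂), add_zero]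

theorem innerLoop_sub : innerLoop γ t₁ t₂ (t₂ - t₁) = γ t₂ := by
  rw [innerLoop, concatAt_of_le le_rfl, add_sub_cancel]

theorem innerLoop_closed (h₁₂ : t₁ ≤ t₂) :
    innerLoop γ t₁ t₂ 0 = innerLoop γ t₁ t₂ (t₂ - t₁ + 1) := by
  rw [innerLoop_zero h₁₂, innerLoop,
    concatAt_add (by rw [add_sub_cancel, segmentPath_zero]) zero_le_one, segmentPath_one]

protected theorem HasVelocity.innerLoop (hγ : HasVelocity T γ v) (h₁ : 0 ≤ t₁) (h₁₂ : t₁ ≤ t₂)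
    (h₂ : t₂ ≤ T) :
    HasVelocity (t₂ - t₁ + 1) (innerLoop γ t₁ t₂)
      (concatAt (t₂ - t₁) (fun r => v (t₁ + r)) (fun _ => γ t₁ - γ t₂)) :=
  (hγ.shift h₁ h₁₂ h₂).concat (hasVelocity_segmentPath _ _)
    (by rw [add_sub_cancel, segmentPath_zero])

theorem neg_stdJ_sub_of_sub_eq {x y : PhaseSpace n} (hxy : y - x = c • stdJ n u) :
    -(stdJ n (x - y)) = -(c • u) := by
  rw [← neg_sub y x, hxy, map_neg, neg_stdJ_smul_stdJ]

theorem action_innerLoop (hγ : HasVelocity T γ v) (h₁ : 0 ≤ t₁) (h₁₂ : t₁ ≤ t₂) (h₂ : t₂ ≤ T)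
    (hH₁ : γ t₁ ∈ hyperplane u h) (hH₂ : γ t₂ ∈ hyperplane u h)
    (hc : γ t₂ - γ t₁ = c • stdJ n u) :
    action (t₂ - t₁ + 1) (innerLoop γ t₁ t₂) =
      1 / 2 * ((∫ t in t₁..t₂, ⟪-(stdJ n (v t)), γ t⟫) - c * h) := by
  have hsegment (t : ℝ) : ⟪-(c • u), segmentPath (γ t₂) (γ t₁) t⟫ = -(c * h) := by
    rw [inner_neg_left, real_inner_smul_left,
      show ⟪u, _⟫ = h from segmentPath_mem_hyperplane hH₂ hH₁ t]
  rw [(hγ.innerLoop h₁ h₁₂ h₂).action_eq, innerLoop,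
    (hγ.shift h₁ h₁₂ h₂).integral_inner_concat (hasVelocity_segmentPath _ _),
    intervalIntegral.integral_comp_add_left (f := fun t => ⟪-(stdJ n (v t)), γ t⟫), add_zero,
    add_sub_cancel]
  simp only [neg_stdJ_sub_of_sub_eq hc, hsegment, intervalIntegral.integral_const, sub_zero,
    one_smul]
  rw [sub_eq_add_neg]

theorem supportLength_mono {L : Set (PhaseSpace n)} (hγ : HasVelocity T γ v) (hKc : IsCompact K)
    (hLc : IsCompact L) (hne : L.Nonempty) (hLK : L ⊆ K) :
    supportLength L T v ≤ supportLength K T v :=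
  intervalIntegral.integral_mono_on hγ.nonneg (hγ.intervalIntegrable_supportFn hLc hne)
    (hγ.intervalIntegrable_supportFn hKc (hne.mono hLK)) fun _ _ => supportFn_mono hKc hne hLK _

theorem supportFn_upperPiece_neg_smul_le (hne : (upperPiece K u h).Nonempty) (hc : 0 ≤ c) :
    supportFn (upperPiece K u h) (-(c • u)) ≤ -(c * h) := by
  refine supportFn_le hne fun y hy => ?_
  rw [inner_neg_left, real_inner_smul_left, neg_le_neg_iff]
  exact mul_le_mul_of_nonneg_left hy.2 hc

namespace SplitsAt

theorem left_mem (hs : SplitsAt u h T γ t₁ t₂) : t₁ ∈ Icc 0 T := ⟨hs.1, hs.2.1.le.trans hs.2.2.1⟩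

theorem right_mem (hs : SplitsAt u h T γ t₁ t₂) : t₂ ∈ Icc 0 T := ⟨hs.1.trans hs.2.1.le, hs.2.2.1⟩

theorem add_mem (hs : SplitsAt u h T γ t₁ t₂) {r : ℝ} (hr : r ∈ Icc 0 (t₂ - t₁)) :
    t₁ + r ∈ Icc 0 T :=
  ⟨add_nonneg hs.1 hr.1, by linarith [hr.2, hs.2.2.1]⟩

theorem apply_ne (hs : SplitsAt u h T γ t₁ t₂) (hu : u ≠ 0) : γ t₂ ≠ γ t₁ := by
  obtain ⟨-, -, -, -, -, c, hc, hchord⟩ := hs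
  have hJu : stdJ n u ≠ 0 := norm_ne_zero_iff.1 ((norm_stdJ u).trans_ne (norm_ne_zero_iff.2 hu))
  exact sub_ne_zero.1 (hchord.trans_ne (smul_ne_zero hc.ne' hJu))

theorem exists_innerLoop_ne (hs : SplitsAt u h T γ t₁ t₂) (hu : u ≠ 0) :
    ∃ t ∈ Icc 0 (t₂ - t₁ + 1), innerLoop γ t₁ t₂ t ≠ innerLoop γ t₁ t₂ 0 := by
  refine ⟨t₂ - t₁, ⟨sub_nonneg.2 hs.2.1.le, le_add_of_nonneg_right zero_le_one⟩, ?_⟩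
  rw [innerLoop_zero hs.2.1.le, innerLoop_sub]
  exact hs.apply_ne hu

end SplitsAt

namespace IsClosedCharacteristic

theorem supportLength_innerLoop_le (hγ : IsClosedCharacteristic K T γ)
    (hs : SplitsAt u h T γ t₁ t₂) (hKc : IsCompact K) (hne : (upperPiece K u h).Nonempty) :
    supportLength (upperPiece K u h) (t₂ - t₁ + 1)
        (concatAt (t₂ - t₁) (fun r => deriv γ (t₁ + r)) (fun _ => γ t₁ - γ t₂)) ≤
      2 * action (t₂ - t₁ + 1) (innerLoop γ t₁ t₂) := by
  have hmem := fun r => hs.add_mem (r := r)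
  obtain ⟨h₁, h₁₂, h₂, hH₁, hH₂, c, hc, hchord⟩ := hs
  have hv := hγ.hasVelocity
  have hshift := hv.shift h₁ h₁₂.le h₂
  have harc : supportLength (upperPiece K u h) (t₂ - t₁) (fun r => deriv γ (t₁ + r)) ≤
      ∫ t in t₁..t₂, ⟪-(stdJ n (deriv γ t)), γ t⟫ :=
    calc _ ≤ supportLength K (t₂ - t₁) (fun r => deriv γ (t₁ + r)) :=
          supportLength_mono hshift hKc (isCompact_upperPiece hKc) hne upperPiece_subset
      _ = ∫ r in (0 : ℝ)..t₂ - t₁, ⟪-(stdJ n (deriv γ (t₁ + r))), γ (t₁ + r)⟫ :=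
          supportLength_eq_integral_inner hshift.nonneg hKc (fun r hr => hγ.mem hKc (hmem r hr))
            (ae_restrict_Icc_zero_const_add h₁ h₂ hγ.velocity_mem)
      _ = ∫ t in t₁..t₂, ⟪-(stdJ n (deriv γ t)), γ t⟫ := by
          rw [intervalIntegral.integral_comp_add_left (f := fun t => ⟪-(stdJ n (deriv γ t)), γ t⟫),
            add_zero, add_sub_cancel]
  have hsegment : supportLength (upperPiece K u h) 1 (fun _ => γ t₁ - γ t₂) ≤ -(c * h) := by
    simp only [supportLength, neg_stdJ_sub_of_sub_eq hchord, intervalIntegral.integral_const,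
      sub_zero, one_smul]
    exact supportFn_upperPiece_neg_smul_le hne hc.le
  rw [hshift.supportLength_concat (hasVelocity_segmentPath _ _) (isCompact_upperPiece hKc) hne,
    action_innerLoop hv h₁ h₁₂.le h₂ hH₁ hH₂ hchord]
  linarith

theorem ehzCapacity_upperPiece_le_action_innerLoop (hγ : IsClosedCharacteristic K T γ)
    (hs : SplitsAt u h T γ t₁ t₂) (hK : Convex ℝ K) (hKc : IsCompact K) (hu : u ≠ 0)
    (hcut : (interior K ∩ hyperplane u h).Nonempty) :
    ehzCapacity (upperPiece K u h) ≤ action (t₂ - t₁ + 1) (innerLoop γ t₁ t₂) := by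
  have : Nontrivial (PhaseSpace n) := nontrivial_of_ne u 0 hu
  have hi := interior_upperPiece_nonempty hu hcut
  have hKc' : IsCompact (upperPiece K u h) := isCompact_upperPiece hKc
  have hloop := hγ.hasVelocity.innerLoop hs.1 hs.2.1.le hs.2.2.1
  have hclosed := innerLoop_closed (γ := γ) hs.2.1.le
  have hL := hγ.supportLength_innerLoop_le hs hKc (hi.mono interior_subset)
  have hpos := hloop.supportLength_pos hclosed hKc' hi (hs.exists_innerLoop_ne hu)
  exact hloop.ehzCapacity_le hclosed (convex_upperPiece hK) hKc' hi (by linarith) hL rfl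

end IsClosedCharacteristic

theorem innerLoop_mem (hK : Convex ℝ K) (hγ : ∀ t ∈ Icc 0 T, γ t ∈ K)
    (hs : SplitsAt u h T γ t₁ t₂) : ∀ t ∈ Icc 0 (t₂ - t₁ + 1), innerLoop γ t₁ t₂ t ∈ K :=
  concatAt_mem (fun _ hr => hγ _ (hs.add_mem hr)) fun _ ht =>
    hK.add_smul_sub_mem (hγ _ hs.right_mem) (hγ _ hs.left_mem) ht

/-- For the chord, `-J` of the velocity is a multiple of `u`, which is normal to the piece only at
points of the hyperplane. -/
theorem SplitsAt.inner_eq_zero_of_isClosedCharacteristic (hs : SplitsAt u h T γ t₁ t₂)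
    (hγ : HasVelocity T γ v) (hKc : IsCompact K) (hK : (K ∩ hyperplane u h).Nonempty)
    {x : PhaseSpace n} (hx : IsClosedCharacteristic (upperPiece K u h) (t₂ - t₁ + 1)
      (fun t => innerLoop γ t₁ t₂ t + x)) : ⟪u, x⟫ = 0 := by
  obtain ⟨h₁, h₁₂, h₂, hH₁, hH₂, c, hc, hchord⟩ := hs
  have hS : 0 ≤ t₂ - t₁ := sub_nonneg.2 h₁₂.le
  have hnormal := ((ae_concatAt_iff
    (P := fun w y => -(stdJ n w) ∈ normalCone (upperPiece K u h) (y + x)) hS zero_le_one).1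
    (hx.ae_mem_normalCone ((hγ.innerLoop h₁ h₁₂.le h₂).add_const x))).2
  have : NeBot (ae (volume.restrict (Icc (0 : ℝ) 1))) :=
    ae_neBot.2 (mt Measure.restrict_eq_zero.1 (by simp))
  obtain ⟨t, ht, htI⟩ := (hnormal.and (ae_restrict_mem measurableSet_Icc)).exists
  have hmem := hx.mem (isCompact_upperPiece hKc) (t := t₂ - t₁ + t)
    ⟨add_nonneg hS htI.1, add_le_add_right htI.2 _⟩
  rw [innerLoop, concatAt_add (by rw [add_sub_cancel, segmentPath_zero]) htI.1] at hmem
  rw [neg_stdJ_sub_of_sub_eq hchord] at ht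
  have hlevel : ⟪u, _⟫ = h := mem_hyperplane_of_neg_smul_mem_normalCone hK hmem hc ht
  rwa [inner_add_right, show ⟪u, _⟫ = h from segmentPath_mem_hyperplane hH₂ hH₁ t,
    add_eq_left] at hlevel

theorem IsClosedCharacteristic.isSystole_innerLoop (hγ : IsClosedCharacteristic K T γ)
    (hs : SplitsAt u h T γ t₁ t₂) (hK : Convex ℝ K) (hKc : IsCompact K) (hu : u ≠ 0)
    (hcut : (interior K ∩ hyperplane u h).Nonempty)
    (hA : action (t₂ - t₁ + 1) (innerLoop γ t₁ t₂) ≤ ehzCapacity (upperPiece K u h)) :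
    IsSystole (upperPiece K u h) (t₂ - t₁ + 1) (innerLoop γ t₁ t₂) := by
  have : Nontrivial (PhaseSpace n) := nontrivial_of_ne u 0 hu
  have hK' : Convex ℝ (upperPiece K u h) := convex_upperPiece hK
  have hKc' : IsCompact (upperPiece K u h) := isCompact_upperPiece hKc
  have hi := interior_upperPiece_nonempty hu hcut
  have hloop := hγ.hasVelocity.innerLoop hs.1 hs.2.1.le hs.2.2.1
  have hclosed := innerLoop_closed (γ := γ) hs.2.1.le
  have hL := hγ.supportLength_innerLoop_le hs hKc (hi.mono interior_subset)
  obtain ⟨x, hx⟩ := hloop.exists_translate_isSystole hclosed hK' hKc' hi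
    (hL.trans (mul_le_mul_of_nonneg_left hA zero_le_two))
    (hγ.ehzCapacity_upperPiece_le_action_innerLoop hs hK hKc hu hcut)
  have hux : ⟪u, x⟫ = 0 := hs.inner_eq_zero_of_isClosedCharacteristic hγ.hasVelocity hKc
    (hcut.mono (inter_subset_inter_left _ interior_subset)) hx.1
  have hmem : ∀ t ∈ Icc 0 (t₂ - t₁ + 1), innerLoop γ t₁ t₂ t ∈ upperPiece K u h := fun t ht => by
    have hlevel : h ≤ ⟪u, innerLoop γ t₁ t₂ t + x⟫ := (hx.1.mem hKc' ht).2
    rw [inner_add_right, hux, add_zero] at hlevel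
    exact ⟨innerLoop_mem hK (fun _ => hγ.mem hKc) hs t ht, hlevel⟩
  exact (hloop.isClosedCharacteristic_of_supportLength_le hclosed hKc' hmem hL
    (hs.exists_innerLoop_ne hu)).isSystole hK' hKc' hi hA

theorem outerLoop_eq_innerLoop (hc : γ 0 = γ T) (h₁ : 0 ≤ t₁) (h₂ : t₂ ≤ T) :
    outerLoop T γ t₁ t₂ = innerLoop (rotate T t₂ γ) 0 (T - t₂ + t₁) := by
  simp only [outerLoop, innerLoop, rotate_sub_add hc h₁, rotate_zero h₂, zero_add, sub_zero]

protected theorem SplitsAt.rotate (hs : SplitsAt u h T γ t₁ t₂) (hu : u ≠ 0) (hc : γ 0 = γ T) :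
    SplitsAt (-u) (-h) T (rotate T t₂ γ) 0 (T - t₂ + t₁) := by
  have hne := hs.apply_ne hu
  obtain ⟨h₁, h₁₂, h₂, hH₁, hH₂, c, hcpos, hchord⟩ := hs
  rw [SplitsAt, hyperplane_neg, rotate_zero h₂, rotate_sub_add hc h₁]
  refine ⟨le_rfl, lt_of_le_of_ne (by linarith) fun hzero => hne ?_, by linarith, hH₂, hH₁, c,
    hcpos, by rw [map_neg, smul_neg, ← hchord, neg_sub]⟩
  rw [show t₂ = T by linarith, show t₁ = 0 by linarith, hc]

theorem SplitsAt.action_innerLoop_add_action_outerLoop (hs : SplitsAt u h T γ t₁ t₂) (hu : u ≠ 0)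
    (hγ : HasVelocity T γ v) (hc : γ 0 = γ T) :
    action (t₂ - t₁ + 1) (innerLoop γ t₁ t₂) + action (T - t₂ + t₁ + 1) (outerLoop T γ t₁ t₂) =
      action T γ := by
  have hi := hγ.intervalIntegrable_inner_neg_stdJ hγ.continuousOn
  have hs' := hs.rotate hu hc
  have m₁ : t₁ ∈ uIcc 0 T := Icc_subset_uIcc hs.left_mem
  have m₂ : t₂ ∈ uIcc 0 T := Icc_subset_uIcc hs.right_mem
  have hrotate := hγ.integral_inner_rotate hs.right_mem hs.left_mem
  have houter := hγ.rotate hc hs.right_mem hs.left_mem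
  obtain ⟨h₁, h₁₂, h₂, hH₁, hH₂, c, -, hchord⟩ := hs
  obtain ⟨-, h₁₂', -, hH₂', hH₁', -⟩ := hs'
  have hchord' : rotate T t₂ γ (T - t₂ + t₁) - rotate T t₂ γ 0 = c • stdJ n (-u) := by
    rw [rotate_zero h₂, rotate_sub_add hc h₁, map_neg, smul_neg, ← hchord, neg_sub]
  have hsplit := intervalIntegral.integral_add_adjacent_intervals
    (hi.mono_set (uIcc_subset_uIcc left_mem_uIcc m₁)) (hi.mono_set (uIcc_subset_uIcc m₁ m₂))
  have hsplit' := intervalIntegral.integral_add_adjacent_intervals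
    (hi.mono_set (uIcc_subset_uIcc left_mem_uIcc m₂))
    (hi.mono_set (uIcc_subset_uIcc m₂ right_mem_uIcc))
  have haction := action_innerLoop houter le_rfl h₁₂'.le le_rfl hH₂' hH₁' hchord'
  rw [hrotate, ← outerLoop_eq_innerLoop hc h₁ h₂, sub_zero] at haction
  rw [action_innerLoop hγ h₁ h₁₂.le h₂ hH₁ hH₂ hchord, haction, hγ.action_eq]
  linarith

end Split

section Additive

variable {n : ℕ} {K : Set (PhaseSpace n)} {u : PhaseSpace n} {h T T₁ T₂ t₁ t₂ a₁ a₂ : ℝ}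
  {γ γ₁ γ₂ : ℝ → PhaseSpace n}

theorem ehzCapacity_upperPiece_pos (hK : Convex ℝ K) (hKc : IsCompact K) (hu : u ≠ 0)
    (hcut : (interior K ∩ hyperplane u h).Nonempty) : 0 < ehzCapacity (upperPiece K u h) :=
  have : Nontrivial (PhaseSpace n) := nontrivial_of_ne u 0 hu
  ehzCapacity_pos (convex_upperPiece hK) (isCompact_upperPiece hKc)
    (interior_upperPiece_nonempty hu hcut)

theorem ehzCapacity_le_add (hK : Convex ℝ K) (hKc : IsCompact K) (hu : u ≠ 0)
    (hcut : (interior K ∩ hyperplane u h).Nonempty) :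
    ehzCapacity K ≤ ehzCapacity (upperPiece K u h) + ehzCapacity (lowerPiece K u h) := by
  have : Nontrivial (PhaseSpace n) := nontrivial_of_ne u 0 hu
  have hu' : -u ≠ 0 := neg_ne_zero.2 hu
  have hcut' : (interior K ∩ hyperplane (-u) (-h)).Nonempty := by rwa [hyperplane_neg]
  rw [lowerPiece_eq_upperPiece]
  obtain ⟨T₁, γ₁, h₁⟩ := exists_isSystole (convex_upperPiece hK) (isCompact_upperPiece hKc)
    (interior_upperPiece_nonempty hu hcut)
  obtain ⟨T₂, γ₂, h₂⟩ := exists_isSystole (convex_upperPiece hK) (isCompact_upperPiece hKc)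
    (interior_upperPiece_nonempty hu' hcut')
  have hA₁ := ehzCapacity_upperPiece_pos hK hKc hu hcut
  have hA₂ := ehzCapacity_upperPiece_pos hK hKc hu' hcut'
  by_contra! hlt
  obtain ⟨-, -, _, _, _, harc₁, -⟩ :=
    h₁.1.exists_stripsTo hK hKc hu hcut (by rw [h₁.action_eq]; linarith)
  obtain ⟨-, -, _, _, _, harc₂, -⟩ :=
    h₂.1.exists_stripsTo hK hKc hu' hcut' (by rw [h₂.action_eq]; linarith)
  rw [h₁.action_eq] at harc₁
  rw [h₂.action_eq] at harc₂
  exact hlt.not_ge (harc₁.ehzCapacity_le_add harc₂ hK hKc (hcut.mono inter_subset_left) hA₁ hA₂)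

theorem IsSystole.isSystole_innerLoop_and_outerLoop (hγ : IsSystole K T γ)
    (hs : SplitsAt u h T γ t₁ t₂) (hK : Convex ℝ K) (hKc : IsCompact K) (hu : u ≠ 0)
    (hcut : (interior K ∩ hyperplane u h).Nonempty) :
    IsSystole (upperPiece K u h) (t₂ - t₁ + 1) (innerLoop γ t₁ t₂) ∧
      IsSystole (lowerPiece K u h) (T - t₂ + t₁ + 1) (outerLoop T γ t₁ t₂) := by
  have hu' : -u ≠ 0 := neg_ne_zero.2 hu
  have hcut' : (interior K ∩ hyperplane (-u) (-h)).Nonempty := by rwa [hyperplane_neg]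
  have hrot := isClosedCharacteristic_rotate hγ.1 hs.right_mem
  have hs' := hs.rotate hu hγ.1.closed
  have hsub := ehzCapacity_le_add hK hKc hu hcut
  have hsum := hs.action_innerLoop_add_action_outerLoop hu hγ.1.hasVelocity hγ.1.closed
  have hin := hγ.1.ehzCapacity_upperPiece_le_action_innerLoop hs hK hKc hu hcut
  have hout := hrot.ehzCapacity_upperPiece_le_action_innerLoop hs' hK hKc hu' hcut'
  have hsys := hrot.isSystole_innerLoop hs' hK hKc hu' hcut'
  rw [← outerLoop_eq_innerLoop hγ.1.closed hs.1 hs.2.2.1, sub_zero] at hout hsys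
  rw [lowerPiece_eq_upperPiece] at hsub ⊢
  rw [hγ.action_eq] at hsum
  exact ⟨hγ.1.isSystole_innerLoop hs hK hKc hu hcut (by linarith), hsys (by linarith)⟩

theorem IsSystole.isAdditiveCut (hγ : IsSystole K T γ) (hs : SplitsAt u h T γ t₁ t₂)
    (hK : Convex ℝ K) (hKc : IsCompact K) (hu : u ≠ 0)
    (hcut : (interior K ∩ hyperplane u h).Nonempty) : IsAdditiveCut K u h := by
  obtain ⟨hin, hout⟩ := hγ.isSystole_innerLoop_and_outerLoop hs hK hKc hu hcut
  rw [IsAdditiveCut, ← hγ.action_eq, ← hin.action_eq, ← hout.action_eq,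
    hs.action_innerLoop_add_action_outerLoop hu hγ.1.hasVelocity hγ.1.closed]

namespace IsAdditiveCut

theorem exists_stripsTo_glue (hadd : IsAdditiveCut K u h) (hK : Convex ℝ K) (hKc : IsCompact K)
    (hu : u ≠ 0) (hcut : (interior K ∩ hyperplane u h).Nonempty)
    (h₁ : IsSystole (upperPiece K u h) T₁ γ₁) (h₂ : IsSystole (lowerPiece K u h) T₂ γ₂) :
    ∃ s₁ ∈ Icc 0 T₁, ∃ s₂ ∈ Icc 0 T₂, ∃ η₁ η₂ : ℝ → PhaseSpace n,
      StripsTo K (hyperplane u h) u T₁ (rotate T₁ s₁ γ₁) η₁ ∧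
      StripsTo K (hyperplane u h) (-u) T₂ (rotate T₂ s₂ γ₂) η₂ ∧
      IsSystole K (T₁ + T₂) (concatAt T₁ η₁ η₂) ∧
      SplitsAt u h (T₁ + T₂) (concatAt T₁ η₁ η₂) 0 T₁ := by
  have : Nontrivial (PhaseSpace n) := nontrivial_of_ne u 0 hu
  have hu' : -u ≠ 0 := neg_ne_zero.2 hu
  have hcut' : (interior K ∩ hyperplane (-u) (-h)).Nonempty := by rwa [hyperplane_neg]
  rw [IsAdditiveCut, lowerPiece_eq_upperPiece] at hadd
  rw [lowerPiece_eq_upperPiece] at h₂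
  have hA₁ := ehzCapacity_upperPiece_pos hK hKc hu hcut
  have hA₂ := ehzCapacity_upperPiece_pos hK hKc hu' hcut'
  obtain ⟨s₁, hs₁, _, _, _, harc₁, hstrip₁⟩ :=
    h₁.1.exists_stripsTo hK hKc hu hcut (by rw [h₁.action_eq]; linarith)
  obtain ⟨s₂, hs₂, _, _, _, harc₂, hstrip₂⟩ :=
    h₂.1.exists_stripsTo hK hKc hu' hcut' (by rw [h₂.action_eq]; linarith)
  rw [h₁.action_eq] at harc₁
  rw [h₂.action_eq] at harc₂
  rw [hyperplane_neg] at hstrip₂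
  obtain ⟨x₁, x₂, hsystole, hsplits⟩ := harc₁.exists_isSystole_concatAt harc₂ hu hK hKc
    (hcut.mono inter_subset_left) hA₁ hA₂ hadd
  exact ⟨s₁, hs₁, s₂, hs₂, _, _, hstrip₁ x₁, hstrip₂ x₂, hsystole, hsplits⟩

theorem exists_glue_of_isArcThenChord (hadd : IsAdditiveCut K u h) (hK : Convex ℝ K)
    (hKc : IsCompact K) (hu : u ≠ 0) (hcut : (interior K ∩ hyperplane u h).Nonempty)
    (h₁ : IsSystole (upperPiece K u h) T₁ γ₁) (h₂ : IsSystole (lowerPiece K u h) T₂ γ₂)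
    (ha₁ : IsArcThenChord K u T₁ a₁ γ₁) (ha₂ : IsArcThenChord K (-u) T₂ a₂ γ₂) :
    ∃ x₁ x₂ : PhaseSpace n,
      IsSystole K (a₁ + a₂) (concatAt a₁ (fun t => γ₁ t + x₁) (fun t => γ₂ t + x₂)) ∧
      SplitsAt u h (a₁ + a₂) (concatAt a₁ (fun t => γ₁ t + x₁) (fun t => γ₂ t + x₂)) 0 a₁ := by
  have : Nontrivial (PhaseSpace n) := nontrivial_of_ne u 0 hu
  have hu' : -u ≠ 0 := neg_ne_zero.2 hu
  have hcut' : (interior K ∩ hyperplane (-u) (-h)).Nonempty := by rwa [hyperplane_neg]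
  rw [IsAdditiveCut, lowerPiece_eq_upperPiece] at hadd
  rw [lowerPiece_eq_upperPiece] at h₂
  obtain ⟨_, harc₁⟩ := ha₁.exists_isBalancedArc h₁.1 hKc
    (hcut.mono (inter_subset_inter_left _ interior_subset))
  obtain ⟨_, harc₂⟩ := ha₂.exists_isBalancedArc h₂.1 hKc
    (hcut'.mono (inter_subset_inter_left _ interior_subset))
  rw [h₁.action_eq] at harc₁
  rw [h₂.action_eq] at harc₂
  exact harc₁.exists_isSystole_concatAt harc₂ hu hK hKc (hcut.mono inter_subset_left)
    (ehzCapacity_upperPiece_pos hK hKc hu hcut) (ehzCapacity_upperPiece_pos hK hKc hu' hcut') hadd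

theorem exists_isSystole_splitsAt (hadd : IsAdditiveCut K u h) (hK : Convex ℝ K)
    (hKc : IsCompact K) (hu : u ≠ 0) (hcut : (interior K ∩ hyperplane u h).Nonempty) :
    ∃ (T : ℝ) (γ : ℝ → PhaseSpace n) (t₁ t₂ : ℝ), IsSystole K T γ ∧ SplitsAt u h T γ t₁ t₂ := by
  have : Nontrivial (PhaseSpace n) := nontrivial_of_ne u 0 hu
  obtain ⟨T₁, γ₁, h₁⟩ := exists_isSystole (convex_upperPiece hK) (isCompact_upperPiece hKc)
    (interior_upperPiece_nonempty hu hcut)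
  obtain ⟨T₂, γ₂, h₂⟩ := exists_isSystole (convex_upperPiece (u := -u) (h := -h) hK)
    (isCompact_upperPiece hKc)
    (interior_upperPiece_nonempty (neg_ne_zero.2 hu) (by rwa [hyperplane_neg]))
  rw [← lowerPiece_eq_upperPiece] at h₂
  obtain ⟨-, -, -, -, η₁, η₂, -, -, hsystole, hsplits⟩ :=
    hadd.exists_stripsTo_glue hK hKc hu hcut h₁ h₂
  exact ⟨_, _, _, _, hsystole, hsplits⟩

end IsAdditiveCut

end Additive

end

theorem mainTheorem3 (n : ℕ) (K : Set (PhaseSpace n)) (hK : Convex ℝ K) (hKc : IsCompact K)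
    (u : PhaseSpace n) (hu : ‖u‖ = 1) (h : ℝ)
    (hcut : (interior K ∩ hyperplane u h).Nonempty) :
    -- additivity is equivalent to the existence of a systole that splits along the hyperplane
    (IsAdditiveCut K u h ↔
      ∃ (T : ℝ) (γ : ℝ → PhaseSpace n) (t₁ t₂ : ℝ),
        IsSystole K T γ ∧ SplitsAt u h T γ t₁ t₂) ∧
    -- each such systole splits into systoles of the two pieces
    (∀ (T : ℝ) (γ : ℝ → PhaseSpace n) (t₁ t₂ : ℝ),
      IsSystole K T γ → SplitsAt u h T γ t₁ t₂ →
        IsSystole (upperPiece K u h) ((t₂ - t₁) + 1) (innerLoop γ t₁ t₂) ∧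
        IsSystole (lowerPiece K u h) ((T - t₂ + t₁) + 1) (outerLoop T γ t₁ t₂)) ∧
    -- for an additive cut, each pair of systoles of the two pieces can be glued
    (IsAdditiveCut K u h →
      ∀ (T₁ T₂ : ℝ) (γ₁ γ₂ : ℝ → PhaseSpace n),
        IsSystole (upperPiece K u h) T₁ γ₁ → IsSystole (lowerPiece K u h) T₂ γ₂ →
        -- after a choice of starting points, delete the motions of the two systoles along the
        -- hyperplane in the directions `∓ J u`, translate, and concatenate
        (∃ s₁ ∈ Icc 0 T₁, ∃ s₂ ∈ Icc 0 T₂, ∃ η₁ η₂ : ℝ → PhaseSpace n,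
          StripsTo K (hyperplane u h) u T₁ (rotate T₁ s₁ γ₁) η₁ ∧
          StripsTo K (hyperplane u h) (-u) T₂ (rotate T₂ s₂ γ₂) η₂ ∧
          IsSystole K (T₁ + T₂) (concatAt T₁ η₁ η₂) ∧
          SplitsAt u h (T₁ + T₂) (concatAt T₁ η₁ η₂) 0 T₁) ∧
        -- if the motion along the hyperplane is a single chord for each of the two systoles, then
        -- their remaining arcs, each translated as a whole, concatenate to a systole
        (∀ a₁ a₂ : ℝ, IsArcThenChord K u T₁ a₁ γ₁ → IsArcThenChord K (-u) T₂ a₂ γ₂ →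
          ∃ x₁ x₂ : PhaseSpace n,
            IsSystole K (a₁ + a₂) (concatAt a₁ (fun t => γ₁ t + x₁) (fun t => γ₂ t + x₂)) ∧
            SplitsAt u h (a₁ + a₂)
              (concatAt a₁ (fun t => γ₁ t + x₁) (fun t => γ₂ t + x₂)) 0 a₁)) := by
  have hu₀ : u ≠ 0 := norm_ne_zero_iff.1 (hu.trans_ne one_ne_zero)
  refine ⟨⟨fun hadd => hadd.exists_isSystole_splitsAt hK hKc hu₀ hcut, ?_⟩, ?_, ?_⟩
  · rintro ⟨T, γ, t₁, t₂, hγ, hs⟩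
    exact hγ.isAdditiveCut hs hK hKc hu₀ hcut
  · intro T γ t₁ t₂ hγ hs
    exact hγ.isSystole_innerLoop_and_outerLoop hs hK hKc hu₀ hcut
  · intro hadd T₁ T₂ γ₁ γ₂ h₁ h₂
    refine ⟨hadd.exists_stripsTo_glue hK hKc hu₀ hcut h₁ h₂, fun a₁ a₂ ha₁ ha₂ => ?_⟩
    exact hadd.exists_glue_of_isArcThenChord hK hKc hu₀ hcut h₁ h₂ ha₁ ha₂
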